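/- **Setting.** Let $G$ be a finite tree with edges $e_1,\dots,e_m$ of length $\pi$, each parametrized by $x_j\in[0,\pi]$. On $e_j$ let $q_j=\sigma_j'$ with a real-valued $\sigma_j\in L_2(0,\pi)$, let $\gamma_j\in\mathbb R$, let $y_j^{[1]}:=y_j'-\sigma_jy_j$, and understand $-y_j''+q_jy_j=\lambda y_j$ as $-(y_j^{[1]})'-\sigma_jy_j^{[1]}-\sigma_j^2y_j=\lambda y_j$ with $y_j,\,y_j^{[1]}$ absolutely continuous. At the end $u$ of $e_j$ with $x_j=0$ put $y_j(u)=y_j(0)$, $y_j^{[1]}(u)=-y_j^{[1]}(0)$; at the end $v$ with $x_j=\pi$ put $y_j(v)=y_j(\pi)$, $y^{[1]}_j(v)=y_j^{[1]}(\pi)+\gamma_jy_j(\pi)$. Let $L$ be the boundary value problem consisting of these equations, continuity and Kirchhoff's condition $\sum_{e_j\ni v}y_j^{[1]}(v)=0$ at every internal vertex, and at each boundary vertex (vertex of degree $1$) either the Dirichlet condition $y(v)=0$ or the Neumann condition $y^{[1]}(v)=0$. Let $\Lambda(L)$ be its spectrum (the set of its eigenvalues). *Characteristic functions.* Let $C_j,S_j$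 be the solutions on $e_j$ with $C_j(0,\lambda)=S_j^{[1]}(0,\lambda)=1$, $C_j^{[1]}(0,\lambda)=S_j(0,\lambda)=0$. For a single edge $e_j$ the characteristic function is $S_j(\pi,\lambda)$, $S_j^{[1]}(\pi,\lambda)+\gamma_jS_j(\pi,\lambda)$, $C_j(\pi,\lambda)$, $C_j^{[1]}(\pi,\lambda)+\gamma_jC_j(\pi,\lambda)$ for the Dirichlet–Dirichlet, Dirichlet–Neumann, Neumann–Dirichlet and Neumann–Neumann conditions at $x_j=0$ and $x_j=\pi$, respectively. For a tree with more edges one splits it at an internal vertex $u$ into subtrees $G_j$ and puts $\Delta=\sum_j\Delta_j^N\prod_{k\ne j}\Delta_k^D$, where $\Delta_j^D,\Delta_j^N$ are the characteristic functions of $G_j$ with the Dirichlet and the Neumann condition at $u$. Let $G$ be divided into two connected subtrees $G_{known}$, $G_{unknown}$, each with at least one edge, whose only common vertex is $w$. For each of them, split it at $w$ into subtrees $G_j$ and put $\Delta^K=\sum_j\Delta_j^N\prod_{k\ne j}\Delta_k^D$ and $\Delta^\Pi=\prod_j\Delta_j^D$, where $\Delta_j^D,\Delta_j^N$ correspond to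 $G_j$ with the Dirichlet and the Neumann condition at $w$ and the conditions of $L$ at all other vertices. This gives $\Delta^K_{known},\Delta^\Pi_{known},\Delta^K_{unknown},\Delta^\Pi_{unknown}$. Let $l$ be the number of edges of $G_{unknown}$ and $r$ the number of the boundary vertices of $G$ in $G_{unknown}$ with the Dirichlet condition; let $r$ be odd. Let $\alpha_1,\dots,\alpha_l\in(0,\tfrac12)$ and let $\lambda_{nk}=\rho_{nk}^2\in\Lambda(L)$, $n\in\mathbb Z$, $k=1,\dots,l$, be eigenvalues with real $\rho_{nk}=n+\alpha_k+\varkappa_{nk}$, $\sum_{n\in\mathbb Z}\varkappa_{nk}^2<\infty$ for each $k$. Let $\Lambda'$ be the family of all $\lambda_{nk}$ except $\lambda_{11},\lambda_{21},\dots,\lambda_{r-1,1}$. Put, for $\lambda\in\Lambda'$ with $\rho=\sqrt\lambda$, and for $j=0,\dots,r-2$, $$ s(t,\lambda)=\begin{bmatrix}\Delta^K_{known}(\lambda)\,\rho^{-1}\sin\rho t\\ \Delta^\Pi_{known}(\lambda)\cos\rho t\end{bmatrix},\qquad s_j(t)=\begin{bmatrix}0\\ t^j\end{bmatrix}\ (j\text{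 even}),\qquad s_j(t)=\begin{bmatrix}t^j\\ 0\end{bmatrix}\ (j\text{ odd}).$$ **Theorem 3.** Assume that ($A_1$) the members of $\Lambda'$ are pairwise distinct and positive; ($A_2$) $\Delta^\Pi_{known}(\lambda)\neq0$ and $\Delta^\Pi_{unknown}(\lambda)\ne0$ for all $\lambda\in\Lambda'$; ($A_3$) $\Delta^K_{unknown}(0)\ne0$ and $\Delta^\Pi_{unknown}(0)\neq0$; ($A_4$) $\Delta^K_{unknown}$ and $\Delta^\Pi_{unknown}$ have no common zeros in $\mathbb C$. Then the system $\mathcal S=\{s(\cdot,\lambda)\}_{\lambda\in\Lambda'}\cup\{s_j\}_{j=0}^{r-2}$ is complete in the real Hilbert space $L_2(0,l\pi)\oplus L_2(0,l\pi)$, i.e. its linear span is dense. -/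

import Mathlib

open MeasureTheory Set

noncomputable section

namespace QTree

/-! ### The Sturm–Liouville equation with a singular potential on one edge -/

/-- `Y = (y, y^{[1]})` solves `-(y^{[1]})' - σ y^{[1]} - σ² y = z y`, `y^{[1]} = y' - σ y`, on
`[0, π]`, i.e. `-y'' + σ' y = z y`. The first-order system
`y' = σ y + y^{[1]}`, `(y^{[1]})' = -σ y^{[1]} - σ² y - z y` is written in integrated form:
`y` and `y^{[1]}` are absolutely continuous and the system holds almost everywhere. -/
structure IsSolution (σ : ℝ → ℝ) (z : ℂ) (Y : ℝ → ℂ × ℂ) : Prop where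
  continuousOn : ContinuousOn Y (Icc 0 Real.pi)
  value : ∀ x ∈ Icc 0 Real.pi,
    (Y x).1 = (Y 0).1 + ∫ t in (0 : ℝ)..x, ((σ t : ℂ) * (Y t).1 + (Y t).2)
  quasiDeriv : ∀ x ∈ Icc 0 Real.pi,
    (Y x).2 = (Y 0).2 -
      ∫ t in (0 : ℝ)..x, ((σ t : ℂ) * (Y t).2 + (σ t : ℂ) ^ 2 * (Y t).1 + z * (Y t).1)

/-- The solution `(y, y^{[1]})` with initial data `y(0) = a`, `y^{[1]}(0) = b`
(for `σ ∈ L₂(0, π)` it exists and is unique on `[0, π]`). -/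
def solution (σ : ℝ → ℝ) (z a b : ℂ) : ℝ → ℂ × ℂ :=
  Classical.epsilon fun Y => IsSolution σ z Y ∧ Y 0 = (a, b)

/-- `C(·, z)` together with its quasi-derivative: `C(0) = 1`, `C^{[1]}(0) = 0`. -/
def solC (σ : ℝ → ℝ) (z : ℂ) : ℝ → ℂ × ℂ := solution σ z 1 0

/-- `S(·, z)` together with its quasi-derivative: `S(0) = 0`, `S^{[1]}(0) = 1`. -/
def solS (σ : ℝ → ℝ) (z : ℂ) : ℝ → ℂ × ℂ := solution σ z 0 1

/-- The type of a boundary condition at a vertex: Dirichlet `y(v) = 0` or Neumann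
`y^{[1]}(v) = 0`. -/
inductive BC where
  | dirichlet
  | neumann

/-- The characteristic function of a single edge, with the given conditions at `x = 0` and at
`x = π`. The Neumann condition at `x = π` is `y^{[1]}(π) + γ y(π) = 0`. -/
def edgeChar (σ : ℝ → ℝ) (γ : ℝ) (z : ℂ) : BC → BC → ℂ
  | .dirichlet, .dirichlet => (solS σ z Real.pi).1
  | .dirichlet, .neumann => (solS σ z Real.pi).2 + γ * (solS σ z Real.pi).1
  | .neumann, .dirichlet => (solC σ z Real.pi).1
  | .neumann, .neumann => (solC σ z Real.pi).2 + γ * (solC σ z Real.pi).1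

/-! ### The boundary value problem on a tree -/

/-- The boundary value problem `L` on a compact tree all of whose edges have length `π`:
the tree, the parametrization of each edge (`src e` is its end `x = 0`, `tgt e` its end `x = π`),
the potentials `q_e = σ_e'` with `σ_e ∈ L₂(0, π)`, the constants `γ_e`, and the types of the
boundary conditions (`bc` is only used at the boundary vertices). -/
structure Problem (V : Type*) where
  G : SimpleGraph V
  isTree : G.IsTree
  src : G.edgeSet → V
  tgt : G.edgeSet → V
  ends : ∀ e : G.edgeSet, (e : Sym2 V) = s(src e, tgt e)
  σ : G.edgeSet → ℝ → ℝ
  memLp : ∀ e, MemLp (σ e) 2 (volume.restrict (Ioo 0 Real.pi))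
  γ : G.edgeSet → ℝ
  bc : V → BC

namespace Problem

variable {V : Type*} (P : Problem V)

/-- Boundary vertices are the vertices of degree `1`. -/
def IsBoundary (v : V) : Prop := (P.G.neighborSet v).ncard = 1

open Classical in
/-- `y_e(v)`, for an end `v` of the edge `e`. -/
def valueAt (Y : P.G.edgeSet → ℝ → ℂ × ℂ) (e : P.G.edgeSet) (v : V) : ℂ :=
  if v = P.src e then (Y e 0).1 else (Y e Real.pi).1

open Classical in
/-- `y_e^{[1]}(v)`, for an end `v` of the edge `e`: it is `-y^{[1]}(0)` at the end `x = 0` and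
`y^{[1]}(π) + γ y(π)` at the end `x = π`. -/
def derivAt (Y : P.G.edgeSet → ℝ → ℂ × ℂ) (e : P.G.edgeSet) (v : V) : ℂ :=
  if v = P.src e then -(Y e 0).2 else (Y e Real.pi).2 + P.γ e * (Y e Real.pi).1

open Classical in
/-- `Y` solves the boundary value problem with spectral parameter `z`: the equation on every edge,
continuity and Kirchhoff's condition in the internal vertices, and the Dirichlet or the Neumann
condition in the boundary vertices. -/
structure Solves [Fintype V] (z : ℂ) (Y : P.G.edgeSet → ℝ → ℂ × ℂ) : Prop where
  equation : ∀ e, IsSolution (P.σ e) z (Y e)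
  continuity : ∀ v, ¬ P.IsBoundary v → ∀ e f : P.G.edgeSet, v ∈ (e : Sym2 V) → v ∈ (f : Sym2 V) →
    P.valueAt Y e v = P.valueAt Y f v
  kirchhoff : ∀ v, ¬ P.IsBoundary v →
    ∑ e : {e : P.G.edgeSet // v ∈ (e : Sym2 V)}, P.derivAt Y e.1 v = 0
  dirichlet : ∀ v, P.IsBoundary v → P.bc v = .dirichlet →
    ∀ e : P.G.edgeSet, v ∈ (e : Sym2 V) → P.valueAt Y e v = 0
  neumann : ∀ v, P.IsBoundary v → P.bc v = .neumann →
    ∀ e : P.G.edgeSet, v ∈ (e : Sym2 V) → P.derivAt Y e v = 0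

/-- The spectrum `Λ(L)`: the set of the eigenvalues. -/
def spectrum [Fintype V] : Set ℂ :=
  {z | ∃ Y, P.Solves z Y ∧ ∃ e, ∃ x ∈ Icc 0 Real.pi, (Y e x).1 ≠ 0}

/-! ### Characteristic functions -/

open Classical in
/-- The characteristic function of the one-edge tree `{u, v}` with the condition `b` in `u` and the
condition `b'` in `v`. -/
def edgeCharAt (z : ℂ) {u v : V} (h : P.G.Adj u v) (b b' : BC) : ℂ :=
  if P.src ⟨s(u, v), h⟩ = u then edgeChar (P.σ ⟨s(u, v), h⟩) (P.γ ⟨s(u, v), h⟩) z b b'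
  else edgeChar (P.σ ⟨s(u, v), h⟩) (P.γ ⟨s(u, v), h⟩) z b' b

open Classical in
/-- The number of vertices on the `v`-side of the edge `{u, v}`. -/
def sideCard [Fintype V] (u v : V) : ℕ :=
  (Finset.univ.filter fun x => P.G.dist x v < P.G.dist x u).card

theorem sideCard_lt [Fintype V] {u v z : V} (huv : P.G.Adj u v) (hvz : P.G.Adj v z)
    (hne : z ≠ u) : P.sideCard v z < P.sideCard u v := by
  classical
  have huniq : ∀ (x : V) (y : V) (hy : P.G.Adj y v), P.G.dist x y < P.G.dist x v →
      ∃ p : P.G.Walk x v, p.IsPath ∧ p.penultimate = y := by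
    intro x y hy hlt
    obtain ⟨p, hp⟩ := P.isTree.connected.exists_walk_length_eq_dist x y
    have hd := P.isTree.dist_eq_dist_add_one_of_adj x hy
    refine ⟨p.concat hy, ?_, by simp⟩
    apply SimpleGraph.Walk.isPath_of_length_eq_dist
    rw [SimpleGraph.Walk.length_concat]
    omega
  apply Finset.card_lt_card
  rw [Finset.ssubset_iff_of_subset]
  · refine ⟨v, ?_, ?_⟩
    · simp only [Finset.mem_filter, Finset.mem_univ, true_and, SimpleGraph.dist_self]
      exact P.isTree.connected.pos_dist_of_ne huv.ne'
    · simp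
  · intro x hx
    simp only [Finset.mem_filter, Finset.mem_univ, true_and] at hx ⊢
    by_contra hcon
    have hlt : P.G.dist x u < P.G.dist x v :=
      lt_of_le_of_ne (not_lt.mp hcon) (P.isTree.dist_ne_of_adj x huv)
    obtain ⟨p, hp, hpu⟩ := huniq x u huv hlt
    obtain ⟨q, hq, hqz⟩ := huniq x z hvz.symm hx
    have hpq := (P.isTree.existsUnique_path x v).unique hp hq
    exact hne (by rw [← hqz, ← hpq, hpu])

open Classical in
/-- Split the tree at the vertex `u`. The subtree containing the edge `{u, v}` is the branch at `u`
through `v`; `branchChar b u v h z` is its characteristic function with the condition `b` in `u`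
(and the given conditions elsewhere). If `v` is a boundary vertex, the branch is a single edge.
Otherwise the branch is split at `v` into the edge `{u, v}` and the branches at `v` through the
other neighbours `x` of `v`, and `Δ = ∑ⱼ Δⱼᴺ ∏_{k ≠ j} Δₖᴰ` over these parts: the first summand
below is the term `j = {u, v}`, the second one collects the others. -/
def branchChar [Fintype V] (b : BC) (u v : V) (h : P.G.Adj u v) (z : ℂ) : ℂ :=
  if P.IsBoundary v then P.edgeCharAt z h b (P.bc v)
  else
    P.edgeCharAt z h b .neumann *
        ∏ x : {x // P.G.Adj v x ∧ x ≠ u}, branchChar .dirichlet v x.1 x.2.1 z +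
      ∑ x : {x // P.G.Adj v x ∧ x ≠ u}, branchChar .neumann v x.1 x.2.1 z *
        (P.edgeCharAt z h b .dirichlet *
          ∏ y ∈ Finset.univ.erase x, branchChar .dirichlet v y.1 y.2.1 z)
termination_by P.sideCard u v
decreasing_by
  all_goals first
    | exact P.sideCard_lt h x.2.1 x.2.2
    | exact P.sideCard_lt h y.2.1 y.2.2

/-- The tree is divided into two connected subtrees, each with at least one edge, whose only
common vertex is `w`. (In particular `w` is an internal vertex of the tree.) -/
structure IsDivision (Gknown Gunknown : P.G.Subgraph) (w : V) : Prop where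
  connected_known : Gknown.Connected
  connected_unknown : Gunknown.Connected
  edges_known : Gknown.edgeSet.Nonempty
  edges_unknown : Gunknown.edgeSet.Nonempty
  sup_eq_top : Gknown ⊔ Gunknown = ⊤
  inter_eq : Gknown.verts ∩ Gunknown.verts = {w}

open Classical in
/-- `Δ^Π(z) = ∏ⱼ Δⱼᴰ(z)`, over the subtrees `Gⱼ` into which the part `H` is split at `w`. -/
def charPi [Fintype V] (H : P.G.Subgraph) (w : V) (z : ℂ) : ℂ :=
  ∏ v : {v // H.Adj w v}, P.branchChar .dirichlet w v.1 v.2.adj_sub z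

open Classical in
/-- `Δ^K(z) = ∑ⱼ Δⱼᴺ(z) ∏_{k ≠ j} Δₖᴰ(z)`: the characteristic function of the part `H`, with the
standard matching conditions in `w` (the Neumann condition, if `w` has degree `1` in `H`). -/
def charK [Fintype V] (H : P.G.Subgraph) (w : V) (z : ℂ) : ℂ :=
  ∑ v : {v // H.Adj w v}, P.branchChar .neumann w v.1 v.2.adj_sub z *
    ∏ u ∈ Finset.univ.erase v, P.branchChar .dirichlet w u.1 u.2.adj_sub z

/-- The number of the Dirichlet boundary conditions for the part `H`. -/
def numDirichlet (H : P.G.Subgraph) : ℕ :=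
  {v | v ∈ H.verts ∧ P.IsBoundary v ∧ P.bc v = .dirichlet}.ncard

end Problem

/-! ### The space `L₂(0, a) ⊕ L₂(0, a)` and the system of vector functions -/

/-- The real Hilbert space `L₂(0, a) ⊕ L₂(0, a)`. -/
abbrev HSpace (a : ℝ) : Type :=
  WithLp 2 (Lp ℝ 2 (volume.restrict (Ioo 0 a)) × Lp ℝ 2 (volume.restrict (Ioo 0 a)))

theorem memLp_of_continuous (a : ℝ) {f : ℝ → ℝ} (hf : Continuous f) :
    MemLp f 2 (volume.restrict (Ioo 0 a)) := by
  obtain ⟨C, hC⟩ := isCompact_Icc.exists_bound_of_continuousOn (s := Icc 0 a) hf.continuousOn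
  refine MemLp.of_bound hf.aestronglyMeasurable C ?_
  filter_upwards [ae_restrict_mem measurableSet_Ioo] with x hx
  exact hC x (Ioo_subset_Icc_self hx)

/-- The vector function with the continuous components `f` and `g`. -/
def vec (a : ℝ) (f g : C(ℝ, ℝ)) : HSpace a :=
  WithLp.toLp 2 ((memLp_of_continuous a f.continuous).toLp f,
    (memLp_of_continuous a g.continuous).toLp g)

/-- `s(t, λ) = (Δ_known^K(λ) ρ⁻¹ sin ρt, Δ_known^Π(λ) cos ρt)`, `ρ = √λ > 0`, where `ΔK`, `ΔPi` are
the characteristic functions of the known part (which are real for real `λ`). -/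
def sVec (a : ℝ) (ΔK ΔPi : ℂ → ℂ) (lam : ℝ) : HSpace a :=
  vec a ⟨fun t => (ΔK lam).re * ((√lam)⁻¹ * Real.sin (√lam * t)), by fun_prop⟩
    ⟨fun t => (ΔPi lam).re * Real.cos (√lam * t), by fun_prop⟩

/-- `s_j(t) = (0, t^j)` for even `j` and `(t^j, 0)` for odd `j`. -/
def sMono (a : ℝ) (j : ℕ) : HSpace a :=
  if Even j then vec a 0 ⟨fun t => t ^ j, by fun_prop⟩
  else vec a ⟨fun t => t ^ j, by fun_prop⟩ 0

/-- The indices `(n, k)`, `n ∈ ℤ`, `k = 1, …, l`, without `(1, 1), …, (r - 1, 1)`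
(`k` is counted from `0` here). -/
def indexSet (l r : ℕ) : Set (ℤ × Fin l) :=
  {p | ¬ ((p.2 : ℕ) = 0 ∧ 1 ≤ p.1 ∧ p.1 ≤ (r : ℤ) - 1)}

/-- A system of vectors is complete if its linear span is dense. -/
def IsCompleteSystem {a : ℝ} (S : Set (HSpace a)) : Prop :=
  (Submodule.span ℝ S).topologicalClosure = ⊤

end QTree

end

/-! Let `(h₁, h₂)` be orthogonal to the system, and put `F₁(ρ) = ∫ h₁ sin ρt`, `F₂(ρ) = ∫ h₂ cos ρt`
over `[0, lπ]`. Write `K`, `Π` for the two characteristic functions of the unknown part. The claim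
is that `F₁` and `F₂` vanish identically; then so do `h₁` and `h₂`.

At an eigenvalue the matching conditions at `w` give `K_known Π + Π_known K = 0`
(`IsDivision.charK_charPi_relation`). Together with orthogonality to `s(·, ρ²)` and `Π_known ≠ 0`
this yields `ρ Π(ρ²) F₂(ρ) = K(ρ²) F₁(ρ)` (`transform_relation`). Hence the odd entire function
`G(z) = z Π(z²) F₂(z) - K(z²) F₁(z)` vanishes at every `±ρ_nk` kept in the system.

Two further facts about `G` come from elsewhere. Orthogonality to the monomials `s_j` kills moments
of `h₁, h₂`, so `G` has a zero of order at least `r` at `0` (`le_analyticOrderAt_transform`). The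
asymptotics of the characteristic functions, namely `Π(-μ²) ~ c μ^{-r} e^{lπμ}` and `K(-μ²) ~ c'
μ^{1-r} e^{lπμ}` with `c, c' > 0` (`hasAsymp_charPi`, `hasAsymp_charK`), show that `z^{r-1} G(z)` is
`O(e^{2lπ|Im z|})`.

Jensen's formula compares zeros with growth. The full families `±ρ_nk` would contribute `4lN + O(1)`
on the circle of radius `N`, exactly what the growth permits. Deleting `r - 1` eigenvalues costs
`2(r-1) log N`, while the zero of order `2r - 1` at the origin gives back `(2r-1) log N`. The
surplus `log N` is impossible, so `G = 0` (`eq_zero_of_zeros`, `transform_identity`).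

Since `K` and `Π` have no common zeros, `Π(z²)` now divides `F₁`, and `F₁(z) = z^r Π(z²) Q(z)` with
`Q` entire (`exists_transform_quotient`). A quotient of functions of exponential type is of
exponential type, and away from the real axis `Q = O(|Im z|^{-1/2})` because `h₁` is square
integrable. Phragmén–Lindelöf in the four sectors between the diagonals and Liouville's theorem give
`Q = 0` (`sinTransform_eq_zero_of_quotient`). So `F₁ = 0`, and then `F₂ = 0`.

The analysis on an edge is done for the first-order system, since `σ` is only in `L₂`: a Volterra
equation gives existence, uniqueness and analyticity in `λ`, and Grönwall's inequality gives the
asymptotics. -/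

open MeasureTheory Set

noncomputable section

namespace QTree

/-! ### Primitives of integrable functions -/

/-- On `[0, b]` the function `F` is a primitive of the integrable function `f`. -/
structure IsPrimitive {E : Type*} [NormedAddCommGroup E] [NormedSpace ℝ E]
    (F f : ℝ → E) (b : ℝ) : Prop where
  integrable : IntervalIntegrable f volume 0 b
  eq_add : ∀ x ∈ Icc 0 b, F x = F 0 + ∫ t in (0 : ℝ)..x, f t

/-- The sums defining absolute continuity of `f` are at most `L` times those of `g`. It serves with
`g` the primitive of `‖f‖`, and for the exponential of an absolutely continuous function. -/
theorem absolutelyContinuousOnInterval_of_dist_le {E : Type*} [PseudoMetricSpace E]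
    {f : ℝ → E} {g : ℝ → ℝ} {a b L : ℝ} (hg : AbsolutelyContinuousOnInterval g a b)
    (h : ∀ x ∈ uIcc a b, ∀ y ∈ uIcc a b, dist (f x) (f y) ≤ L * dist (g x) (g y)) :
    AbsolutelyContinuousOnInterval f a b := by
  unfold AbsolutelyContinuousOnInterval at *
  have h2 := hg.const_mul L
  rw [mul_zero] at h2
  refine squeeze_zero' (Filter.Eventually.of_forall fun E => by positivity) ?_ h2
  filter_upwards [Filter.mem_inf_of_right (Filter.mem_principal_self _)] with E hE
  rw [Finset.mul_sum]
  refine Finset.sum_le_sum fun i hi => h _ ?_ _ ?_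
  · exact (hE.1 i hi).1
  · exact (hE.1 i hi).2

section

variable {E : Type*} [NormedAddCommGroup E] [NormedSpace ℝ E] {F f G g : ℝ → E} {b : ℝ}

theorem IsPrimitive.intervalIntegrable (h : IsPrimitive F f b) {x y : ℝ} (hx : x ∈ Icc 0 b)
    (hy : y ∈ Icc 0 b) : IntervalIntegrable f volume x y := by
  refine h.integrable.mono_set ?_
  have hb : (0 : ℝ) ≤ b := hx.1.trans hx.2
  rw [uIcc_of_le hb]
  exact uIcc_subset_Icc hx hy

theorem IsPrimitive.sub_eq (h : IsPrimitive F f b) {x y : ℝ} (hx : x ∈ Icc 0 b)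
    (hy : y ∈ Icc 0 b) : F y - F x = ∫ t in x..y, f t := by
  have h0 : (0 : ℝ) ∈ Icc 0 b := ⟨le_rfl, hx.1.trans hx.2⟩
  rw [h.eq_add x hx, h.eq_add y hy, ← intervalIntegral.integral_add_adjacent_intervals
    (h.intervalIntegrable h0 hx) (h.intervalIntegrable hx hy)]
  abel

theorem IsPrimitive.absolutelyContinuous (hb : 0 ≤ b) (h : IsPrimitive F f b) :
    AbsolutelyContinuousOnInterval F 0 b := by
  have hn : IntervalIntegrable (fun t => ‖f t‖) volume 0 b := h.integrable.norm
  refine absolutelyContinuousOnInterval_of_dist_le (L := 1)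
    (hn.absolutelyContinuousOnInterval_intervalIntegral (c := 0) (by simp)) ?_
  intro x hx y hy
  rw [uIcc_of_le hb] at hx hy
  rw [one_mul, dist_comm, dist_eq_norm, h.sub_eq hx hy, dist_comm, Real.dist_eq]
  have h0 : (0 : ℝ) ∈ Icc 0 b := ⟨le_rfl, hb⟩
  rw [intervalIntegral.integral_interval_sub_left (h.intervalIntegrable h0 hy).norm
    (h.intervalIntegrable h0 hx).norm]
  exact intervalIntegral.norm_integral_le_abs_integral_norm

theorem IsPrimitive.continuousOn (hb : 0 ≤ b) (h : IsPrimitive F f b) :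
    ContinuousOn F (Icc 0 b) := by
  have := (h.absolutelyContinuous hb).continuousOn
  rwa [uIcc_of_le hb] at this

theorem IsPrimitive.ae_hasDerivAt [CompleteSpace E] (h : IsPrimitive F f b) :
    ∀ᵐ x, x ∈ Ioo 0 b → HasDerivAt F (f x) x := by
  filter_upwards [h.integrable.ae_hasDerivAt_integral] with x hx hxb
  have hb : 0 ≤ b := (hxb.1.trans hxb.2).le
  have h1 := hx (by rw [uIcc_of_le hb]; exact Ioo_subset_Icc_self hxb) 0 (by simp)
  refine (h1.const_add (F 0)).congr_of_eventuallyEq ?_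
  filter_upwards [Ioo_mem_nhds hxb.1 hxb.2] with y hy
  exact h.eq_add y (Ioo_subset_Icc_self hy)

theorem ae_Ioo_of_uIcc {p : ℝ → Prop} (hb : 0 ≤ b) (h : ∀ᵐ x, x ∈ Ioo 0 b → p x) :
    ∀ᵐ x, x ∈ uIcc 0 b → p x := by
  have h₁ : ∀ᵐ x : ℝ, x ≠ 0 := by simp [ae_iff, measure_singleton]
  have h₂ : ∀ᵐ x : ℝ, x ≠ b := by simp [ae_iff, measure_singleton]
  filter_upwards [h, h₁, h₂] with x hx h1 h2 hxb
  rw [uIcc_of_le hb] at hxb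
  exact hx ⟨lt_of_le_of_ne hxb.1 h1.symm, lt_of_le_of_ne hxb.2 h2⟩

theorem isPrimitive_self (hf : IntervalIntegrable f volume 0 b) (c : E) :
    IsPrimitive (fun x => c + ∫ t in (0 : ℝ)..x, f t) f b :=
  ⟨hf, fun x _ => by simp⟩

/-- The difference of `F` and the integral of `f` is absolutely continuous with zero derivative
almost everywhere, hence constant. This gives product and chain rules for solutions that are not
continuously differentiable. -/
theorem isPrimitive_of_absolutelyContinuous [CompleteSpace E] (hb : 0 ≤ b)
    (hF : AbsolutelyContinuousOnInterval F 0 b) (hf : IntervalIntegrable f volume 0 b)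
    (h : ∀ᵐ x, x ∈ Ioo 0 b → HasDerivAt F (f x) x) : IsPrimitive F f b := by
  refine ⟨hf, fun x hx => ?_⟩
  have hI := isPrimitive_self hf (0 : E)
  have hac := hF.sub (hI.absolutelyContinuous hb)
  obtain ⟨C, hC⟩ := hac.const_of_ae_hasDerivAt_zero (ae_Ioo_of_uIcc hb (by
    filter_upwards [h, hI.ae_hasDerivAt] with x h1 h2 hx
    simpa using (h1 hx).sub (h2 hx)))
  have e1 := hC x (by rwa [uIcc_of_le hb])
  have e2 := hC 0 (by simp)
  simp at e1 e2
  rw [← e2, sub_eq_iff_eq_add] at e1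
  exact e1

theorem IsPrimitive.congr (hb : 0 ≤ b) (h : IsPrimitive F f b) (hF : EqOn F G (Icc 0 b))
    (hf : EqOn f g (Icc 0 b)) : IsPrimitive G g b := by
  have h0 : (0 : ℝ) ∈ Icc 0 b := ⟨le_rfl, hb⟩
  refine ⟨h.integrable.congr_uIoo ?_, fun x hx => ?_⟩
  · rw [uIoo_of_le hb]; exact hf.mono Ioo_subset_Icc_self
  rw [← hF hx, ← hF h0, h.eq_add x hx]
  congr 1
  refine intervalIntegral.integral_congr fun t ht => hf ?_
  exact uIcc_subset_Icc h0 hx ht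

theorem IsPrimitive.add (hF : IsPrimitive F f b) (hG : IsPrimitive G g b) :
    IsPrimitive (fun x => F x + G x) (fun x => f x + g x) b := by
  refine ⟨hF.integrable.add hG.integrable, fun x hx => ?_⟩
  have h0 : (0 : ℝ) ∈ Icc 0 b := ⟨le_rfl, hx.1.trans hx.2⟩
  rw [intervalIntegral.integral_add (hF.intervalIntegrable h0 hx) (hG.intervalIntegrable h0 hx),
    hF.eq_add x hx, hG.eq_add x hx]
  abel

theorem isPrimitive_of_hasDerivAt [CompleteSpace E] (h : ∀ x, HasDerivAt F (f x) x)
    (hf : Continuous f) : IsPrimitive F f b :=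
  ⟨hf.intervalIntegrable _ _, fun x _ => by
    rw [intervalIntegral.integral_eq_sub_of_hasDerivAt (fun x _ => h x) (hf.intervalIntegrable _ _)]
    abel⟩

end

/-! ### Products, powers and exponentials of primitives -/

section

variable {𝕂 : Type*} [RCLike 𝕂] {F f G g : ℝ → 𝕂} {b : ℝ}

theorem IsPrimitive.mul (hb : 0 ≤ b) (hF : IsPrimitive F f b) (hG : IsPrimitive G g b) :
    IsPrimitive (fun x => F x * G x) (fun x => f x * G x + F x * g x) b := by
  refine isPrimitive_of_absolutelyContinuous hb
    ((hF.absolutelyContinuous hb).smul (hG.absolutelyContinuous hb)) ?_ ?_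
  · exact (hF.integrable.mul_continuousOn (by
      rw [uIcc_of_le hb]; exact hG.continuousOn hb)).add (hG.integrable.continuousOn_mul (by
      rw [uIcc_of_le hb]; exact hF.continuousOn hb))
  · filter_upwards [hF.ae_hasDerivAt, hG.ae_hasDerivAt] with x h1 h2 hx
    exact (h1 hx).mul (h2 hx)

theorem IsPrimitive.const_mul (hF : IsPrimitive F f b) (c : 𝕂) :
    IsPrimitive (fun x => c * F x) (fun x => c * f x) b := by
  refine ⟨hF.integrable.const_mul c, fun x hx => ?_⟩
  rw [intervalIntegral.integral_const_mul, hF.eq_add x hx, mul_add]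

end

theorem IsPrimitive.pow {F f : ℝ → ℝ} {b : ℝ} (hb : 0 ≤ b) (hF : IsPrimitive F f b) (n : ℕ) :
    IsPrimitive (fun x => F x ^ (n + 1)) (fun x => (n + 1) * F x ^ n * f x) b := by
  induction n with
  | zero => simpa using hF
  | succ n ih =>
    refine (ih.mul hb hF).congr hb (fun x _ => by ring) (fun x _ => ?_)
    push_cast
    ring

theorem IsPrimitive.exp {F f : ℝ → ℝ} {b : ℝ} (hb : 0 ≤ b) (hF : IsPrimitive F f b) :
    IsPrimitive (fun x => Real.exp (F x)) (fun x => Real.exp (F x) * f x) b := by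
  obtain ⟨M, hM⟩ := isCompact_Icc.exists_bound_of_continuousOn (hF.continuousOn hb)
  refine isPrimitive_of_absolutelyContinuous hb ?_ ?_ ?_
  · refine absolutelyContinuousOnInterval_of_dist_le (L := Real.exp M)
      (hF.absolutelyContinuous hb) fun x hx y hy => ?_
    rw [uIcc_of_le hb] at hx hy
    rw [Real.dist_eq, Real.dist_eq, ← Real.norm_eq_abs, ← Real.norm_eq_abs]
    refine Convex.norm_image_sub_le_of_norm_deriv_le (s := Iic M)
      (fun z _ => Real.differentiableAt_exp) ?_ (convex_Iic M) ?_ ?_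
    · intro z hz
      rw [Real.deriv_exp, Real.norm_eq_abs, Real.abs_exp]
      exact Real.exp_le_exp.2 hz
    · exact (le_abs_self _).trans (hM y hy)
    · exact (le_abs_self _).trans (hM x hx)
  · exact hF.integrable.continuousOn_mul (by
      rw [uIcc_of_le hb]; exact (hF.continuousOn hb).rexp)
  · filter_upwards [hF.ae_hasDerivAt] with x h1 hx
    exact (h1 hx).exp

/-- Grönwall's inequality with an integrable kernel. -/
theorem gronwall_integrable {u k : ℝ → ℝ} {a b : ℝ} (hb : 0 ≤ b)
    (hk : IntervalIntegrable k volume 0 b) (hk0 : ∀ x ∈ Icc 0 b, 0 ≤ k x)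
    (hu : ContinuousOn u (Icc 0 b))
    (h : ∀ x ∈ Icc 0 b, u x ≤ a + ∫ t in (0 : ℝ)..x, k t * u t) :
    ∀ x ∈ Icc 0 b, u x ≤ a * Real.exp (∫ t in (0 : ℝ)..x, k t) := by
  have hku : IntervalIntegrable (fun t => k t * u t) volume 0 b :=
    hk.mul_continuousOn (by rwa [uIcc_of_le hb])
  have hU := isPrimitive_self hku a
  have hK := (isPrimitive_self hk 0).const_mul (-1)
  have hP := hU.mul hb (hK.exp hb)
  intro x hx
  have h1 := hP.eq_add x hx
  -- With `U = a + ∫ k u`, the product `U exp(-∫ k)` has derivative `k (u - U) exp(-∫ k) ≤ 0`.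
  have h2 : ∫ t in (0 : ℝ)..x, (k t * u t * Real.exp (-1 * (0 + ∫ t in (0 : ℝ)..t, k t)) +
      (a + ∫ t in (0 : ℝ)..t, k t * u t) *
        (Real.exp (-1 * (0 + ∫ t in (0 : ℝ)..t, k t)) * (-1 * k t))) ≤ 0 := by
    rw [← neg_nonneg, ← intervalIntegral.integral_neg]
    refine intervalIntegral.integral_nonneg hx.1 fun t ht => ?_
    have ht' : t ∈ Icc 0 b := ⟨ht.1, ht.2.trans hx.2⟩
    have := mul_nonneg (mul_nonneg (Real.exp_pos (-1 * (0 + ∫ t in (0 : ℝ)..t, k t))).le (hk0 t ht'))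
      (sub_nonneg.2 (h t ht'))
    linarith
  simp only [zero_add, neg_mul, one_mul] at h1 h2
  simp only [intervalIntegral.integral_same, neg_zero, Real.exp_zero, mul_one, add_zero] at h1
  have h3 : (a + ∫ t in (0 : ℝ)..x, k t * u t) * Real.exp (-∫ t in (0 : ℝ)..x, k t) ≤ a := by
    rw [h1]
    linarith
  rw [Real.exp_neg, ← div_eq_mul_inv, div_le_iff₀ (Real.exp_pos _)] at h3
  exact (h x hx).trans h3

end QTree
end

open MeasureTheory Set

noncomputable section

namespace QTree

/-! ### Linear Volterra equations with integrable coefficients -/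

section Volterra

variable {E : Type*} [NormedAddCommGroup E] [NormedSpace ℂ E]

theorem intervalIntegrable_clm_apply {A : ℝ → E →L[ℂ] E} {Y : ℝ → E} {a b : ℝ}
    (hA : IntervalIntegrable A volume a b) (hY : ContinuousOn Y (uIcc a b)) :
    IntervalIntegrable (fun t => A t (Y t)) volume a b := by
  obtain ⟨M, hM⟩ := isCompact_uIcc.exists_bound_of_continuousOn hY
  refine (hA.norm.mul_const M).mono_fun ?_ ?_
  · refine (ContinuousLinearMap.id ℂ (E →L[ℂ] E)).aestronglyMeasurable_comp₂
      (intervalIntegrable_iff.1 hA).aestronglyMeasurable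
      ((hY.mono uIoc_subset_uIcc).aestronglyMeasurable measurableSet_uIoc)
  · filter_upwards [ae_restrict_mem measurableSet_uIoc] with t ht
    rw [norm_mul, norm_norm]
    refine ((A t).le_opNorm _).trans ?_
    gcongr
    exact (hM t (uIoc_subset_uIcc ht)).trans (Real.le_norm_self M)

theorem continuousOn_primitive_clm_apply {A : ℝ → E →L[ℂ] E} {Y : ℝ → E} {b : ℝ} (hb : 0 ≤ b)
    (hA : IntervalIntegrable A volume 0 b) (hY : ContinuousOn Y (Icc 0 b)) :
    ContinuousOn (fun x => ∫ t in (0 : ℝ)..x, A t (Y t)) (Icc 0 b) := by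
  have := (isPrimitive_self (intervalIntegrable_clm_apply hA
    (by rwa [uIcc_of_le hb])) (0 : E)).continuousOn hb
  simpa using this

theorem continuous_primitive_clm_apply {A : ℝ → E →L[ℂ] E} {b : ℝ} (hb : 0 ≤ b)
    (hA : IntervalIntegrable A volume 0 b) (Y : C(Icc 0 b, E)) :
    Continuous fun x : Icc 0 b => ∫ t in (0 : ℝ)..x, A t (IccExtend hb Y t) :=
  continuousOn_iff_continuous_domRestrict.1
    (continuousOn_primitive_clm_apply hb hA Y.continuous.Icc_extend'.continuousOn)

variable {b : ℝ} (hb : 0 ≤ b)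

/-- The Volterra operator `Y ↦ ∫₀ˣ A(t) Y(t) dt` on `C([0, b], E)`. -/
def volterra {A : ℝ → E →L[ℂ] E} (hA : IntervalIntegrable A volume 0 b) :
    C(Icc 0 b, E) →L[ℂ] C(Icc 0 b, E) :=
  LinearMap.mkContinuous
    { toFun := fun Y => ⟨fun x => ∫ t in (0 : ℝ)..x, A t (IccExtend hb Y t),
        continuous_primitive_clm_apply hb hA Y⟩
      map_add' := fun Y Z => by
        ext x
        have h (Y : C(Icc 0 b, E)) : IntervalIntegrable (fun t => A t (IccExtend hb Y t))
            volume 0 x := intervalIntegrable_clm_apply (hA.mono_set (by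
              rw [uIcc_of_le hb, uIcc_of_le x.2.1]; exact Icc_subset_Icc_right x.2.2))
              Y.continuous.Icc_extend'.continuousOn
        simp only [ContinuousMap.coe_mk, ContinuousMap.add_apply]
        rw [← intervalIntegral.integral_add (h Y) (h Z)]
        simp [IccExtend]
      map_smul' := fun c Y => by
        ext x
        simp only [ContinuousMap.coe_mk, ContinuousMap.smul_apply, RingHom.id_apply]
        rw [← intervalIntegral.integral_smul]
        simp [IccExtend] }
    (∫ t in (0 : ℝ)..b, ‖A t‖) fun Y => by
      have h0 : 0 ≤ ∫ t in (0 : ℝ)..b, ‖A t‖ :=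
        intervalIntegral.integral_nonneg hb fun _ _ => norm_nonneg _
      refine (ContinuousMap.norm_le _ (by positivity)).2 fun x => ?_
      have hsub : IntervalIntegrable A volume 0 x := hA.mono_set (by
        rw [uIcc_of_le hb, uIcc_of_le x.2.1]; exact Icc_subset_Icc_right x.2.2)
      calc ‖∫ t in (0 : ℝ)..x, A t (IccExtend hb Y t)‖ ≤ ∫ t in (0 : ℝ)..x, ‖A t‖ * ‖Y‖ := by
            refine intervalIntegral.norm_integral_le_of_norm_le x.2.1
              (Filter.Eventually.of_forall fun t _ => ?_) (hsub.norm.mul_const _)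
            refine ((A t).le_opNorm _).trans ?_
            gcongr
            exact Y.norm_coe_le_norm _
        _ = (∫ t in (0 : ℝ)..x, ‖A t‖) * ‖Y‖ := intervalIntegral.integral_mul_const _ _
        _ ≤ _ := by
          gcongr
          exact intervalIntegral.integral_mono_interval le_rfl x.2.1 x.2.2
            (Filter.Eventually.of_forall fun _ => norm_nonneg _) hA.norm

theorem volterra_apply {A : ℝ → E →L[ℂ] E} (hA : IntervalIntegrable A volume 0 b)
    (Y : C(Icc 0 b, E)) (x : Icc 0 b) :
    volterra hb hA Y x = ∫ t in (0 : ℝ)..x, A t (IccExtend hb Y t) := rfl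

theorem norm_volterra_pow_apply_le {A : ℝ → E →L[ℂ] E} (hA : IntervalIntegrable A volume 0 b)
    (n : ℕ) (Y : C(Icc 0 b, E)) (x : Icc 0 b) :
    ‖(volterra hb hA ^ n) Y x‖ ≤ (∫ t in (0 : ℝ)..x, ‖A t‖) ^ n / n.factorial * ‖Y‖ := by
  induction n generalizing x with
  | zero => simpa using Y.norm_coe_le_norm x
  | succ n ih =>
    rw [pow_succ', mul_apply_eq_comp, volterra_apply]
    have hK := isPrimitive_self hA.norm 0
    -- With `κ(x) = ∫₀ˣ ‖A‖`, the induction step integrates `κⁿ κ' / n!` to `κⁿ⁺¹ / (n+1)!`.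
    have hP := (hK.pow hb n).const_mul (‖Y‖ / (n + 1).factorial)
    have h0 : (0 : ℝ) ∈ Icc 0 b := ⟨le_rfl, hb⟩
    have h1 := hP.eq_add x x.2
    simp only [zero_add, intervalIntegral.integral_same] at h1
    have h2 : (∫ t in (0 : ℝ)..x, ‖A t‖) ^ (n + 1) / (n + 1).factorial * ‖Y‖ =
        ∫ t in (0 : ℝ)..x, ‖Y‖ / (n + 1).factorial *
          ((n + 1) * (∫ t in (0 : ℝ)..t, ‖A t‖) ^ n * ‖A t‖) := by
      rw [zero_pow n.succ_ne_zero, mul_zero, zero_add] at h1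
      rw [← h1]
      ring
    rw [h2]
    refine intervalIntegral.norm_integral_le_of_norm_le x.2.1
      (Filter.Eventually.of_forall fun t ht => ?_) ?_
    · have ht' : t ∈ Icc 0 b := ⟨ht.1.le, ht.2.trans x.2.2⟩
      refine ((A t).le_opNorm _).trans ?_
      have h3 := ih ⟨t, ht'⟩
      rw [IccExtend_of_mem hb _ ht']
      calc ‖A t‖ * _ ≤ ‖A t‖ * ((∫ t in (0 : ℝ)..t, ‖A t‖) ^ n / n.factorial * ‖Y‖) := by
            gcongr
        _ = _ := by
          rw [Nat.factorial_succ]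
          push_cast
          field_simp
    · have := hP.intervalIntegrable h0 x.2
      simpa using this

/-- Some power `Vⁿ` has norm below `1`, since `Kⁿ / n! → 0`. Then `1 - Vⁿ` is invertible, and it is
the product of the commuting factors `1 - V` and `1 + V + ⋯ + Vⁿ⁻¹`. No smallness of `A` is needed.
-/
theorem isUnit_one_sub_volterra [CompleteSpace E] {A : ℝ → E →L[ℂ] E} (hA : IntervalIntegrable A volume 0 b) :
    IsUnit (1 - volterra hb hA) := by
  set K := ∫ t in (0 : ℝ)..b, ‖A t‖ with hKdef
  obtain ⟨n, hn⟩ := ((FloorSemiring.tendsto_pow_div_factorial_atTop K).eventually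
    (gt_mem_nhds one_half_pos)).exists
  have hK0 : 0 ≤ K := intervalIntegral.integral_nonneg hb fun _ _ => norm_nonneg _
  have hnorm : ‖volterra hb hA ^ n‖ < 1 := by
    refine lt_of_le_of_lt (ContinuousLinearMap.opNorm_le_bound _ (by positivity) fun Y => ?_)
      (hn.trans one_half_lt_one)
    refine (ContinuousMap.norm_le _ (by positivity)).2 fun x => ?_
    refine (norm_volterra_pow_apply_le hb hA n Y x).trans ?_
    gcongr
    · exact intervalIntegral.integral_nonneg x.2.1 fun _ _ => norm_nonneg _
    · exact intervalIntegral.integral_mono_interval le_rfl x.2.1 x.2.2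
        (Filter.Eventually.of_forall fun _ => norm_nonneg _) hA.norm
  have hu := isUnit_one_sub_of_norm_lt_one (R := C(Icc 0 b, E) →L[ℂ] C(Icc 0 b, E)) hnorm
  have h1 := mul_neg_geom_sum (volterra hb hA) n
  have h2 := geom_sum_mul_neg (volterra hb hA) n
  rw [← h1] at hu
  exact ((show Commute _ _ from h1.trans h2.symm).isUnit_mul_iff.1 hu).1

end Volterra

/-! ### Existence, uniqueness and analyticity for the equation on an edge -/

/-- The coefficient matrix of the first-order system. -/
def coeffMatrix (σ : ℝ → ℝ) (z : ℂ) (t : ℝ) : ℂ × ℂ →L[ℂ] ℂ × ℂ :=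
  (σ t : ℂ) • ((ContinuousLinearMap.fst ℂ ℂ ℂ).prod (-ContinuousLinearMap.snd ℂ ℂ ℂ)) +
    ((σ t : ℂ) ^ 2) • ((0 : ℂ × ℂ →L[ℂ] ℂ).prod (-ContinuousLinearMap.fst ℂ ℂ ℂ)) +
    (ContinuousLinearMap.snd ℂ ℂ ℂ).prod (0 : ℂ × ℂ →L[ℂ] ℂ) +
    z • ((0 : ℂ × ℂ →L[ℂ] ℂ).prod (-ContinuousLinearMap.fst ℂ ℂ ℂ))

theorem coeffMatrix_apply (σ : ℝ → ℝ) (z : ℂ) (t : ℝ) (Y : ℂ × ℂ) :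
    coeffMatrix σ z t Y = ((σ t : ℂ) * Y.1 + Y.2,
      -((σ t : ℂ) * Y.2 + (σ t : ℂ) ^ 2 * Y.1 + z * Y.1)) := by
  ext
  · simp [coeffMatrix]
  · simp [coeffMatrix]
    ring

/-- The square integrable functions on the edge `[0, π]`. -/
abbrev SqIntegrable (σ : ℝ → ℝ) : Prop := MemLp σ 2 (volume.restrict (Ioo 0 Real.pi))

section

variable {σ : ℝ → ℝ}

theorem SqIntegrable.intervalIntegrable (hσ : SqIntegrable σ) : IntervalIntegrable σ volume 0 Real.pi := by
  rw [intervalIntegrable_iff_integrableOn_Ioo_of_le Real.pi_pos.le]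
  exact hσ.integrable one_le_two

theorem SqIntegrable.intervalIntegrable_sq (hσ : SqIntegrable σ) :
    IntervalIntegrable (fun t => σ t ^ 2) volume 0 Real.pi := by
  rw [intervalIntegrable_iff_integrableOn_Ioo_of_le Real.pi_pos.le]
  exact hσ.integrable_sq

theorem SqIntegrable.intervalIntegrable_ofReal (hσ : SqIntegrable σ) :
    IntervalIntegrable (fun t => (σ t : ℂ)) volume 0 Real.pi :=
  ⟨hσ.intervalIntegrable.1.ofReal, hσ.intervalIntegrable.2.ofReal⟩

theorem SqIntegrable.intervalIntegrable_ofReal_sq (hσ : SqIntegrable σ) :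
    IntervalIntegrable (fun t => (σ t : ℂ) ^ 2) volume 0 Real.pi := by
  have h := hσ.intervalIntegrable_sq
  have : (fun t => (σ t : ℂ) ^ 2) = fun t => ((σ t ^ 2 : ℝ) : ℂ) := by
    ext t; push_cast; rfl
  rw [this]
  exact ⟨h.1.ofReal, h.2.ofReal⟩

theorem SqIntegrable.intervalIntegrable_coeffMatrix (hσ : SqIntegrable σ) (z : ℂ) :
    IntervalIntegrable (coeffMatrix σ z) volume 0 Real.pi := by
  unfold coeffMatrix
  refine ((IntervalIntegrable.add ?_ ?_).add ?_).add ?_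
  · exact ⟨hσ.intervalIntegrable_ofReal.1.smul_const _, hσ.intervalIntegrable_ofReal.2.smul_const _⟩
  · exact ⟨hσ.intervalIntegrable_ofReal_sq.1.smul_const _,
      hσ.intervalIntegrable_ofReal_sq.2.smul_const _⟩
  · exact intervalIntegrable_const
  · exact intervalIntegrable_const

theorem isSolution_iff (hσ : SqIntegrable σ) {z : ℂ} {Y : ℝ → ℂ × ℂ} :
    IsSolution σ z Y ↔ ContinuousOn Y (Icc 0 Real.pi) ∧
      ∀ x ∈ Icc 0 Real.pi, Y x = Y 0 + ∫ t in (0 : ℝ)..x, coeffMatrix σ z t (Y t) := by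
  have key : ContinuousOn Y (Icc 0 Real.pi) → ∀ x ∈ Icc 0 Real.pi,
      (∫ t in (0 : ℝ)..x, coeffMatrix σ z t (Y t)) =
      (∫ t in (0 : ℝ)..x, ((σ t : ℂ) * (Y t).1 + (Y t).2),
        -∫ t in (0 : ℝ)..x, ((σ t : ℂ) * (Y t).2 + (σ t : ℂ) ^ 2 * (Y t).1 + z * (Y t).1)) := by
    intro hc x hx
    have hi : IntervalIntegrable (fun t => coeffMatrix σ z t (Y t)) volume 0 x := by
      have hs : uIcc 0 x ⊆ Icc 0 Real.pi := by
        rw [uIcc_of_le hx.1]; exact Icc_subset_Icc_right hx.2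
      refine intervalIntegrable_clm_apply
        ((hσ.intervalIntegrable_coeffMatrix z).mono_set ?_) (hc.mono hs)
      rwa [uIcc_of_le Real.pi_pos.le]
    ext1
    · have := (ContinuousLinearMap.fst ℂ ℂ ℂ).intervalIntegral_comp_comm hi
      simp only [ContinuousLinearMap.coe_fst', coeffMatrix_apply] at this
      simp only [coeffMatrix_apply, this]
    · have := (ContinuousLinearMap.snd ℂ ℂ ℂ).intervalIntegral_comp_comm hi
      simp only [ContinuousLinearMap.coe_snd', coeffMatrix_apply] at this
      simp only [coeffMatrix_apply, ← this, intervalIntegral.integral_neg]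
  constructor
  · intro h
    refine ⟨h.continuousOn, fun x hx => ?_⟩
    rw [key h.continuousOn x hx]
    ext1
    · simpa using h.value x hx
    · simpa [sub_eq_add_neg] using h.quasiDeriv x hx
  · rintro ⟨hc, h⟩
    refine ⟨hc, fun x hx => ?_, fun x hx => ?_⟩
    · have := congrArg Prod.fst (h x hx)
      rw [key hc x hx] at this
      simpa using this
    · have := congrArg Prod.snd (h x hx)
      rw [key hc x hx] at this
      simpa [sub_eq_add_neg] using this

theorem volterra_coeffMatrix (hσ : SqIntegrable σ) (z : ℂ) :
    volterra Real.pi_pos.le (hσ.intervalIntegrable_coeffMatrix z) =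
      volterra Real.pi_pos.le (hσ.intervalIntegrable_coeffMatrix 0) +
        z • volterra Real.pi_pos.le (intervalIntegrable_const
          (c := (0 : ℂ × ℂ →L[ℂ] ℂ).prod (-ContinuousLinearMap.fst ℂ ℂ ℂ))) := by
  ext1 Y
  ext1 x
  have hs : uIcc 0 (x : ℝ) ⊆ uIcc 0 Real.pi := by
    rw [uIcc_of_le x.2.1, uIcc_of_le Real.pi_pos.le]; exact Icc_subset_Icc_right x.2.2
  have hY : ContinuousOn (IccExtend Real.pi_pos.le Y) (uIcc 0 x) :=
    Y.continuous.Icc_extend'.continuousOn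
  simp only [add_apply, smul_apply, ContinuousMap.add_apply,
    ContinuousMap.smul_apply, volterra_apply]
  rw [← intervalIntegral.integral_smul, ← intervalIntegral.integral_add]
  · refine intervalIntegral.integral_congr fun t _ => ?_
    ext
    · simp [coeffMatrix_apply]
    · simp [coeffMatrix_apply]
      ring
  · exact intervalIntegrable_clm_apply ((hσ.intervalIntegrable_coeffMatrix 0).mono_set hs) hY
  · exact (intervalIntegrable_clm_apply (intervalIntegrable_const) hY).smul z

/-- The solution with initial data `Y₀` as an element of `C([0, π])`. -/
def solutionMap (hσ : SqIntegrable σ) (z : ℂ) (Y₀ : ℂ × ℂ) : C(Icc 0 Real.pi, ℂ × ℂ) :=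
  Ring.inverse (1 - volterra Real.pi_pos.le (hσ.intervalIntegrable_coeffMatrix z))
    (ContinuousMap.const _ Y₀)

theorem solutionMap_apply (hσ : SqIntegrable σ) (z : ℂ) (Y₀ : ℂ × ℂ) (x : Icc 0 Real.pi) :
    solutionMap hσ z Y₀ x = Y₀ + ∫ t in (0 : ℝ)..x,
      coeffMatrix σ z t (IccExtend Real.pi_pos.le (solutionMap hσ z Y₀) t) := by
  have h := Ring.mul_inverse_cancel _
    (isUnit_one_sub_volterra Real.pi_pos.le (hσ.intervalIntegrable_coeffMatrix z))
  have h1 := congrArg (fun T => (T (ContinuousMap.const _ Y₀)) x) h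
  simp only [mul_apply_eq_comp, sub_apply, one_apply_eq_self,
    ContinuousMap.sub_apply, ContinuousMap.const_apply] at h1
  rw [sub_eq_iff_eq_add] at h1
  exact h1

theorem isSolution_solutionMap (hσ : SqIntegrable σ) (z : ℂ) (Y₀ : ℂ × ℂ) :
    IsSolution σ z (IccExtend Real.pi_pos.le (solutionMap hσ z Y₀)) ∧
      IccExtend Real.pi_pos.le (solutionMap hσ z Y₀) 0 = Y₀ := by
  have h0 : IccExtend Real.pi_pos.le (solutionMap hσ z Y₀) 0 = Y₀ := by
    rw [IccExtend_of_mem _ _ ⟨le_rfl, Real.pi_pos.le⟩, solutionMap_apply]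
    simp
  refine ⟨(isSolution_iff hσ).2 ⟨(solutionMap hσ z Y₀).continuous.Icc_extend'.continuousOn,
    fun x hx => ?_⟩, h0⟩
  rw [h0, IccExtend_of_mem _ _ hx, solutionMap_apply]

theorem IsSolution.eqOn_solutionMap (hσ : SqIntegrable σ) {z : ℂ} {Y : ℝ → ℂ × ℂ}
    (hY : IsSolution σ z Y) :
    EqOn Y (IccExtend Real.pi_pos.le (solutionMap hσ z (Y 0))) (Icc 0 Real.pi) := by
  obtain ⟨hc, h⟩ := (isSolution_iff hσ).1 hY
  set y : C(Icc 0 Real.pi, ℂ × ℂ) := ⟨fun x => Y x, continuousOn_iff_continuous_domRestrict.1 hc⟩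
    with hy
  have h1 : (1 - volterra Real.pi_pos.le (hσ.intervalIntegrable_coeffMatrix z)) y =
      ContinuousMap.const _ (Y 0) := by
    ext1 x
    simp only [sub_apply, one_apply_eq_self, ContinuousMap.sub_apply,
      ContinuousMap.const_apply, volterra_apply]
    rw [sub_eq_iff_eq_add]
    refine (h x x.2).trans ?_
    congr 1
    refine intervalIntegral.integral_congr fun t ht => ?_
    have ht' : t ∈ Icc 0 Real.pi := by
      rw [uIcc_of_le x.2.1] at ht; exact ⟨ht.1, ht.2.trans x.2.2⟩
    simp only [IccExtend_of_mem _ _ ht']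
    rfl
  have h2 : y = solutionMap hσ z (Y 0) := by
    rw [solutionMap, ← h1]
    have := Ring.inverse_mul_cancel _
      (isUnit_one_sub_volterra Real.pi_pos.le (hσ.intervalIntegrable_coeffMatrix z))
    exact (congrArg (fun T => T y) this).symm
  intro x hx
  rw [IccExtend_of_mem _ _ hx, ← h2]
  rfl

theorem isSolution_solution (hσ : SqIntegrable σ) (z a b : ℂ) :
    IsSolution σ z (solution σ z a b) ∧ solution σ z a b 0 = (a, b) :=
  Classical.epsilon_spec (p := fun Y => IsSolution σ z Y ∧ Y 0 = (a, b))
    ⟨_, isSolution_solutionMap hσ z (a, b)⟩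

theorem IsSolution.eqOn (hσ : SqIntegrable σ) {z : ℂ} {Y Z : ℝ → ℂ × ℂ}
    (hY : IsSolution σ z Y) (hZ : IsSolution σ z Z) (h : Y 0 = Z 0) :
    EqOn Y Z (Icc 0 Real.pi) := fun x hx => by
  rw [hY.eqOn_solutionMap hσ hx, hZ.eqOn_solutionMap hσ hx, h]

theorem differentiableAt_one_sub_add_smul {R : Type*} [NormedRing R] [NormedAlgebra ℂ R]
    (V W : R) (z : ℂ) : DifferentiableAt ℂ (fun z : ℂ => 1 - (V + z • W)) z := by
  fun_prop

/-- The Volterra operator is affine in `z`, and inversion in a Banach algebra is analytic at units.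
-/
theorem differentiable_solutionMap (hσ : SqIntegrable σ) (Y₀ : ℂ × ℂ) :
    Differentiable ℂ fun z => solutionMap hσ z Y₀ := by
  intro z
  have h : DifferentiableAt ℂ (fun z => Ring.inverse
      (1 - volterra Real.pi_pos.le (hσ.intervalIntegrable_coeffMatrix z))) z := by
    refine DifferentiableAt.inverse (𝕜 := ℂ)
      (R := C(Icc 0 Real.pi, ℂ × ℂ) →L[ℂ] C(Icc 0 Real.pi, ℂ × ℂ))
      (h := fun z => 1 - volterra Real.pi_pos.le (hσ.intervalIntegrable_coeffMatrix z)) ?_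
      (isUnit_one_sub_volterra _ _)
    have : (fun z => 1 - volterra Real.pi_pos.le (hσ.intervalIntegrable_coeffMatrix z)) =
        fun z => 1 - (volterra Real.pi_pos.le (hσ.intervalIntegrable_coeffMatrix 0) +
        z • volterra Real.pi_pos.le (intervalIntegrable_const
          (c := (0 : ℂ × ℂ →L[ℂ] ℂ).prod (-ContinuousLinearMap.fst ℂ ℂ ℂ)))) := by
      funext z
      rw [volterra_coeffMatrix hσ]
    rw [this]
    exact differentiableAt_one_sub_add_smul _ _ _
  exact h.clm_apply (differentiableAt_const _)

theorem differentiable_solution (hσ : SqIntegrable σ) (a b : ℂ) :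
    Differentiable ℂ fun z => solution σ z a b Real.pi := by
  have hpi : Real.pi ∈ Icc 0 Real.pi := ⟨Real.pi_pos.le, le_rfl⟩
  have : (fun z => solution σ z a b Real.pi) =
      fun z => ContinuousMap.evalCLM ℂ (⟨Real.pi, hpi⟩ : Icc 0 Real.pi)
        (solutionMap hσ z (a, b)) := by
    funext z
    obtain ⟨h1, h2⟩ := isSolution_solution hσ z a b
    rw [h1.eqOn_solutionMap hσ hpi, h2, IccExtend_of_mem _ _ hpi]
    rfl
  rw [this]
  exact (ContinuousLinearMap.differentiable _).comp (differentiable_solutionMap hσ _)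

end

end QTree
end

open MeasureTheory Set

noncomputable section

namespace QTree

/-! ### Linear structure of the solution space, the Wronskian, and real solutions -/

section

variable {σ : ℝ → ℝ} {z : ℂ}

theorem IsSolution.isPrimitive_fst (hσ : SqIntegrable σ) {Y : ℝ → ℂ × ℂ} (hY : IsSolution σ z Y) :
    IsPrimitive (fun x => (Y x).1) (fun t => (σ t : ℂ) * (Y t).1 + (Y t).2) Real.pi := by
  refine ⟨?_, hY.value⟩
  have hc := hY.continuousOn
  rw [← uIcc_of_le Real.pi_pos.le] at hc
  exact (hσ.intervalIntegrable_ofReal.mul_continuousOn hc.fst).add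
    (hc.snd.intervalIntegrable)

theorem IsSolution.isPrimitive_snd (hσ : SqIntegrable σ) {Y : ℝ → ℂ × ℂ} (hY : IsSolution σ z Y) :
    IsPrimitive (fun x => (Y x).2)
      (fun t => -((σ t : ℂ) * (Y t).2 + (σ t : ℂ) ^ 2 * (Y t).1 + z * (Y t).1)) Real.pi := by
  refine ⟨?_, fun x hx => ?_⟩
  · have hc := hY.continuousOn
    rw [← uIcc_of_le Real.pi_pos.le] at hc
    exact (((hσ.intervalIntegrable_ofReal.mul_continuousOn hc.snd).add
      (hσ.intervalIntegrable_ofReal_sq.mul_continuousOn hc.fst)).add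
      (continuousOn_const.mul hc.fst).intervalIntegrable).neg
  · rw [hY.quasiDeriv x hx, intervalIntegral.integral_neg, sub_eq_add_neg]

theorem isSolution_of_isPrimitive {Y : ℝ → ℂ × ℂ}
    (h1 : IsPrimitive (fun x => (Y x).1) (fun t => (σ t : ℂ) * (Y t).1 + (Y t).2) Real.pi)
    (h2 : IsPrimitive (fun x => (Y x).2)
      (fun t => -((σ t : ℂ) * (Y t).2 + (σ t : ℂ) ^ 2 * (Y t).1 + z * (Y t).1)) Real.pi) :
    IsSolution σ z Y := by
  refine ⟨(h1.continuousOn Real.pi_pos.le).prodMk (h2.continuousOn Real.pi_pos.le), h1.eq_add,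
    fun x hx => ?_⟩
  rw [h2.eq_add x hx, intervalIntegral.integral_neg, sub_eq_add_neg]

theorem IsSolution.linearCombination (hσ : SqIntegrable σ) {Y Z : ℝ → ℂ × ℂ}
    (hY : IsSolution σ z Y) (hZ : IsSolution σ z Z) (a b : ℂ) :
    IsSolution σ z fun x => (a * (Y x).1 + b * (Z x).1, a * (Y x).2 + b * (Z x).2) := by
  refine isSolution_of_isPrimitive ?_ ?_
  · exact (((hY.isPrimitive_fst hσ).const_mul a).add ((hZ.isPrimitive_fst hσ).const_mul b)).congr
      Real.pi_pos.le (fun _ _ => rfl) (fun _ _ => by ring)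
  · exact (((hY.isPrimitive_snd hσ).const_mul a).add ((hZ.isPrimitive_snd hσ).const_mul b)).congr
      Real.pi_pos.le (fun _ _ => rfl) (fun _ _ => by ring)

theorem isSolution_solC (hσ : SqIntegrable σ) (z : ℂ) : IsSolution σ z (solC σ z) :=
  (isSolution_solution hσ z 1 0).1

theorem isSolution_solS (hσ : SqIntegrable σ) (z : ℂ) : IsSolution σ z (solS σ z) :=
  (isSolution_solution hσ z 0 1).1

theorem solC_zero (hσ : SqIntegrable σ) (z : ℂ) : solC σ z 0 = (1, 0) :=
  (isSolution_solution hσ z 1 0).2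

theorem solS_zero (hσ : SqIntegrable σ) (z : ℂ) : solS σ z 0 = (0, 1) :=
  (isSolution_solution hσ z 0 1).2

theorem IsSolution.eq_solC_solS (hσ : SqIntegrable σ) {Y : ℝ → ℂ × ℂ} (hY : IsSolution σ z Y)
    {x : ℝ} (hx : x ∈ Icc 0 Real.pi) :
    Y x = ((Y 0).1 * (solC σ z x).1 + (Y 0).2 * (solS σ z x).1,
      (Y 0).1 * (solC σ z x).2 + (Y 0).2 * (solS σ z x).2) :=
  hY.eqOn hσ ((isSolution_solC hσ z).linearCombination hσ (isSolution_solS hσ z) (Y 0).1 (Y 0).2)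
    (by simp [solC_zero hσ, solS_zero hσ]) hx

theorem wronskian_eq_one (hσ : SqIntegrable σ) (z : ℂ) :
    (solC σ z Real.pi).1 * (solS σ z Real.pi).2 - (solC σ z Real.pi).2 * (solS σ z Real.pi).1
      = 1 := by
  have hC := isSolution_solC hσ z
  have hS := isSolution_solS hσ z
  have h := ((hC.isPrimitive_fst hσ).mul Real.pi_pos.le (hS.isPrimitive_snd hσ)).add
    (((hC.isPrimitive_snd hσ).mul Real.pi_pos.le (hS.isPrimitive_fst hσ)).const_mul (-1))
  have h1 := h.eq_add Real.pi ⟨Real.pi_pos.le, le_rfl⟩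
  -- The derivative of `C S^{[1]} - C^{[1]} S` cancels pointwise, so its value at `0` persists.
  rw [solC_zero hσ, solS_zero hσ, intervalIntegral.integral_congr (g := fun _ => (0 : ℂ))
    (fun t _ => by ring)] at h1
  simp at h1
  linear_combination h1

theorem intervalIntegral_conj (f : ℝ → ℂ) (a b : ℝ) :
    ∫ t in a..b, starRingEnd ℂ (f t) = starRingEnd ℂ (∫ t in a..b, f t) := by
  simp [intervalIntegral, integral_conj]

theorem IsSolution.conj {Y : ℝ → ℂ × ℂ} (hY : IsSolution σ z Y) :
    IsSolution σ (starRingEnd ℂ z) fun x => (starRingEnd ℂ (Y x).1, starRingEnd ℂ (Y x).2) := by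
  refine ⟨?_, fun x hx => ?_, fun x hx => ?_⟩
  · exact (Complex.continuous_conj.comp_continuousOn hY.continuousOn.fst).prodMk
      (Complex.continuous_conj.comp_continuousOn hY.continuousOn.snd)
  · have := congrArg (starRingEnd ℂ) (hY.value x hx)
    simp only [map_add, ← intervalIntegral_conj] at this
    simpa using this
  · have := congrArg (starRingEnd ℂ) (hY.quasiDeriv x hx)
    simp only [map_sub, ← intervalIntegral_conj] at this
    simpa using this

/-- As `σ` is real, conjugation turns a solution for `z` into one for the conjugate of `z`;
uniqueness finishes. -/
theorem solution_real (hσ : SqIntegrable σ) {z : ℂ} {a b : ℝ} (hz : z.im = 0) {x : ℝ}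
    (hx : x ∈ Icc 0 Real.pi) :
    ((solution σ z a b x).1).im = 0 ∧ ((solution σ z a b x).2).im = 0 := by
  obtain ⟨h1, h2⟩ := isSolution_solution hσ z a b
  have h3 := h1.conj
  rw [Complex.conj_eq_iff_im.2 hz] at h3
  have h4 := h3.eqOn hσ h1 (by simp [h2]) hx
  exact ⟨Complex.conj_eq_iff_im.1 (congrArg Prod.fst h4),
    Complex.conj_eq_iff_im.1 (congrArg Prod.snd h4)⟩

theorem edgeChar_im (hσ : SqIntegrable σ) (γ : ℝ) {z : ℂ} (hz : z.im = 0) (b b' : BC) :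
    (edgeChar σ γ z b b').im = 0 := by
  have hpi : Real.pi ∈ Icc 0 Real.pi := ⟨Real.pi_pos.le, le_rfl⟩
  have hS := solution_real hσ (a := 0) (b := 1) hz hpi
  have hC := solution_real hσ (a := 1) (b := 0) hz hpi
  simp only [Complex.ofReal_zero, Complex.ofReal_one] at hS hC
  cases b <;> cases b' <;> simp [edgeChar, solS, solC, hS, hC]

theorem differentiable_edgeChar (hσ : SqIntegrable σ) (γ : ℝ) (b b' : BC) :
    Differentiable ℂ fun z => edgeChar σ γ z b b' := by
  have hS := differentiable_solution hσ 0 1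
  have hC := differentiable_solution hσ 1 0
  cases b <;> cases b' <;> simp only [edgeChar, solS, solC]
  · exact hS.fst
  · exact hS.snd.add (hS.fst.const_mul _)
  · exact hC.fst
  · exact hC.snd.add (hC.fst.const_mul _)

end

end QTree
end

open MeasureTheory Set

noncomputable section

namespace QTree

/-! ### Asymptotics of the solutions on an edge -/

/-- A Cauchy–Schwarz estimate in additive form: `e |g| ≤ √c e² + g² / √c`, and `∫ e^{-2cs} ≤ 1 / c`.
It is the source of every `τ^{-1/2}` below; `s` is the distance to the endpoint at which the
exponential concentrates. -/
theorem integral_exp_mul_abs_le {g : ℝ → ℝ} {b c x : ℝ} (hc : 0 < c)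
    (hg : IntervalIntegrable g volume 0 b)
    (hg2 : IntervalIntegrable (fun t => g t ^ 2) volume 0 b) (hx : x ∈ Icc 0 b) {s : ℝ → ℝ}
    (hs : (s = fun t => t) ∨ s = fun t => x - t) :
    ∫ t in (0 : ℝ)..x, Real.exp (-(c * s t)) * |g t| ≤ (1 + ∫ t in (0 : ℝ)..b, g t ^ 2) / √c := by
  have hsub : uIcc 0 x ⊆ uIcc 0 b := by
    rw [uIcc_of_le hx.1, uIcc_of_le (hx.1.trans hx.2)]; exact Icc_subset_Icc_right hx.2
  have hgx := hg.mono_set hsub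
  have hg2x := hg2.mono_set hsub
  have hsc : Continuous s := by rcases hs with rfl | rfl <;> fun_prop
  have hsq : 0 < √c := Real.sqrt_pos.2 hc
  have hcc : √c * √c = c := Real.mul_self_sqrt hc.le
  have hexp : ∫ t in (0 : ℝ)..x, Real.exp (-(2 * c) * s t) ≤ 1 / c := by
    have h0 : ∫ t in (0 : ℝ)..x, Real.exp (-(2 * c) * t) ≤ 1 / c := by
      have h1 : ∫ t in (0 : ℝ)..x, Real.exp (-(2 * c) * t) =
          (-(2 * c))⁻¹ * Real.exp (-(2 * c) * x) - (-(2 * c))⁻¹ * Real.exp (-(2 * c) * 0) := by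
        refine intervalIntegral.integral_eq_sub_of_hasDerivAt (f := fun t =>
          (-(2 * c))⁻¹ * Real.exp (-(2 * c) * t)) (fun t _ => ?_) (by
            apply Continuous.intervalIntegrable; fun_prop)
        have := (((hasDerivAt_id t).const_mul (-(2 * c))).exp).const_mul (-(2 * c))⁻¹
        refine this.congr_deriv ?_
        simp only [id, mul_one]
        field_simp
      rw [h1]
      have h2 : (-(2 * c))⁻¹ = -(1 / c / 2) := by field_simp
      have h3 := Real.exp_pos (-(2 * c) * x)
      have h4 : 0 < 1 / c := by positivity
      rw [h2]
      simp only [mul_zero, Real.exp_zero]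
      nlinarith
    rcases hs with rfl | rfl
    · exact h0
    · have := intervalIntegral.integral_comp_sub_left
        (fun t => Real.exp (-(2 * c) * t)) x (a := 0) (b := x)
      simp only [sub_self, sub_zero] at this
      rw [this]
      exact h0
  have hint : IntervalIntegrable (fun t => √c * Real.exp (-(2 * c) * s t)) volume 0 x := by
    apply Continuous.intervalIntegrable; fun_prop
  calc ∫ t in (0 : ℝ)..x, Real.exp (-(c * s t)) * |g t|
      ≤ ∫ t in (0 : ℝ)..x, (√c * Real.exp (-(2 * c) * s t) + (√c)⁻¹ * g t ^ 2) := by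
        refine intervalIntegral.integral_mono_on hx.1 ?_ (hint.add (hg2x.const_mul _)) fun t _ => ?_
        · refine (hgx.abs).continuousOn_mul (Continuous.continuousOn ?_)
          fun_prop
        · have h1 : Real.exp (-(2 * c) * s t) = Real.exp (-(c * s t)) ^ 2 := by
            rw [← Real.exp_nat_mul]; congr 1; push_cast; ring
          rw [h1, ← sq_abs (g t)]
          have h2 := Real.exp_pos (-(c * s t))
          set e := Real.exp (-(c * s t))
          have h3 := abs_nonneg (g t)
          have h4 : √c * e ^ 2 + (√c)⁻¹ * |g t| ^ 2 - 2 * (e * |g t|) =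
              (√c)⁻¹ * (√c * e - |g t|) ^ 2 := by
            field_simp
            ring
          have h5 : 0 ≤ (√c)⁻¹ * (√c * e - |g t|) ^ 2 := by positivity
          nlinarith [mul_nonneg h2.le h3]
    _ = √c * (∫ t in (0 : ℝ)..x, Real.exp (-(2 * c) * s t)) +
        (√c)⁻¹ * ∫ t in (0 : ℝ)..x, g t ^ 2 := by
        rw [intervalIntegral.integral_add hint (hg2x.const_mul _),
          intervalIntegral.integral_const_mul, intervalIntegral.integral_const_mul]
    _ ≤ √c * (1 / c) + (√c)⁻¹ * ∫ t in (0 : ℝ)..b, g t ^ 2 := by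
        gcongr
        exact intervalIntegral.integral_mono_interval le_rfl hx.1 hx.2
          (Filter.Eventually.of_forall fun _ => sq_nonneg _) hg2
    _ = _ := by
        have : √c * (1 / c) = 1 / √c := by
          rw [mul_one_div, div_eq_div_iff hc.ne' hsq.ne', hcc, one_mul]
        rw [this]
        ring

section

variable {σ : ℝ → ℝ}

/-- The amplitude of the exponentially growing solution. -/
def ampGrow (μ : ℂ) (Y : ℝ → ℂ × ℂ) (x : ℝ) : ℂ :=
  Complex.exp (-μ * x) * ((Y x).1 + μ⁻¹ * (Y x).2)

/-- The amplitude of the exponentially decaying solution, relative to the growing one. -/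
def ampDecay (μ : ℂ) (Y : ℝ → ℂ × ℂ) (x : ℝ) : ℂ :=
  Complex.exp (-μ * x) * ((Y x).1 - μ⁻¹ * (Y x).2)

theorem isPrimitive_cexp (c : ℂ) (b : ℝ) :
    IsPrimitive (fun x : ℝ => Complex.exp (c * x)) (fun x => c * Complex.exp (c * x)) b := by
  refine isPrimitive_of_hasDerivAt (fun x => ?_) (by fun_prop)
  have := ((Complex.ofRealCLM.hasDerivAt (x := x)).const_mul c).cexp
  refine this.congr_deriv ?_
  simp [mul_comm]

theorem isPrimitive_ampGrow (hσ : SqIntegrable σ) {μ : ℂ} (hμ : μ ≠ 0) {Y : ℝ → ℂ × ℂ}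
    (hY : IsSolution σ (-μ ^ 2) Y) :
    IsPrimitive (ampGrow μ Y) (fun t => (σ t : ℂ) * ampDecay μ Y t -
      (2 * μ)⁻¹ * ((σ t : ℂ) ^ 2 * (ampGrow μ Y t + ampDecay μ Y t))) Real.pi := by
  refine ((isPrimitive_cexp (-μ) Real.pi).mul Real.pi_pos.le ((hY.isPrimitive_fst hσ).add
    ((hY.isPrimitive_snd hσ).const_mul μ⁻¹))).congr Real.pi_pos.le (fun x _ => rfl) fun x _ => ?_
  simp only [ampGrow, ampDecay]
  field_simp
  ring

/-- Duhamel's formula. The function `e^{μx} (y - y^{[1]} / μ)` has derivative `e^{μx} (σ (y +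
y^{[1]} / μ) + σ² y / μ)`, in which the large terms `μ y` cancel; multiplication by `e^{-2μx}` turns
it into the relative amplitude. -/
theorem ampDecay_eq (hσ : SqIntegrable σ) {μ : ℂ} (hμ : μ ≠ 0) {Y : ℝ → ℂ × ℂ}
    (hY : IsSolution σ (-μ ^ 2) Y) {x : ℝ} (hx : x ∈ Icc 0 Real.pi) :
    ampDecay μ Y x = Complex.exp (-(2 * μ) * x) * ampDecay μ Y 0 +
      ∫ t in (0 : ℝ)..x, Complex.exp (-(2 * μ) * (x - t)) * ((σ t : ℂ) * ampGrow μ Y t +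
        (2 * μ)⁻¹ * ((σ t : ℂ) ^ 2 * (ampGrow μ Y t + ampDecay μ Y t))) := by
  have h := ((isPrimitive_cexp μ Real.pi).mul Real.pi_pos.le ((hY.isPrimitive_fst hσ).add
    ((hY.isPrimitive_snd hσ).const_mul (-μ⁻¹)))).eq_add x hx
  have h1 : ∀ t : ℝ, Complex.exp (-(2 * μ) * (x - t)) * ((σ t : ℂ) * ampGrow μ Y t +
      (2 * μ)⁻¹ * ((σ t : ℂ) ^ 2 * (ampGrow μ Y t + ampDecay μ Y t))) =
      Complex.exp (-(2 * μ) * x) * (μ * Complex.exp (μ * t) * ((Y t).1 + -μ⁻¹ * (Y t).2) +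
        Complex.exp (μ * t) * ((σ t : ℂ) * (Y t).1 + (Y t).2 + -μ⁻¹ *
          (-((σ t : ℂ) * (Y t).2 + (σ t : ℂ) ^ 2 * (Y t).1 + -μ ^ 2 * (Y t).1)))) := by
    intro t
    have e1 : Complex.exp (-(2 * μ) * (x - t)) = Complex.exp (-(2 * μ) * x) *
        Complex.exp (μ * t) * Complex.exp (μ * t) := by
      rw [← Complex.exp_add, ← Complex.exp_add]; congr 1; ring
    have e2 : Complex.exp (μ * t) * Complex.exp (-μ * t) = 1 := by
      rw [← Complex.exp_add, neg_mul, add_neg_cancel, Complex.exp_zero]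
    rw [e1]
    simp only [ampGrow, ampDecay]
    have e3 : Complex.exp (-μ * t) = (Complex.exp (μ * t))⁻¹ := by
      rw [neg_mul, Complex.exp_neg]
    rw [e3]
    have e4 := Complex.exp_ne_zero (μ * t)
    field_simp
    ring
  rw [intervalIntegral.integral_congr (fun t _ => h1 t), intervalIntegral.integral_const_mul]
  have h2 : ampDecay μ Y x = Complex.exp (-(2 * μ) * x) * (Complex.exp (μ * x) *
      ((Y x).1 + -μ⁻¹ * (Y x).2)) := by
    rw [← mul_assoc, ← Complex.exp_add, ampDecay, sub_eq_add_neg, neg_mul μ⁻¹]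
    congr 2
    ring
  rw [h2, h, ampDecay]
  simp
  ring

theorem continuousOn_ampGrow {μ : ℂ} {z : ℂ} {Y : ℝ → ℂ × ℂ} (hY : IsSolution σ z Y) :
    ContinuousOn (ampGrow μ Y) (Icc 0 Real.pi) := by
  refine ContinuousOn.mul (by fun_prop) (hY.continuousOn.fst.add ?_)
  exact continuousOn_const.mul hY.continuousOn.snd

theorem continuousOn_ampDecay {μ : ℂ} {z : ℂ} {Y : ℝ → ℂ × ℂ} (hY : IsSolution σ z Y) :
    ContinuousOn (ampDecay μ Y) (Icc 0 Real.pi) := by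
  refine ContinuousOn.mul (by fun_prop) (hY.continuousOn.fst.sub ?_)
  exact continuousOn_const.mul hY.continuousOn.snd

theorem norm_ampDecay_le (hσ : SqIntegrable σ) {μ : ℂ} (hμ : μ ≠ 0) {Y : ℝ → ℂ × ℂ}
    (hY : IsSolution σ (-μ ^ 2) Y) {x : ℝ} (hx : x ∈ Icc 0 Real.pi) :
    ‖ampDecay μ Y x‖ ≤ Real.exp (-(2 * μ.re * x)) * ‖ampDecay μ Y 0‖ +
      ∫ t in (0 : ℝ)..x, Real.exp (-(2 * μ.re * (x - t))) * (|σ t| * ‖ampGrow μ Y t‖ +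
        (2 * ‖μ‖)⁻¹ * (σ t ^ 2 * (‖ampGrow μ Y t‖ + ‖ampDecay μ Y t‖))) := by
  have hexp : ∀ s : ℝ, ‖Complex.exp (-(2 * μ) * s)‖ = Real.exp (-(2 * μ.re * s)) := by
    intro s
    rw [Complex.norm_exp]
    simp
  have h0 : (0 : ℝ) ∈ Icc 0 Real.pi := ⟨le_rfl, Real.pi_pos.le⟩
  have hsub : uIcc 0 x ⊆ Icc 0 Real.pi := uIcc_subset_Icc h0 hx
  have hsub' : uIcc 0 x ⊆ uIcc 0 Real.pi := by rwa [uIcc_of_le Real.pi_pos.le]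
  have hP := ((continuousOn_ampGrow (μ := μ) hY).mono hsub).norm
  have hQ := ((continuousOn_ampDecay (μ := μ) hY).mono hsub).norm
  rw [ampDecay_eq hσ hμ hY hx]
  refine (norm_add_le _ _).trans ?_
  rw [norm_mul, hexp]
  gcongr
  refine intervalIntegral.norm_integral_le_of_norm_le hx.1
    (Filter.Eventually.of_forall fun t ht => ?_) ?_
  · rw [norm_mul, ← Complex.ofReal_sub, hexp]
    gcongr
    refine (norm_add_le _ _).trans ?_
    simp only [norm_mul, norm_inv, Complex.norm_real, Complex.norm_ofNat, norm_pow, sq_abs,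
      Real.norm_eq_abs]
    gcongr
    exact norm_add_le _ _
  · refine IntervalIntegrable.continuousOn_mul (((hσ.intervalIntegrable.mono_set
      hsub').abs.mul_continuousOn hP).add (((hσ.intervalIntegrable_sq.mono_set
      hsub').mul_continuousOn (hP.add hQ)).const_mul _)) (Continuous.continuousOn ?_)
    fun_prop

theorem norm_ampGrow_sub_le (hσ : SqIntegrable σ) {μ : ℂ} (hμ : μ ≠ 0) {Y : ℝ → ℂ × ℂ}
    (hY : IsSolution σ (-μ ^ 2) Y) {x : ℝ} (hx : x ∈ Icc 0 Real.pi) :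
    ‖ampGrow μ Y x - ampGrow μ Y 0‖ ≤
      ∫ t in (0 : ℝ)..x, (|σ t| * ‖ampDecay μ Y t‖ +
        (2 * ‖μ‖)⁻¹ * (σ t ^ 2 * (‖ampGrow μ Y t‖ + ‖ampDecay μ Y t‖))) := by
  have h0 : (0 : ℝ) ∈ Icc 0 Real.pi := ⟨le_rfl, Real.pi_pos.le⟩
  have hsub : uIcc 0 x ⊆ Icc 0 Real.pi := uIcc_subset_Icc h0 hx
  have hsub' : uIcc 0 x ⊆ uIcc 0 Real.pi := by rwa [uIcc_of_le Real.pi_pos.le]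
  have hP := ((continuousOn_ampGrow (μ := μ) hY).mono hsub).norm
  have hQ := ((continuousOn_ampDecay (μ := μ) hY).mono hsub).norm
  rw [(isPrimitive_ampGrow hσ hμ hY).sub_eq h0 hx]
  refine intervalIntegral.norm_integral_le_of_norm_le hx.1
    (Filter.Eventually.of_forall fun t ht => ?_) ?_
  · refine (norm_sub_le _ _).trans ?_
    simp only [norm_mul, norm_inv, Complex.norm_real, Complex.norm_ofNat, norm_pow, sq_abs,
      Real.norm_eq_abs]
    gcongr
    exact norm_add_le _ _
  · exact ((hσ.intervalIntegrable.mono_set hsub').abs.mul_continuousOn hQ).add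
      (((hσ.intervalIntegrable_sq.mono_set hsub').mul_continuousOn (hP.add hQ)).const_mul _)

/-- For `Re μ ≥ 0` and `|μ| ≥ 1` all kernels are bounded by `|σ| + σ²`. Adding the inequalities for
the two amplitudes gives the factor `2` in the Grönwall kernel, which does not depend on `μ`. -/
theorem exists_norm_amp_le (hσ : SqIntegrable σ) : ∃ K : ℝ, 0 < K ∧ ∀ μ : ℂ, 0 ≤ μ.re → 1 ≤ ‖μ‖ →
    ∀ Y, IsSolution σ (-μ ^ 2) Y → ∀ x ∈ Icc 0 Real.pi,
      ‖ampGrow μ Y x‖ + ‖ampDecay μ Y x‖ ≤ (‖ampGrow μ Y 0‖ + ‖ampDecay μ Y 0‖) * K := by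
  have hk : IntervalIntegrable (fun t => 2 * (|σ t| + σ t ^ 2)) volume 0 Real.pi :=
    (hσ.intervalIntegrable.abs.add hσ.intervalIntegrable_sq).const_mul 2
  have hk0 : ∀ t, 0 ≤ 2 * (|σ t| + σ t ^ 2) := fun t => by positivity
  refine ⟨Real.exp (∫ t in (0 : ℝ)..Real.pi, 2 * (|σ t| + σ t ^ 2)), Real.exp_pos _,
    fun μ hre hμ Y hY x hx => ?_⟩
  have hμ0 : μ ≠ 0 := norm_pos_iff.1 (by linarith)
  have hP := (continuousOn_ampGrow (μ := μ) hY).norm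
  have hQ := (continuousOn_ampDecay (μ := μ) hY).norm
  have h0 : (0 : ℝ) ∈ Icc 0 Real.pi := ⟨le_rfl, Real.pi_pos.le⟩
  have hinv : (2 * ‖μ‖)⁻¹ ≤ 1 := inv_le_one_of_one_le₀ (by linarith)
  have hinv0 : 0 ≤ (2 * ‖μ‖)⁻¹ := by positivity
  refine (gronwall_integrable (a := ‖ampGrow μ Y 0‖ + ‖ampDecay μ Y 0‖) Real.pi_pos.le hk (fun t _ => hk0 t) (hP.add hQ) ?_ x hx).trans ?_
  · intro y hy
    have hsub : uIcc 0 y ⊆ Icc 0 Real.pi := uIcc_subset_Icc h0 hy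
    have hsub' : uIcc 0 y ⊆ uIcc 0 Real.pi := by rwa [uIcc_of_le Real.pi_pos.le]
    have i1 := hσ.intervalIntegrable.abs.mono_set hsub'
    have i2 := hσ.intervalIntegrable_sq.mono_set hsub'
    have j : IntervalIntegrable (fun t => (|σ t| + σ t ^ 2) *
        (‖ampGrow μ Y t‖ + ‖ampDecay μ Y t‖)) volume 0 y :=
      (i1.add i2).mul_continuousOn ((hP.add hQ).mono hsub)
    have e1 : ‖ampGrow μ Y y‖ ≤ ‖ampGrow μ Y 0‖ + ∫ t in (0 : ℝ)..y, (|σ t| + σ t ^ 2) *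
        (‖ampGrow μ Y t‖ + ‖ampDecay μ Y t‖) := by
      have h1 := norm_ampGrow_sub_le hσ hμ0 hY hy
      have h2 := norm_sub_norm_le (ampGrow μ Y y) (ampGrow μ Y 0)
      have h3 : (∫ t in (0 : ℝ)..y, (|σ t| * ‖ampDecay μ Y t‖ +
          (2 * ‖μ‖)⁻¹ * (σ t ^ 2 * (‖ampGrow μ Y t‖ + ‖ampDecay μ Y t‖)))) ≤
          ∫ t in (0 : ℝ)..y, (|σ t| + σ t ^ 2) * (‖ampGrow μ Y t‖ + ‖ampDecay μ Y t‖) := by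
        refine intervalIntegral.integral_mono_on hy.1 ?_ j fun t _ => ?_
        · exact (i1.mul_continuousOn (hQ.mono hsub)).add
            ((i2.mul_continuousOn ((hP.add hQ).mono hsub)).const_mul _)
        · have a1 := mul_nonneg (abs_nonneg (σ t)) (norm_nonneg (ampGrow μ Y t))
          have a2 : 0 ≤ σ t ^ 2 * (‖ampGrow μ Y t‖ + ‖ampDecay μ Y t‖) := by positivity
          nlinarith
      linarith
    have e2 : ‖ampDecay μ Y y‖ ≤ ‖ampDecay μ Y 0‖ + ∫ t in (0 : ℝ)..y, (|σ t| + σ t ^ 2) *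
        (‖ampGrow μ Y t‖ + ‖ampDecay μ Y t‖) := by
      refine (norm_ampDecay_le hσ hμ0 hY hy).trans (add_le_add ?_ ?_)
      · refine mul_le_of_le_one_left (norm_nonneg _) (Real.exp_le_one_iff.2 ?_)
        have := mul_nonneg hre hy.1
        linarith
      · refine intervalIntegral.integral_mono_on hy.1 ?_ j fun t ht => ?_
        · refine IntervalIntegrable.continuousOn_mul ((i1.mul_continuousOn (hP.mono hsub)).add
            ((i2.mul_continuousOn ((hP.add hQ).mono hsub)).const_mul _)) (Continuous.continuousOn ?_)
          fun_prop
        · have a1 := mul_nonneg (abs_nonneg (σ t)) (norm_nonneg (ampDecay μ Y t))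
          have a2 : 0 ≤ σ t ^ 2 * (‖ampGrow μ Y t‖ + ‖ampDecay μ Y t‖) := by positivity
          refine (mul_le_of_le_one_left (by positivity) (Real.exp_le_one_iff.2 ?_)).trans ?_
          · have := mul_nonneg hre (sub_nonneg.2 ht.2)
            linarith
          · nlinarith
    have e3 : (∫ t in (0 : ℝ)..y, 2 * (|σ t| + σ t ^ 2) *
        (‖ampGrow μ Y t‖ + ‖ampDecay μ Y t‖)) = 2 * ∫ t in (0 : ℝ)..y, (|σ t| + σ t ^ 2) *
        (‖ampGrow μ Y t‖ + ‖ampDecay μ Y t‖) := by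
      rw [← intervalIntegral.integral_const_mul]
      simp only [mul_assoc]
    simp only [Pi.add_apply]
    rw [e3]
    linarith
  · gcongr
    exact intervalIntegral.integral_mono_interval le_rfl hx.1 hx.2
      (Filter.Eventually.of_forall hk0) hk

/-- A bootstrap. Inserting the uniform bound into Duhamel's formula shows that the relative decaying
amplitude is `O(e^{-2τx} + τ^{-1/2})`, `τ = Re μ`. The growing amplitude changes only by the
integral of `|σ|` against this, plus a term of order `1 / |μ|`, so it too changes by `O(τ^{-1/2})`.
-/
theorem exists_norm_amp_sub_le (hσ : SqIntegrable σ) : ∃ K : ℝ, 0 < K ∧ ∀ μ : ℂ, 1 ≤ μ.re →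
    ∀ Y, IsSolution σ (-μ ^ 2) Y →
      ‖ampGrow μ Y Real.pi - ampGrow μ Y 0‖ + ‖ampDecay μ Y Real.pi‖ ≤
        (‖ampGrow μ Y 0‖ + ‖ampDecay μ Y 0‖) * (K / √μ.re) := by
  obtain ⟨K, hK, hbound⟩ := exists_norm_amp_le hσ
  set B := ∫ t in (0 : ℝ)..Real.pi, σ t ^ 2 with hB
  set A := ∫ t in (0 : ℝ)..Real.pi, |σ t| with hA
  have hB0 : 0 ≤ B := intervalIntegral.integral_nonneg Real.pi_pos.le fun _ _ => sq_nonneg _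
  have hA0 : 0 ≤ A := intervalIntegral.integral_nonneg Real.pi_pos.le fun _ _ => abs_nonneg _
  -- The summand `1` absorbs `e^{-2πτ}`, which is at most `1 / √τ`; the other two come from the `σ`
  -- and `σ²` terms in `decay`.
  set D := 1 + K * (1 + B) + K * B with hD
  have hD0 : 0 < D := by positivity
  refine ⟨(1 + B + K * B + A * D) + D + 1, by positivity, fun μ hre Y hY => ?_⟩
  set τ := μ.re with hτ
  have hτ0 : 0 < τ := by linarith
  have hμ : τ ≤ ‖μ‖ := Complex.re_le_norm μ
  have hμ0 : μ ≠ 0 := norm_pos_iff.1 (by linarith)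
  set N := ‖ampGrow μ Y 0‖ + ‖ampDecay μ Y 0‖ with hN
  have hN0 : 0 ≤ N := by positivity
  have hb := hbound μ hτ0.le (by linarith) Y hY
  have hP := (continuousOn_ampGrow (μ := μ) hY).norm
  have hQ := (continuousOn_ampDecay (μ := μ) hY).norm
  have h0 : (0 : ℝ) ∈ Icc 0 Real.pi := ⟨le_rfl, Real.pi_pos.le⟩
  have hpi : Real.pi ∈ Icc 0 Real.pi := ⟨Real.pi_pos.le, le_rfl⟩
  have hs1 : 1 ≤ √τ := Real.one_le_sqrt.2 hre
  have hss : √τ * √τ = τ := Real.mul_self_sqrt hτ0.le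
  have hinv : (2 * ‖μ‖)⁻¹ ≤ 1 / √τ := by
    rw [inv_eq_one_div]
    refine one_div_le_one_div_of_le (by positivity) ?_
    nlinarith
  have h2τ : 1 / √(2 * τ) ≤ 1 / √τ :=
    one_div_le_one_div_of_le (by positivity) (Real.sqrt_le_sqrt (by linarith))
  have decay : ∀ x ∈ Icc 0 Real.pi,
      ‖ampDecay μ Y x‖ ≤ N * (Real.exp (-(2 * τ * x)) + (K * (1 + B) + K * B) / √τ) := by
    intro x hx
    have hsub : uIcc 0 x ⊆ Icc 0 Real.pi := uIcc_subset_Icc h0 hx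
    have hsub' : uIcc 0 x ⊆ uIcc 0 Real.pi := by rwa [uIcc_of_le Real.pi_pos.le]
    have i1 := hσ.intervalIntegrable.abs.mono_set hsub'
    have i2 := hσ.intervalIntegrable_sq.mono_set hsub'
    have ie : IntervalIntegrable (fun t => Real.exp (-(2 * τ * (x - t))) * |σ t|) volume 0 x := by
      refine i1.continuousOn_mul (Continuous.continuousOn ?_)
      fun_prop
    have h1 : (∫ t in (0 : ℝ)..x, Real.exp (-(2 * τ * (x - t))) * (|σ t| * ‖ampGrow μ Y t‖ +
        (2 * ‖μ‖)⁻¹ * (σ t ^ 2 * (‖ampGrow μ Y t‖ + ‖ampDecay μ Y t‖)))) ≤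
        ∫ t in (0 : ℝ)..x, ((N * K) * (Real.exp (-(2 * τ * (x - t))) * |σ t|) +
          (1 / √τ * (N * K)) * σ t ^ 2) := by
      refine intervalIntegral.integral_mono_on hx.1 ?_
        ((ie.const_mul _).add (i2.const_mul _)) fun t ht => ?_
      · refine IntervalIntegrable.continuousOn_mul ((i1.mul_continuousOn (hP.mono hsub)).add
          ((i2.mul_continuousOn ((hP.add hQ).mono hsub)).const_mul _)) (Continuous.continuousOn ?_)
        fun_prop
      · have hbt := hb t ⟨ht.1, ht.2.trans hx.2⟩
        have hPt : ‖ampGrow μ Y t‖ ≤ N * K := by linarith [norm_nonneg (ampDecay μ Y t)]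
        have hE : Real.exp (-(2 * τ * (x - t))) ≤ 1 := Real.exp_le_one_iff.2 (by
          have := mul_nonneg hτ0.le (sub_nonneg.2 ht.2)
          linarith)
        rw [mul_add]
        refine add_le_add ?_ ?_
        · calc _ ≤ Real.exp (-(2 * τ * (x - t))) * (|σ t| * (N * K)) := by gcongr
            _ = _ := by ring
        · calc _ ≤ 1 * (1 / √τ * (σ t ^ 2 * (N * K))) := by gcongr
            _ = _ := by ring
    have h2 := integral_exp_mul_abs_le (c := 2 * τ) (by linarith) hσ.intervalIntegrable
      hσ.intervalIntegrable_sq hx (s := fun t => x - t) (Or.inr rfl)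
    have h3 : ∫ t in (0 : ℝ)..x, σ t ^ 2 ≤ B :=
      intervalIntegral.integral_mono_interval le_rfl hx.1 hx.2
        (Filter.Eventually.of_forall fun _ => sq_nonneg _) hσ.intervalIntegrable_sq
    rw [intervalIntegral.integral_add (ie.const_mul _) (i2.const_mul _),
      intervalIntegral.integral_const_mul, intervalIntegral.integral_const_mul] at h1
    have h4 : (1 + B) / √(2 * τ) ≤ (1 + B) / √τ := by
      rw [div_eq_mul_one_div, div_eq_mul_one_div (1 + B)]
      gcongr
    calc ‖ampDecay μ Y x‖ ≤ _ := norm_ampDecay_le hσ hμ0 hY hx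
      _ ≤ Real.exp (-(2 * τ * x)) * N + (N * K * ((1 + B) / √τ) + 1 / √τ * (N * K) * B) := by
        refine add_le_add ?_ (h1.trans (add_le_add ?_ ?_))
        · gcongr
          exact le_add_of_nonneg_left (norm_nonneg _)
        · gcongr
          exact h2.trans h4
        · gcongr
      _ = _ := by ring
  have e1 : ‖ampDecay μ Y Real.pi‖ ≤ N * (D / √τ) := by
    refine (decay _ hpi).trans ?_
    gcongr
    rw [hD, add_assoc, add_div 1]
    gcongr
    have h1 : Real.exp (-(2 * τ * Real.pi)) ≤ 1 / (2 * τ * Real.pi) := by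
      rw [Real.exp_neg, inv_eq_one_div]
      refine one_div_le_one_div_of_le (by positivity) ?_
      linarith [Real.add_one_le_exp (2 * τ * Real.pi)]
    refine h1.trans (one_div_le_one_div_of_le (by positivity) ?_)
    nlinarith [Real.pi_gt_three]
  have e2 : ‖ampGrow μ Y Real.pi - ampGrow μ Y 0‖ ≤ N * ((1 + B + K * B + A * D) / √τ) := by
    have i1 := hσ.intervalIntegrable.abs
    have i2 := hσ.intervalIntegrable_sq
    have ie : IntervalIntegrable (fun t => Real.exp (-(2 * τ * t)) * |σ t|) volume 0 Real.pi := by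
      refine i1.continuousOn_mul (Continuous.continuousOn ?_)
      fun_prop
    have hIcc : uIcc 0 Real.pi = Icc 0 Real.pi := uIcc_of_le Real.pi_pos.le
    have h1 : (∫ t in (0 : ℝ)..Real.pi, (|σ t| * ‖ampDecay μ Y t‖ +
        (2 * ‖μ‖)⁻¹ * (σ t ^ 2 * (‖ampGrow μ Y t‖ + ‖ampDecay μ Y t‖)))) ≤
        ∫ t in (0 : ℝ)..Real.pi, (N * (Real.exp (-(2 * τ * t)) * |σ t|) +
          (N * (D / √τ) * |σ t| + (1 / √τ * (N * K)) * σ t ^ 2)) := by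
      refine intervalIntegral.integral_mono_on Real.pi_pos.le ?_
        ((ie.const_mul _).add ((i1.const_mul _).add (i2.const_mul _))) fun t ht => ?_
      · exact (i1.mul_continuousOn (by rwa [hIcc])).add
          ((i2.mul_continuousOn (by rw [hIcc]; exact hP.add hQ)).const_mul _)
      · have hbt := hb t ht
        have hdt := decay t ht
        have hD1 : (K * (1 + B) + K * B) / √τ ≤ D / √τ := by
          gcongr
          linarith
        rw [← add_assoc]
        refine add_le_add ?_ ?_
        · calc |σ t| * ‖ampDecay μ Y t‖ ≤
              |σ t| * (N * (Real.exp (-(2 * τ * t)) + D / √τ)) := by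
                gcongr
                refine hdt.trans ?_
                gcongr
            _ = _ := by ring
        · calc _ ≤ (1 / √τ * (σ t ^ 2 * (N * K))) := by gcongr
            _ = _ := by ring
    have h2 := integral_exp_mul_abs_le (c := 2 * τ) (by linarith) hσ.intervalIntegrable
      hσ.intervalIntegrable_sq hpi (s := fun t => t) (Or.inl rfl)
    rw [intervalIntegral.integral_add (ie.const_mul _) ((i1.const_mul _).add (i2.const_mul _)),
      intervalIntegral.integral_add (i1.const_mul _) (i2.const_mul _),
      intervalIntegral.integral_const_mul, intervalIntegral.integral_const_mul,
      intervalIntegral.integral_const_mul] at h1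
    have h4 : (1 + B) / √(2 * τ) ≤ (1 + B) / √τ := by
      rw [div_eq_mul_one_div, div_eq_mul_one_div (1 + B)]
      gcongr
    calc _ ≤ _ := norm_ampGrow_sub_le hσ hμ0 hY hpi
      _ ≤ N * ((1 + B) / √τ) + (N * (D / √τ) * A + 1 / √τ * (N * K) * B) := by
        refine h1.trans (add_le_add ?_ le_rfl)
        gcongr
        exact h2.trans h4
      _ = _ := by ring
  calc _ ≤ N * ((1 + B + K * B + A * D) / √τ) + N * (D / √τ) := add_le_add e2 e1
    _ = N * (((1 + B + K * B + A * D) + D) / √τ) := by ring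
    _ ≤ _ := by
      refine mul_le_mul_of_nonneg_left (div_le_div_of_nonneg_right ?_ (Real.sqrt_nonneg _)) hN0
      linarith

end

end QTree
end

open MeasureTheory Set Filter Topology

noncomputable section

namespace QTree

/-! ### Exponential asymptotics in the right half-plane -/

/-- `f(-μ²) = μ^k e^{nπμ} ε(μ)` in the right half-plane outside the unit disc, where `ε` is bounded
and `ε(μ) → c` as `Re μ → ∞`. -/
def HasAsymp (f : ℂ → ℂ) (k : ℤ) (n : ℕ) (c : ℝ) : Prop :=
  ∃ ε : ℂ → ℂ, (∃ M : ℝ, ∀ μ : ℂ, 0 ≤ μ.re → 1 ≤ ‖μ‖ → ‖ε μ‖ ≤ M) ∧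
    Tendsto ε (comap Complex.re atTop) (𝓝 (c : ℂ)) ∧
    ∀ μ : ℂ, 0 ≤ μ.re → 1 ≤ ‖μ‖ →
      f (-μ ^ 2) = μ ^ k * Complex.exp (n * (Real.pi * μ)) * ε μ

theorem HasAsymp.mul {f g : ℂ → ℂ} {k k' : ℤ} {n n' : ℕ} {c c' : ℝ} (hf : HasAsymp f k n c)
    (hg : HasAsymp g k' n' c') :
    HasAsymp (fun z => f z * g z) (k + k') (n + n') (c * c') := by
  obtain ⟨ε, ⟨M, hM⟩, hε, h⟩ := hf
  obtain ⟨ε', ⟨M', hM'⟩, hε', h'⟩ := hg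
  refine ⟨fun μ => ε μ * ε' μ, ⟨M * M', fun μ h1 h2 => ?_⟩, ?_, fun μ h1 h2 => ?_⟩
  · rw [norm_mul]
    exact mul_le_mul (hM μ h1 h2) (hM' μ h1 h2) (norm_nonneg _)
      ((norm_nonneg _).trans (hM μ h1 h2))
  · simpa using hε.mul hε'
  · have hμ : μ ≠ 0 := norm_pos_iff.1 (by linarith)
    simp only
    rw [h μ h1 h2, h' μ h1 h2, zpow_add₀ hμ]
    push_cast
    rw [add_mul, Complex.exp_add]
    ring

theorem HasAsymp.add {f g : ℂ → ℂ} {k : ℤ} {n : ℕ} {c c' : ℝ} (hf : HasAsymp f k n c)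
    (hg : HasAsymp g k n c') : HasAsymp (fun z => f z + g z) k n (c + c') := by
  obtain ⟨ε, ⟨M, hM⟩, hε, h⟩ := hf
  obtain ⟨ε', ⟨M', hM'⟩, hε', h'⟩ := hg
  refine ⟨fun μ => ε μ + ε' μ, ⟨M + M', fun μ h1 h2 => ?_⟩, ?_, fun μ h1 h2 => ?_⟩
  · exact (norm_add_le _ _).trans (add_le_add (hM μ h1 h2) (hM' μ h1 h2))
  · simpa using hε.add hε'
  · simp only
    rw [h μ h1 h2, h' μ h1 h2]
    ring

theorem HasAsymp.zero (k : ℤ) (n : ℕ) : HasAsymp (fun _ => 0) k n 0 :=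
  ⟨fun _ => 0, ⟨0, fun _ _ _ => by simp⟩, by simpa using tendsto_const_nhds, fun _ _ _ => by simp⟩

theorem HasAsymp.one : HasAsymp (fun _ => 1) 0 0 1 :=
  ⟨fun _ => 1, ⟨1, fun _ _ _ => by simp⟩, by simpa using tendsto_const_nhds, fun _ _ _ => by simp⟩

theorem HasAsymp.sum {ι : Type*} (s : Finset ι) {f : ι → ℂ → ℂ} {k : ℤ} {n : ℕ} {c : ι → ℝ}
    (h : ∀ i ∈ s, HasAsymp (f i) k n (c i)) :
    HasAsymp (fun z => ∑ i ∈ s, f i z) k n (∑ i ∈ s, c i) := by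
  classical
  induction s using Finset.induction_on with
  | empty => simpa using HasAsymp.zero k n
  | insert i s hi ih =>
    simp only [Finset.sum_insert hi]
    exact (h i (by simp)).add (ih fun j hj => h j (by simp [hj]))

theorem HasAsymp.prod {ι : Type*} (s : Finset ι) {f : ι → ℂ → ℂ} {k : ι → ℤ} {n : ι → ℕ}
    {c : ι → ℝ} (h : ∀ i ∈ s, HasAsymp (f i) (k i) (n i) (c i)) :
    HasAsymp (fun z => ∏ i ∈ s, f i z) (∑ i ∈ s, k i) (∑ i ∈ s, n i) (∏ i ∈ s, c i) := by
  classical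
  induction s using Finset.induction_on with
  | empty => simpa using HasAsymp.one
  | insert i s hi ih =>
    simp only [Finset.sum_insert hi, Finset.prod_insert hi]
    exact (h i (by simp)).mul (ih fun j hj => h j (by simp [hj]))

theorem tendsto_inv_comap_re : Tendsto (fun μ : ℂ => μ⁻¹) (comap Complex.re atTop) (𝓝 0) := by
  rw [tendsto_zero_iff_norm_tendsto_zero]
  have h : Tendsto (fun μ : ℂ => ‖μ‖) (comap Complex.re atTop) atTop :=
    tendsto_atTop_mono (fun μ => Complex.re_le_norm μ) tendsto_comap
  simpa [Function.comp_def] using tendsto_inv_atTop_zero.comp h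

/-- The lower term carries an extra `μ⁻¹`, bounded by `1` outside the unit disc and tending to `0`.
It absorbs `γ y(π)` in the Neumann condition at `x = π`. -/
theorem HasAsymp.add_lower {f g : ℂ → ℂ} {k : ℤ} {n : ℕ} {c c' : ℝ} (hf : HasAsymp f (k + 1) n c)
    (hg : HasAsymp g k n c') : HasAsymp (fun z => f z + g z) (k + 1) n c := by
  obtain ⟨ε, ⟨M, hM⟩, hε, h⟩ := hf
  obtain ⟨ε', ⟨M', hM'⟩, hε', h'⟩ := hg
  refine ⟨fun μ => ε μ + μ⁻¹ * ε' μ, ⟨M + 1 * M', fun μ h1 h2 => ?_⟩, ?_, fun μ h1 h2 => ?_⟩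
  · refine (norm_add_le _ _).trans (add_le_add (hM μ h1 h2) ?_)
    rw [norm_mul, norm_inv]
    exact mul_le_mul (inv_le_one_of_one_le₀ h2) (hM' μ h1 h2) (norm_nonneg _) zero_le_one
  · simpa using hε.add (tendsto_inv_comap_re.mul hε')
  · have hμ : μ ≠ 0 := norm_pos_iff.1 (by linarith)
    simp only
    rw [h μ h1 h2, h' μ h1 h2, zpow_add_one₀ hμ]
    field_simp

theorem HasAsymp.const_mul {f : ℂ → ℂ} {k : ℤ} {n : ℕ} {c : ℝ} (hf : HasAsymp f k n c) (a : ℝ) :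
    HasAsymp (fun z => a * f z) k n (a * c) := by
  obtain ⟨ε, ⟨M, hM⟩, hε, h⟩ := hf
  refine ⟨fun μ => a * ε μ, ⟨‖(a : ℂ)‖ * M, fun μ h1 h2 => ?_⟩, ?_, fun μ h1 h2 => ?_⟩
  · rw [norm_mul]
    exact mul_le_mul_of_nonneg_left (hM μ h1 h2) (norm_nonneg _)
  · simpa using hε.const_mul (a : ℂ)
  · simp only
    rw [h μ h1 h2]
    ring

/-! ### Asymptotics of the characteristic functions of an edge -/

section

variable {σ : ℝ → ℝ}

theorem fst_pi_eq (μ : ℂ) (Y : ℝ → ℂ × ℂ) :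
    (Y Real.pi).1 = Complex.exp (Real.pi * μ) *
      ((ampGrow μ Y Real.pi + ampDecay μ Y Real.pi) / 2) := by
  have h : Complex.exp (Real.pi * μ) * Complex.exp (-μ * Real.pi) = 1 := by
    rw [← Complex.exp_add, ← Complex.exp_zero]; congr 1; ring
  rw [ampGrow, ampDecay]
  linear_combination (-(Y Real.pi).1) * h

theorem snd_pi_eq {μ : ℂ} (hμ : μ ≠ 0) (Y : ℝ → ℂ × ℂ) :
    (Y Real.pi).2 = Complex.exp (Real.pi * μ) * (μ *
      ((ampGrow μ Y Real.pi - ampDecay μ Y Real.pi) / 2)) := by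
  have h : Complex.exp (Real.pi * μ) * Complex.exp (-μ * Real.pi) = 1 := by
    rw [← Complex.exp_add, ← Complex.exp_zero]; congr 1; ring
  have h' : μ * μ⁻¹ = 1 := mul_inv_cancel₀ hμ
  rw [ampGrow, ampDecay]
  linear_combination (-(Y Real.pi).2 * (μ * μ⁻¹)) * h - (Y Real.pi).2 * h'

/-- The asymptotics of solutions whose initial data give the amplitudes `μ^k` and `±μ^k`. -/
theorem hasAsymp_solution (hσ : SqIntegrable σ) (a b : ℂ) (k : ℤ)
    (h1 : ∀ μ : ℂ, μ ≠ 0 → a + μ⁻¹ * b = μ ^ k) (h2 : ∀ μ : ℂ, μ ≠ 0 → ‖a - μ⁻¹ * b‖ = ‖μ ^ k‖) :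
    HasAsymp (fun z => (solution σ z a b Real.pi).1) k 1 (1 / 2) ∧
      HasAsymp (fun z => (solution σ z a b Real.pi).2) (k + 1) 1 (1 / 2) := by
  obtain ⟨K, hK, hb⟩ := exists_norm_amp_le hσ
  obtain ⟨K', hK', hb'⟩ := exists_norm_amp_sub_le hσ
  have hpi : Real.pi ∈ Icc 0 Real.pi := ⟨Real.pi_pos.le, le_rfl⟩
  have hamp : ∀ μ : ℂ, μ ≠ 0 → ampGrow μ (solution σ (-μ ^ 2) a b) 0 = μ ^ k ∧
      ‖ampDecay μ (solution σ (-μ ^ 2) a b) 0‖ = ‖μ ^ k‖ := by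
    intro μ hμ
    obtain ⟨-, h0⟩ := isSolution_solution hσ (-μ ^ 2) a b
    constructor
    · rw [ampGrow, h0, ← h1 μ hμ]
      simp
    · rw [ampDecay, h0, ← h2 μ hμ]
      simp
  -- Amplitudes at `π` normalized by their initial size: `P → 1` and `Q → 0` as `Re μ → ∞`. Hence
  -- `y(π)` and `y^{[1]}(π) / μ` are both `μ^k e^{πμ} (1/2 + o(1))`.
  set P : ℂ → ℂ := fun μ => (μ ^ k)⁻¹ * ampGrow μ (solution σ (-μ ^ 2) a b) Real.pi with hP
  set Q : ℂ → ℂ := fun μ => (μ ^ k)⁻¹ * ampDecay μ (solution σ (-μ ^ 2) a b) Real.pi with hQ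
  have bound : ∀ μ : ℂ, 0 ≤ μ.re → 1 ≤ ‖μ‖ → ‖P μ‖ + ‖Q μ‖ ≤ 2 * K := by
    intro μ hre hμ
    have hμ0 : μ ≠ 0 := norm_pos_iff.1 (by linarith)
    have hpos : 0 < ‖μ ^ k‖ := norm_pos_iff.2 (zpow_ne_zero _ hμ0)
    have h := hb μ hre hμ _ (isSolution_solution hσ (-μ ^ 2) a b).1 _ hpi
    rw [(hamp μ hμ0).1, (hamp μ hμ0).2] at h
    rw [hP, hQ]
    simp only [norm_mul, norm_inv]
    rw [← mul_add, inv_mul_le_iff₀ hpos]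
    linarith
  have bound' : ∀ μ : ℂ, 1 ≤ μ.re → ‖P μ - 1‖ + ‖Q μ‖ ≤ 2 * (K' / √μ.re) := by
    intro μ hre
    have hμ : 1 ≤ ‖μ‖ := hre.trans (Complex.re_le_norm μ)
    have hμ0 : μ ≠ 0 := norm_pos_iff.1 (by linarith)
    have hne : μ ^ k ≠ 0 := zpow_ne_zero _ hμ0
    have hpos : 0 < ‖μ ^ k‖ := norm_pos_iff.2 hne
    have h := hb' μ hre _ (isSolution_solution hσ (-μ ^ 2) a b).1
    rw [(hamp μ hμ0).1, (hamp μ hμ0).2] at h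
    have e : P μ - 1 = (μ ^ k)⁻¹ * (ampGrow μ (solution σ (-μ ^ 2) a b) Real.pi - μ ^ k) := by
      rw [hP, mul_sub, inv_mul_cancel₀ hne]
    rw [e, hQ]
    simp only [norm_mul, norm_inv]
    rw [← mul_add, inv_mul_le_iff₀ hpos]
    linarith
  have hlim : Tendsto (fun μ : ℂ => 2 * (K' / √μ.re)) (comap Complex.re atTop) (𝓝 0) := by
    have h := (tendsto_const_nhds (x := K')).div_atTop (Real.tendsto_sqrt_atTop.comp
      (tendsto_comap (f := Complex.re) (x := atTop)))
    simpa using h.const_mul 2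
  have hev : ∀ᶠ μ : ℂ in comap Complex.re atTop, 1 ≤ μ.re :=
    (eventually_ge_atTop (1 : ℝ)).comap _
  have hPlim : Tendsto P (comap Complex.re atTop) (𝓝 1) := by
    rw [tendsto_iff_norm_sub_tendsto_zero]
    refine squeeze_zero' (Eventually.of_forall fun _ => norm_nonneg _) ?_ hlim
    filter_upwards [hev] with μ hμ
    linarith [bound' μ hμ, norm_nonneg (Q μ)]
  have hQlim : Tendsto Q (comap Complex.re atTop) (𝓝 0) := by
    rw [tendsto_zero_iff_norm_tendsto_zero]
    refine squeeze_zero' (Eventually.of_forall fun _ => norm_nonneg _) ?_ hlim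
    filter_upwards [hev] with μ hμ
    linarith [bound' μ hμ, norm_nonneg (P μ - 1)]
  constructor
  · refine ⟨fun μ => (P μ + Q μ) / 2, ⟨K, fun μ hre hμ => ?_⟩, ?_, fun μ hre hμ => ?_⟩
    · rw [norm_div, Complex.norm_ofNat]
      linarith [norm_add_le (P μ) (Q μ), bound μ hre hμ]
    · simpa using (hPlim.add hQlim).div_const 2
    · have hμ0 : μ ≠ 0 := norm_pos_iff.1 (by linarith)
      have hne : μ ^ k ≠ 0 := zpow_ne_zero _ hμ0
      simp only [hP, hQ]
      rw [fst_pi_eq μ]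
      push_cast
      field_simp
  · refine ⟨fun μ => (P μ - Q μ) / 2, ⟨K, fun μ hre hμ => ?_⟩, ?_, fun μ hre hμ => ?_⟩
    · rw [norm_div, Complex.norm_ofNat]
      linarith [norm_sub_le (P μ) (Q μ), bound μ hre hμ]
    · simpa using (hPlim.sub hQlim).div_const 2
    · have hμ0 : μ ≠ 0 := norm_pos_iff.1 (by linarith)
      have hne : μ ^ k ≠ 0 := zpow_ne_zero _ hμ0
      simp only [hP, hQ]
      rw [snd_pi_eq hμ0, zpow_add_one₀ hμ0]
      push_cast
      field_simp

/-- `1` for the Dirichlet and `0` for the Neumann condition. -/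
def BC.dirichletCount : BC → ℕ
  | .dirichlet => 1
  | .neumann => 0

theorem hasAsymp_edgeChar (hσ : SqIntegrable σ) (γ : ℝ) (b b' : BC) :
    HasAsymp (fun z => edgeChar σ γ z b b') (1 - b.dirichletCount - b'.dirichletCount) 1 (1 / 2) := by
  -- The initial amplitudes are `1, 1` for `C`, and `μ⁻¹, -μ⁻¹` for `S`.
  obtain ⟨hC, hC'⟩ := hasAsymp_solution hσ 1 0 0 (by simp) (by simp)
  obtain ⟨hS, hS'⟩ := hasAsymp_solution hσ 0 1 (-1) (by simp) (by simp)
  cases b <;> cases b' <;> simp only [edgeChar, BC.dirichletCount]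
  · exact hS
  · exact hS'.add_lower (hS.const_mul γ)
  · exact hC
  · exact hC'.add_lower (hC.const_mul γ)

end

end QTree
end

open MeasureTheory Set Filter Topology

noncomputable section

namespace QTree

namespace Problem

variable {V : Type*} [Fintype V] (P : Problem V)

/-! ### Branches of the tree -/

/-- Passing from an edge to the next one away from `u` strictly decreases the number of vertices
ahead, so this is induction from the leaves towards the root. -/
theorem branch_induction {motive : ∀ u v, P.G.Adj u v → Prop}
    (step : ∀ u v (h : P.G.Adj u v),
      (∀ x (hx : P.G.Adj v x), x ≠ u → motive v x hx) → motive u v h) :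
    ∀ u v (h : P.G.Adj u v), motive u v h := by
  have key : ∀ n u v (h : P.G.Adj u v), P.sideCard u v = n → motive u v h := by
    intro n
    induction n using Nat.strong_induction_on with
    | _ n ih =>
      intro u v h hn
      refine step u v h fun x hx hxu => ih _ ?_ v x hx rfl
      rw [← hn]
      exact P.sideCard_lt h hx hxu
  exact fun u v h => key _ u v h rfl

open Classical in
/-- The vertices on the `v`-side of the edge `{u, v}`. -/
def side (u v : V) : Finset V :=
  Finset.univ.filter fun x => P.G.dist x v < P.G.dist x u

variable {P}

theorem mem_side {u v x : V} : x ∈ P.side u v ↔ P.G.dist x v < P.G.dist x u := by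
  simp [side]

/-- In a tree only one neighbour of `v` is closer to `x`: a shortest walk from `x` to such a
neighbour, extended by `v`, is the unique path from `x` to `v`, and its penultimate vertex is that
neighbour. -/
theorem eq_of_dist_lt {x v y y' : V} (hy : P.G.Adj y v) (hy' : P.G.Adj y' v)
    (h : P.G.dist x y < P.G.dist x v) (h' : P.G.dist x y' < P.G.dist x v) : y = y' := by
  have huniq : ∀ (y : V) (hy : P.G.Adj y v), P.G.dist x y < P.G.dist x v →
      ∃ p : P.G.Walk x v, p.IsPath ∧ p.penultimate = y := by
    intro y hy hlt
    obtain ⟨p, hp⟩ := P.isTree.connected.exists_walk_length_eq_dist x y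
    have hd := P.isTree.dist_eq_dist_add_one_of_adj x hy
    refine ⟨p.concat hy, ?_, by simp⟩
    apply SimpleGraph.Walk.isPath_of_length_eq_dist
    rw [SimpleGraph.Walk.length_concat]
    omega
  obtain ⟨p, hp, hpy⟩ := huniq y hy h
  obtain ⟨q, hq, hqy⟩ := huniq y' hy' h'
  rw [← hpy, ← hqy, (P.isTree.existsUnique_path x v).unique hp hq]

theorem exists_adj_dist_lt {x v : V} (h : x ≠ v) :
    ∃ y, P.G.Adj v y ∧ P.G.dist x y < P.G.dist x v := by
  obtain ⟨p, hp⟩ := P.isTree.connected.exists_walk_length_eq_dist v x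
  cases p with
  | nil => exact absurd rfl h
  | cons hadj q =>
    refine ⟨_, hadj, ?_⟩
    rw [SimpleGraph.Walk.length_cons] at hp
    have := SimpleGraph.dist_le q
    rw [SimpleGraph.dist_comm, P.G.dist_comm (u := x)]
    omega

theorem exists_mem_side {x v : V} (h : x ≠ v) : ∃ y, P.G.Adj v y ∧ x ∈ P.side v y := by
  obtain ⟨y, hy, hlt⟩ := exists_adj_dist_lt h
  exact ⟨y, hy, mem_side.2 hlt⟩

theorem self_mem_side {u v : V} (h : P.G.Adj u v) : v ∈ P.side u v := by
  rw [mem_side, SimpleGraph.dist_self]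
  exact P.isTree.connected.pos_dist_of_ne h.ne'

theorem notMem_side_self {u v : V} : u ∉ P.side u v := by
  rw [mem_side, SimpleGraph.dist_self]
  exact Nat.not_lt_zero _

theorem eq_of_mem_side {x v y y' : V} (hy : P.G.Adj v y) (hy' : P.G.Adj v y')
    (h : x ∈ P.side v y) (h' : x ∈ P.side v y') : y = y' :=
  eq_of_dist_lt hy.symm hy'.symm (mem_side.1 h) (mem_side.1 h')

theorem mem_side_iff {u v x : V} (h : P.G.Adj u v) :
    x ∈ P.side u v ↔ x = v ∨ ∃ y, P.G.Adj v y ∧ y ≠ u ∧ x ∈ P.side v y := by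
  constructor
  · intro hx
    by_cases hxv : x = v
    · exact Or.inl hxv
    obtain ⟨y, hy, hlt⟩ := exists_mem_side hxv
    refine Or.inr ⟨y, hy, ?_, hlt⟩
    rintro rfl
    have h1 := mem_side.1 hx
    have h2 := mem_side.1 hlt
    omega
  · rintro (rfl | ⟨y, hy, hyu, hx⟩)
    · exact self_mem_side h
    · rw [mem_side]
      by_contra hcon
      have hlt : P.G.dist x u < P.G.dist x v :=
        lt_of_le_of_ne (not_lt.mp hcon) (P.isTree.dist_ne_of_adj x h)
      exact hyu (eq_of_dist_lt hy.symm h (mem_side.1 hx) hlt)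

-- The side splits into `v` and the disjoint sides beyond `v`; any additive count over vertices then
-- obeys the recursion of `branchChar`.
open Classical in
theorem sum_side {M : Type*} [AddCommMonoid M] (f : V → M) {u v : V} (h : P.G.Adj u v) :
    ∑ x ∈ P.side u v, f x =
      f v + ∑ x : {x // P.G.Adj v x ∧ x ≠ u}, ∑ y ∈ P.side v x.1, f y := by
  have hs : P.side u v = insert v (Finset.univ.biUnion
      fun x : {x // P.G.Adj v x ∧ x ≠ u} => P.side v x.1) := by
    ext x
    rw [mem_side_iff h]
    simp [and_assoc]
  rw [hs, Finset.sum_insert (by simp [notMem_side_self]), Finset.sum_biUnion]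
  intro x _ y _ hxy
  refine Finset.disjoint_left.2 fun a hx hy => hxy (Subtype.ext ?_)
  exact eq_of_mem_side x.2.1 y.2.1 hx hy

open Classical in
variable (P) in
/-- `1` at the boundary vertices with the Dirichlet condition, and `0` at the other vertices. -/
def dirichletIndicator (v : V) : ℕ := if P.IsBoundary v ∧ P.bc v = .dirichlet then 1 else 0

variable (P) in
/-- The number of Dirichlet boundary vertices on the `v`-side of the edge `{u, v}`. -/
def sideDirichlet (u v : V) : ℕ := ∑ x ∈ P.side u v, P.dirichletIndicator x

theorem isEmpty_of_isBoundary {u v : V} (h : P.G.Adj u v) (hv : P.IsBoundary v) :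
    IsEmpty {x // P.G.Adj v x ∧ x ≠ u} := by
  obtain ⟨a, ha⟩ := Set.ncard_eq_one.1 hv
  have hu : u ∈ P.G.neighborSet v := h.symm
  refine ⟨fun x => x.2.2 ?_⟩
  have hx : x.1 ∈ P.G.neighborSet v := x.2.1
  rw [ha, mem_singleton_iff] at hu hx
  exact hx.trans hu.symm

theorem dirichletIndicator_of_isBoundary {v : V} (hv : P.IsBoundary v) :
    P.dirichletIndicator v = (P.bc v).dirichletCount := by
  cases hb : P.bc v <;> simp [dirichletIndicator, hv, hb, BC.dirichletCount]

-- Each vertex on the side is the far end of exactly one edge of the branch, so this counts edges;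
-- it is the exponential type in units of `π`.
open Classical in
theorem sideCard_eq {u v : V} (h : P.G.Adj u v) :
    P.sideCard u v = 1 + ∑ x : {x // P.G.Adj v x ∧ x ≠ u}, P.sideCard v x.1 := by
  have hc : ∀ u v, P.sideCard u v = ∑ _x ∈ P.side u v, 1 := fun u v => by
    rw [Finset.sum_const, smul_eq_mul, mul_one]; rfl
  simp only [hc]
  rw [sum_side _ h]

open Classical in
theorem sideDirichlet_eq {u v : V} (h : P.G.Adj u v) :
    P.sideDirichlet u v =
      P.dirichletIndicator v + ∑ x : {x // P.G.Adj v x ∧ x ≠ u}, P.sideDirichlet v x.1 :=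
  sum_side _ h

/-! ### Characteristic functions of branches -/

theorem hasAsymp_edgeCharAt {u v : V} (h : P.G.Adj u v) (b b' : BC) :
    HasAsymp (fun z => P.edgeCharAt z h b b') (1 - b.dirichletCount - b'.dirichletCount) 1
      (1 / 2) := by
  unfold edgeCharAt
  split_ifs
  · exact hasAsymp_edgeChar (P.memLp _) _ b b'
  · have := hasAsymp_edgeChar (P.memLp ⟨s(u, v), h⟩) (P.γ ⟨s(u, v), h⟩) b' b
    rwa [sub_right_comm] at this

theorem differentiable_edgeCharAt {u v : V} (h : P.G.Adj u v) (b b' : BC) :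
    Differentiable ℂ fun z => P.edgeCharAt z h b b' := by
  unfold edgeCharAt
  split_ifs <;> exact differentiable_edgeChar (P.memLp _) _ _ _

theorem edgeCharAt_im {z : ℂ} (hz : z.im = 0) {u v : V} (h : P.G.Adj u v) (b b' : BC) :
    (P.edgeCharAt z h b b').im = 0 := by
  unfold edgeCharAt
  split_ifs <;> exact edgeChar_im (P.memLp _) _ hz _ _

/-- In the splitting formula every summand has the same power of `μ` and the same exponential type,
and all leading constants are positive. Nothing cancels, so the orders simply add up along the
branch. -/
theorem hasAsymp_branchChar : ∀ u v (h : P.G.Adj u v), ∀ b : BC,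
    ∃ c : ℝ, 0 < c ∧ HasAsymp (fun z => P.branchChar b u v h z)
      (1 - b.dirichletCount - P.sideDirichlet u v) (P.sideCard u v) c := by
  classical
  refine P.branch_induction fun u v h ih b => ?_
  by_cases hv : P.IsBoundary v
  · have := isEmpty_of_isBoundary h hv
    refine ⟨1 / 2, by norm_num, ?_⟩
    rw [sideCard_eq h, sideDirichlet_eq h, dirichletIndicator_of_isBoundary hv]
    have e : (fun z => P.branchChar b u v h z) = fun z => P.edgeCharAt z h b (P.bc v) := by
      funext z
      rw [branchChar, if_pos hv]
    rw [e]
    simpa using hasAsymp_edgeCharAt h b (P.bc v)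
  · have hD : P.dirichletIndicator v = 0 := by simp [dirichletIndicator, hv]
    choose c hc0 hc using fun x : {x // P.G.Adj v x ∧ x ≠ u} => ih x.1 x.2.1 x.2.2
    have e : (fun z => P.branchChar b u v h z) = fun z => P.edgeCharAt z h b .neumann *
        ∏ x : {x // P.G.Adj v x ∧ x ≠ u}, P.branchChar .dirichlet v x.1 x.2.1 z +
      ∑ x : {x // P.G.Adj v x ∧ x ≠ u}, P.branchChar .neumann v x.1 x.2.1 z *
        (P.edgeCharAt z h b .dirichlet *
          ∏ y ∈ Finset.univ.erase x, P.branchChar .dirichlet v y.1 y.2.1 z) := by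
      funext z
      rw [branchChar, if_neg hv]
    have h1 : HasAsymp (fun z => P.edgeCharAt z h b .neumann *
        ∏ x : {x // P.G.Adj v x ∧ x ≠ u}, P.branchChar .dirichlet v x.1 x.2.1 z)
        (1 - b.dirichletCount - P.sideDirichlet u v) (P.sideCard u v)
        (1 / 2 * ∏ x, c x .dirichlet) := by
      have := (hasAsymp_edgeCharAt h b .neumann).mul
        (HasAsymp.prod Finset.univ fun x _ => hc x .dirichlet)
      convert this using 1
      · rw [sideDirichlet_eq h, hD]
        simp only [BC.dirichletCount]
        push_cast
        rw [← sub_eq_zero]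
        simp [Finset.sum_neg_distrib]
        ring
      · rw [sideCard_eq h]
    have h2 : ∀ x : {x // P.G.Adj v x ∧ x ≠ u},
        HasAsymp (fun z => P.branchChar .neumann v x.1 x.2.1 z * (P.edgeCharAt z h b .dirichlet *
          ∏ y ∈ Finset.univ.erase x, P.branchChar .dirichlet v y.1 y.2.1 z))
        (1 - b.dirichletCount - P.sideDirichlet u v) (P.sideCard u v)
        (c x .neumann * (1 / 2 * ∏ y ∈ Finset.univ.erase x, c y .dirichlet)) := by
      intro x
      have := (hc x .neumann).mul ((hasAsymp_edgeCharAt h b .dirichlet).mul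
        (HasAsymp.prod (Finset.univ.erase x) fun x _ => hc x .dirichlet))
      convert this using 1
      · rw [sideDirichlet_eq h, hD, ← Finset.add_sum_erase _ _ (Finset.mem_univ x)]
        simp only [BC.dirichletCount]
        push_cast
        rw [← sub_eq_zero]
        simp [Finset.sum_neg_distrib]
        ring
      · rw [sideCard_eq h, ← Finset.add_sum_erase _ _ (Finset.mem_univ x)]
        ring
    have h3 := h1.add (HasAsymp.sum Finset.univ fun x _ => h2 x)
    rw [← e] at h3
    refine ⟨_, ?_, h3⟩
    refine add_pos_of_pos_of_nonneg ?_ (Finset.sum_nonneg fun x _ => ?_)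
    · exact mul_pos (by norm_num) (Finset.prod_pos fun x _ => hc0 x _)
    · exact mul_nonneg (hc0 x _).le (mul_nonneg (by norm_num)
        (Finset.prod_nonneg fun y _ => (hc0 y _).le))

theorem differentiable_branchChar : ∀ u v (h : P.G.Adj u v), ∀ b : BC,
    Differentiable ℂ fun z => P.branchChar b u v h z := by
  classical
  refine P.branch_induction fun u v h ih b => ?_
  by_cases hv : P.IsBoundary v
  · have e : (fun z => P.branchChar b u v h z) = fun z => P.edgeCharAt z h b (P.bc v) := by
      funext z
      rw [branchChar, if_pos hv]
    rw [e]
    exact differentiable_edgeCharAt h b _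
  · have e : (fun z => P.branchChar b u v h z) = fun z => P.edgeCharAt z h b .neumann *
        ∏ x : {x // P.G.Adj v x ∧ x ≠ u}, P.branchChar .dirichlet v x.1 x.2.1 z +
      ∑ x : {x // P.G.Adj v x ∧ x ≠ u}, P.branchChar .neumann v x.1 x.2.1 z *
        (P.edgeCharAt z h b .dirichlet *
          ∏ y ∈ Finset.univ.erase x, P.branchChar .dirichlet v y.1 y.2.1 z) := by
      funext z
      rw [branchChar, if_neg hv]
    rw [e]
    refine ((differentiable_edgeCharAt h b _).mul ?_).add ?_
    · exact Differentiable.fun_finsetProd fun x _ => ih x.1 x.2.1 x.2.2 _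
    · refine Differentiable.fun_sum fun x _ => (ih x.1 x.2.1 x.2.2 _).mul
        ((differentiable_edgeCharAt h b _).mul ?_)
      exact Differentiable.fun_finsetProd fun x _ => ih x.1 x.2.1 x.2.2 _

/-- The complex numbers with imaginary part `0`, as a subring. -/
def realSubring : Subring ℂ := Complex.ofRealHom.range

theorem mem_realSubring {z : ℂ} : z ∈ realSubring ↔ z.im = 0 := by
  constructor
  · rintro ⟨x, rfl⟩
    exact Complex.ofReal_im x
  · intro h
    exact ⟨z.re, Complex.ext rfl (by simpa using h.symm)⟩

theorem branchChar_mem_real {z : ℂ} (hz : z.im = 0) : ∀ u v (h : P.G.Adj u v), ∀ b : BC,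
    P.branchChar b u v h z ∈ realSubring := by
  classical
  refine P.branch_induction fun u v h ih b => ?_
  rw [branchChar]
  split_ifs with hv
  · exact mem_realSubring.2 (edgeCharAt_im hz h _ _)
  · refine realSubring.add_mem (realSubring.mul_mem (mem_realSubring.2 (edgeCharAt_im hz h _ _))
      (realSubring.prod_mem fun x _ => ih x.1 x.2.1 x.2.2 _)) (realSubring.sum_mem fun x _ =>
      realSubring.mul_mem (ih x.1 x.2.1 x.2.2 _) (realSubring.mul_mem
      (mem_realSubring.2 (edgeCharAt_im hz h _ _))
      (realSubring.prod_mem fun x _ => ih x.1 x.2.1 x.2.2 _)))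

theorem charPi_im (H : P.G.Subgraph) (w : V) {z : ℂ} (hz : z.im = 0) :
    (P.charPi H w z).im = 0 :=
  mem_realSubring.1 (realSubring.prod_mem fun v _ => branchChar_mem_real hz w v.1 _ _)

theorem charK_im (H : P.G.Subgraph) (w : V) {z : ℂ} (hz : z.im = 0) :
    (P.charK H w z).im = 0 :=
  mem_realSubring.1 (realSubring.sum_mem fun v _ => realSubring.mul_mem
    (branchChar_mem_real hz w v.1 _ _)
    (realSubring.prod_mem fun v _ => branchChar_mem_real hz w v.1 _ _))

theorem differentiable_charPi (H : P.G.Subgraph) (w : V) :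
    Differentiable ℂ (P.charPi H w) :=
  Differentiable.fun_finsetProd fun v _ => differentiable_branchChar w v.1 v.2.adj_sub _

theorem differentiable_charK (H : P.G.Subgraph) (w : V) :
    Differentiable ℂ (P.charK H w) :=
  Differentiable.fun_sum fun v _ => (differentiable_branchChar w v.1 v.2.adj_sub _).mul
    (Differentiable.fun_finsetProd fun v _ => differentiable_branchChar w v.1 v.2.adj_sub _)

open Classical in
theorem hasAsymp_charPi (H : P.G.Subgraph) (w : V) :
    ∃ c : ℝ, 0 < c ∧ HasAsymp (P.charPi H w)
      (-((∑ v : {v // H.Adj w v}, P.sideDirichlet w v.1 : ℕ) : ℤ))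
      (∑ v : {v // H.Adj w v}, P.sideCard w v.1) c := by
  choose c hc0 hc using fun v : {v // H.Adj w v} => hasAsymp_branchChar w v.1 v.2.adj_sub .dirichlet
  refine ⟨∏ v, c v, Finset.prod_pos fun v _ => hc0 v, ?_⟩
  have := HasAsymp.prod Finset.univ fun v _ => hc v
  change HasAsymp (fun z => ∏ v : {v // H.Adj w v}, P.branchChar .dirichlet w v.1 _ z) _ _ _
  convert this using 1
  rw [Nat.cast_sum, ← Finset.sum_neg_distrib]
  simp [BC.dirichletCount]

open Classical in
theorem hasAsymp_charK (H : P.G.Subgraph) (w : V) (hne : ∃ v, H.Adj w v) :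
    ∃ c : ℝ, 0 < c ∧ HasAsymp (P.charK H w)
      (1 - ((∑ v : {v // H.Adj w v}, P.sideDirichlet w v.1 : ℕ) : ℤ))
      (∑ v : {v // H.Adj w v}, P.sideCard w v.1) c := by
  choose c hc0 hc using fun v : {v // H.Adj w v} => hasAsymp_branchChar w v.1 v.2.adj_sub
  obtain ⟨v₀, hv₀⟩ := hne
  have h2 : ∀ v : {v // H.Adj w v},
      HasAsymp (fun z => P.branchChar .neumann w v.1 v.2.adj_sub z *
        ∏ u ∈ Finset.univ.erase v, P.branchChar .dirichlet w u.1 u.2.adj_sub z)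
      (1 - ((∑ v : {v // H.Adj w v}, P.sideDirichlet w v.1 : ℕ) : ℤ))
      (∑ v : {v // H.Adj w v}, P.sideCard w v.1)
      (c v .neumann * ∏ u ∈ Finset.univ.erase v, c u .dirichlet) := by
    intro v
    have := (hc v .neumann).mul (HasAsymp.prod (Finset.univ.erase v) fun x _ => hc x .dirichlet)
    convert this using 1
    · rw [← Finset.add_sum_erase _ _ (Finset.mem_univ v)]
      simp only [BC.dirichletCount]
      push_cast
      rw [← sub_eq_zero]
      simp [Finset.sum_neg_distrib]
    · rw [← Finset.add_sum_erase _ _ (Finset.mem_univ v)]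
  refine ⟨_, ?_, HasAsymp.sum Finset.univ fun v _ => h2 v⟩
  refine Finset.sum_pos (fun v _ => mul_pos (hc0 v _) (Finset.prod_pos fun u _ => hc0 u _))
    ⟨⟨v₀, hv₀⟩, Finset.mem_univ _⟩

end Problem

end QTree
end

open MeasureTheory Set Filter Topology

noncomputable section

namespace QTree

namespace Problem

variable {V : Type*} [Fintype V] {P : Problem V}

/-! ### Division of the tree into two parts -/

theorem IsDivision.symm {K H : P.G.Subgraph} {w : V} (h : P.IsDivision K H w) :
    P.IsDivision H K w :=
  ⟨h.connected_unknown, h.connected_known, h.edges_unknown, h.edges_known,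
    by rw [sup_comm]; exact h.sup_eq_top, by rw [inter_comm]; exact h.inter_eq⟩

theorem IsDivision.mem_verts {K H : P.G.Subgraph} {w : V} (h : P.IsDivision K H w) :
    w ∈ H.verts :=
  (h.inter_eq.symm ▸ mem_singleton w : w ∈ K.verts ∩ H.verts).2

/-- A path from `w` to `x` inside `H` is the unique path of the tree, and its first step is the
neighbour of `w` closer to `x`, that is `v`. -/
theorem adj_of_mem_verts {H : P.G.Subgraph} (hH : H.Connected) {w v x : V} (hw : w ∈ H.verts)
    (hx : x ∈ H.verts) (hv : P.G.Adj w v) (hxv : x ∈ P.side w v) : H.Adj w v := by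
  obtain ⟨p, hp⟩ := (hH.coe.preconnected ⟨w, hw⟩ ⟨x, hx⟩).exists_isPath
  have hp' : (p.map H.hom).IsPath := hp.map Subtype.val_injective
  have hlen : (p.map H.hom).length = P.G.dist w x := by
    obtain ⟨q, hq⟩ := P.isTree.connected.exists_walk_length_eq_dist w x
    rw [← hq]
    congr 1
    exact (P.isTree.existsUnique_path w x).unique hp'
      (SimpleGraph.Walk.isPath_of_length_eq_dist q hq)
  cases p with
  | nil => exact absurd hxv notMem_side_self
  | @cons _ y _ hadj q =>
    have h1 : P.G.dist x y.1 < P.G.dist x w := by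
      have := SimpleGraph.dist_le (q.map H.hom)
      rw [SimpleGraph.Walk.map_cons, SimpleGraph.Walk.length_cons] at hlen
      have e : P.G.dist x y.1 = P.G.dist (H.hom y) x := SimpleGraph.dist_comm
      rw [e, SimpleGraph.dist_comm (u := x)]
      change P.G.dist (H.hom y) x ≤ _ at this
      omega
    have hadj' : H.Adj w y.1 := hadj
    rwa [eq_of_dist_lt hv.symm hadj'.adj_sub.symm (mem_side.1 hxv) h1]

/-- Each side of `w` lies wholly in one part: otherwise `v` would belong to both parts, whose only
common vertex is `w`. -/
theorem IsDivision.mem_verts_iff {K H : P.G.Subgraph} {w : V} (h : P.IsDivision K H w) {v x : V}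
    (hv : P.G.Adj w v) (hxv : x ∈ P.side w v) : x ∈ H.verts ↔ H.Adj w v := by
  refine ⟨fun hx => adj_of_mem_verts h.connected_unknown h.mem_verts hx hv hxv, fun hH => ?_⟩
  by_contra hx
  have hK : x ∈ K.verts := by
    have : x ∈ (K ⊔ H).verts := h.sup_eq_top ▸ mem_univ x
    exact this.resolve_right hx
  have hv' : v ∈ K.verts ∩ H.verts :=
    ⟨(adj_of_mem_verts h.connected_known h.symm.mem_verts hK hv hxv).snd_mem, hH.snd_mem⟩
  rw [h.inter_eq] at hv'
  exact hv.ne hv'.symm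

theorem IsDivision.exists_adj {K H : P.G.Subgraph} {w : V} (h : P.IsDivision K H w) :
    ∃ v, H.Adj w v := by
  obtain ⟨e, he⟩ := h.edges_unknown
  obtain ⟨x, hx, hne⟩ : ∃ x ∈ H.verts, x ≠ w := by
    induction e with
    | _ a b =>
      have hab : H.Adj a b := he
      by_cases ha : a = w
      · exact ⟨b, hab.snd_mem, fun hb => hab.ne (ha.trans hb.symm)⟩
      · exact ⟨a, hab.fst_mem, ha⟩
  obtain ⟨v, hv, hxv⟩ := exists_mem_side hne
  exact ⟨v, (h.mem_verts_iff hv hxv).1 hx⟩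

theorem IsDivision.not_adj {K H : P.G.Subgraph} {w v : V} (h : P.IsDivision K H w)
    (hK : K.Adj w v) : ¬ H.Adj w v := by
  intro hH
  have hv' : v ∈ K.verts ∩ H.verts := ⟨hK.snd_mem, hH.snd_mem⟩
  rw [h.inter_eq] at hv'
  exact hK.ne hv'.symm

theorem IsDivision.adj_iff {K H : P.G.Subgraph} {w v : V} (h : P.IsDivision K H w) :
    P.G.Adj w v ↔ K.Adj w v ∨ H.Adj w v := by
  rw [← SimpleGraph.Subgraph.sup_adj, h.sup_eq_top, SimpleGraph.Subgraph.top_adj]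

theorem IsDivision.not_isBoundary {K H : P.G.Subgraph} {w : V} (h : P.IsDivision K H w) :
    ¬ P.IsBoundary w := by
  intro hw
  obtain ⟨a, ha⟩ := Set.ncard_eq_one.1 hw
  obtain ⟨v, hv⟩ := h.exists_adj
  obtain ⟨u, hu⟩ := h.symm.exists_adj
  have h1 : v ∈ P.G.neighborSet w := hv.adj_sub
  have h2 : u ∈ P.G.neighborSet w := hu.adj_sub
  rw [ha, mem_singleton_iff] at h1 h2
  subst h1 h2
  exact h.not_adj hu hv

open Classical in
theorem IsDivision.sum_verts {M : Type*} [AddCommMonoid M] (f : V → M) {K H : P.G.Subgraph}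
    {w : V} (h : P.IsDivision K H w) :
    ∑ x ∈ H.verts.toFinset, f x = f w + ∑ v : {v // H.Adj w v}, ∑ x ∈ P.side w v.1, f x := by
  have hs : H.verts.toFinset = insert w (Finset.univ.biUnion
      fun v : {v // H.Adj w v} => P.side w v.1) := by
    ext x
    simp only [mem_toFinset, Finset.mem_insert, Finset.mem_biUnion, Finset.mem_univ, true_and,
      Subtype.exists]
    constructor
    · intro hx
      by_cases hxw : x = w
      · exact Or.inl hxw
      obtain ⟨v, hv, hxv⟩ := exists_mem_side hxw
      exact Or.inr ⟨v, (h.mem_verts_iff hv hxv).1 hx, hxv⟩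
    · rintro (rfl | ⟨v, hv, hxv⟩)
      · exact h.mem_verts
      · exact (h.mem_verts_iff hv.adj_sub hxv).2 hv
  rw [hs, Finset.sum_insert (by simp [notMem_side_self]), Finset.sum_biUnion]
  intro x _ y _ hxy
  refine Finset.disjoint_left.2 fun a hx hy => hxy (Subtype.ext ?_)
  exact eq_of_mem_side x.2.adj_sub y.2.adj_sub hx hy

-- The vertex `w` has neighbours in both parts, so it is not a boundary vertex and contributes
-- nothing; this gives the power of `μ` in the asymptotics.
open Classical in
theorem IsDivision.numDirichlet_eq {K H : P.G.Subgraph} {w : V} (h : P.IsDivision K H w) :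
    P.numDirichlet H = ∑ v : {v // H.Adj w v}, P.sideDirichlet w v.1 := by
  have h0 : P.dirichletIndicator w = 0 := by simp [dirichletIndicator, h.not_isBoundary]
  have h1 := h.sum_verts P.dirichletIndicator
  rw [h0, zero_add] at h1
  rw [show (∑ v : {v // H.Adj w v}, P.sideDirichlet w v.1) = _ from h1.symm]
  unfold dirichletIndicator numDirichlet
  rw [← Finset.sum_filter, Finset.sum_const, smul_eq_mul, mul_one,
    Set.ncard_eq_toFinset_card']
  congr 1
  ext x
  simp only [Finset.mem_filter, mem_toFinset, mem_ofPred_eq]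

-- A subtree has one vertex more than edges, and that extra vertex is `w`.
open Classical in
theorem IsDivision.ncard_edgeSet_eq {K H : P.G.Subgraph} {w : V} (h : P.IsDivision K H w) :
    H.edgeSet.ncard = ∑ v : {v // H.Adj w v}, P.sideCard w v.1 := by
  have hT : H.coe.IsTree := ⟨h.connected_unknown.coe, P.isTree.isAcyclic.subgraph H⟩
  have h1 := (SimpleGraph.isTree_iff_connected_and_card.1 hT).2
  have h2 : H.edgeSet.ncard = Nat.card H.coe.edgeSet := by
    rw [← SimpleGraph.Subgraph.image_coe_edgeSet_coe,
      Set.ncard_image_of_injective _ (Sym2.map.injective Subtype.val_injective)]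
    rfl
  have h3 := h.sum_verts fun _ => 1
  rw [Finset.sum_const, smul_eq_mul, mul_one, Set.toFinset_card, ← Nat.card_eq_fintype_card] at h3
  have h4 : ∀ v, ∑ x ∈ P.side w v, 1 = P.sideCard w v := fun v => by
    rw [Finset.sum_const, smul_eq_mul, mul_one]; rfl
  simp only [h4] at h3
  omega

/-! ### The relation between the characteristic functions at an eigenvalue -/

theorem ends_cases {u v : V} (h : P.G.Adj u v) :
    (P.src ⟨s(u, v), h⟩ = u ∧ v ≠ P.src ⟨s(u, v), h⟩) ∨
      (P.src ⟨s(u, v), h⟩ = v ∧ u ≠ P.src ⟨s(u, v), h⟩) := by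
  have he := P.ends ⟨s(u, v), h⟩
  have hne := h.ne
  rcases Sym2.eq_iff.1 he with ⟨h1, _⟩ | ⟨_, h2⟩
  · exact Or.inl ⟨h1.symm, by rw [← h1]; exact hne.symm⟩
  · exact Or.inr ⟨h2.symm, by rw [← h2]; exact hne⟩

theorem valueAt_derivAt_transfer {z : ℂ} {Y : P.G.edgeSet → ℝ → ℂ × ℂ} {u v : V}
    (h : P.G.Adj u v) (hY : IsSolution (P.σ ⟨s(u, v), h⟩) z (Y ⟨s(u, v), h⟩)) :
    P.valueAt Y ⟨s(u, v), h⟩ v =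
        P.valueAt Y ⟨s(u, v), h⟩ u * P.edgeCharAt z h .neumann .dirichlet -
          P.derivAt Y ⟨s(u, v), h⟩ u * P.edgeCharAt z h .dirichlet .dirichlet ∧
      P.derivAt Y ⟨s(u, v), h⟩ v =
        P.valueAt Y ⟨s(u, v), h⟩ u * P.edgeCharAt z h .neumann .neumann -
          P.derivAt Y ⟨s(u, v), h⟩ u * P.edgeCharAt z h .dirichlet .neumann := by
  have hσ := P.memLp ⟨s(u, v), h⟩
  have hπ := hY.eq_solC_solS hσ (x := Real.pi) ⟨Real.pi_pos.le, le_rfl⟩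
  have hW := wronskian_eq_one hσ z
  have hne := h.ne
  rcases ends_cases h with ⟨h1, h2⟩ | ⟨h1, h2⟩
  · simp only [valueAt, derivAt, edgeCharAt, h1, hne.symm, if_true, if_false, edgeChar, hπ]
    constructor <;> ring
  -- Here `u` is the end `x = π`, so the transfer runs against the parametrization and the matrix
  -- from `0` to `π` must be inverted; its determinant is the Wronskian.
  · simp only [valueAt, derivAt, edgeCharAt, h1, hne, hne.symm, if_true, if_false, edgeChar, hπ]
    constructor
    · linear_combination (-(Y ⟨s(u, v), h⟩ 0).1) * hW
    · linear_combination ((Y ⟨s(u, v), h⟩ 0).2) * hW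

theorem eqOn_zero_of_valueAt_derivAt {z : ℂ} {Y : P.G.edgeSet → ℝ → ℂ × ℂ} {u v : V}
    (h : P.G.Adj u v) (hY : IsSolution (P.σ ⟨s(u, v), h⟩) z (Y ⟨s(u, v), h⟩))
    (h0 : P.valueAt Y ⟨s(u, v), h⟩ u = 0) (h1 : P.derivAt Y ⟨s(u, v), h⟩ u = 0) :
    P.valueAt Y ⟨s(u, v), h⟩ v = 0 ∧ P.derivAt Y ⟨s(u, v), h⟩ v = 0 ∧
      ∀ x ∈ Icc 0 Real.pi, (Y ⟨s(u, v), h⟩ x).1 = 0 := by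
  obtain ⟨h2, h3⟩ := valueAt_derivAt_transfer h hY
  rw [h0, h1] at h2 h3
  simp only [zero_mul, sub_zero] at h2 h3
  refine ⟨h2, h3, fun x hx => ?_⟩
  have hx := hY.eq_solC_solS (P.memLp ⟨s(u, v), h⟩) hx
  -- Both ends have zero Cauchy data, so the end `x = 0` does, whichever of `u` and `v` it is.
  have h00 : (Y ⟨s(u, v), h⟩ 0).1 = 0 ∧ (Y ⟨s(u, v), h⟩ 0).2 = 0 := by
    rcases ends_cases h with ⟨h4, -⟩ | ⟨h4, -⟩
    · simp only [valueAt, derivAt, h4, if_true, neg_eq_zero] at h0 h1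
      exact ⟨h0, h1⟩
    · simp only [valueAt, derivAt, h4, if_true, neg_eq_zero] at h2 h3
      exact ⟨h2, h3⟩
  rw [hx, h00.1, h00.2]
  simp

open Classical in
variable (P) in
/-- `y_e^{[1]}(v)` for the edge `e = {v, x}`, and `0` if there is no such edge. -/
def outDeriv (Y : P.G.edgeSet → ℝ → ℂ × ℂ) (v x : V) : ℂ :=
  if h : P.G.Adj v x then P.derivAt Y ⟨s(v, x), h⟩ v else 0

theorem outDeriv_of_adj (Y : P.G.edgeSet → ℝ → ℂ × ℂ) {v x : V} (h : P.G.Adj v x) :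
    P.outDeriv Y v x = P.derivAt Y ⟨s(v, x), h⟩ v := dif_pos h

theorem Solves.sum_outDeriv {z : ℂ} {Y : P.G.edgeSet → ℝ → ℂ × ℂ} (hY : P.Solves z Y) {v : V}
    (hv : ¬ P.IsBoundary v) : ∑ x, P.outDeriv Y v x = 0 := by
  classical
  rw [← hY.kirchhoff v hv]
  have h1 : ∑ x, P.outDeriv Y v x = ∑ x : {x // P.G.Adj v x}, P.derivAt Y ⟨s(v, x.1), x.2⟩ v := by
    rw [← Finset.sum_filter_of_ne (p := fun x => P.G.Adj v x),
      Finset.sum_subtype (p := fun x => P.G.Adj v x) _ (by simp)]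
    · exact Finset.sum_congr rfl fun x _ => outDeriv_of_adj Y x.2
    · intro x _ hx
      by_contra hcon
      exact hx (dif_neg hcon)
  rw [h1]
  let F : {x // P.G.Adj v x} → {e : P.G.edgeSet // v ∈ (e : Sym2 V)} :=
    fun x => ⟨⟨s(v, x.1), x.2⟩, Sym2.mem_mk_left _ _⟩
  have hF : Function.Bijective F := by
    constructor
    · intro x y hxy
      have : s(v, x.1) = s(v, y.1) := congrArg (fun e => (e.1 : Sym2 V)) hxy
      exact Subtype.ext (Sym2.congr_right.1 this)
    · rintro ⟨⟨e, he⟩, hve⟩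
      obtain ⟨y, hy⟩ := hve
      change e = s(v, y) at hy
      subst hy
      exact ⟨⟨y, he⟩, rfl⟩
  exact Fintype.sum_bijective F hF _ _ fun x => rfl

theorem Solves.add_sum_outDeriv {z : ℂ} {Y : P.G.edgeSet → ℝ → ℂ × ℂ} (hY : P.Solves z Y)
    {u v : V} (h : P.G.Adj u v) (hv : ¬ P.IsBoundary v) [Fintype {x // P.G.Adj v x ∧ x ≠ u}] :
    P.derivAt Y ⟨s(u, v), h⟩ v + ∑ x : {x // P.G.Adj v x ∧ x ≠ u}, P.outDeriv Y v x.1 = 0 := by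
  classical
  have e : P.derivAt Y ⟨s(u, v), h⟩ v = P.outDeriv Y v u := by
    rw [outDeriv_of_adj Y h.symm]
    congr 2
    exact Sym2.eq_swap
  have h0 := hY.sum_outDeriv hv
  rw [← Finset.add_sum_erase _ _ (Finset.mem_univ u)] at h0
  rw [e, ← h0]
  congr 1
  rw [← Finset.sum_filter_of_ne (p := fun x => P.G.Adj v x),
    Finset.sum_subtype (p := fun x => P.G.Adj v x ∧ x ≠ u) _ (by simp [and_comm])]
  intro x _ hx
  by_contra hcon
  exact hx (dif_neg hcon)

/-- Kirchhoff's condition with the derivatives eliminated. Multiplying by all the `D i` avoids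
division, so no `D i` need be nonzero. -/
theorem mul_prod_add_sum_eq_zero {ι : Type*} [Fintype ι] [DecidableEq ι] {D N d : ι → ℂ}
    {p q : ℂ} (hrel : ∀ i, D i * d i = N i * p) (hsum : q + ∑ i, d i = 0) :
    (∏ i, D i) * q + (∑ i, N i * ∏ j ∈ Finset.univ.erase i, D j) * p = 0 := by
  have h1 : (∑ i, N i * ∏ j ∈ Finset.univ.erase i, D j) * p = (∏ i, D i) * ∑ i, d i := by
    rw [Finset.sum_mul, Finset.mul_sum]
    refine Finset.sum_congr rfl fun i hi => ?_
    rw [← Finset.mul_prod_erase _ _ hi]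
    linear_combination (-∏ j ∈ Finset.univ.erase i, D j) * hrel i
  rw [h1, ← mul_add, hsum, mul_zero]

/-- The ratio `N / D` plays the role of the Weyl function of the branch. At a boundary vertex the
relation is the boundary condition written through the transfer matrix; at an internal vertex
`mul_prod_add_sum_eq_zero` combines the branches beyond it. -/
theorem Solves.branchChar_mul_derivAt {z : ℂ} {Y : P.G.edgeSet → ℝ → ℂ × ℂ}
    (hY : P.Solves z Y) : ∀ u v (h : P.G.Adj u v),
    P.branchChar .dirichlet u v h z * P.derivAt Y ⟨s(u, v), h⟩ u =
      P.branchChar .neumann u v h z * P.valueAt Y ⟨s(u, v), h⟩ u := by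
  classical
  refine P.branch_induction fun u v h ih => ?_
  obtain ⟨h1, h2⟩ := valueAt_derivAt_transfer h (hY.equation ⟨s(u, v), h⟩)
  have hmem : v ∈ s(u, v) := Sym2.mem_mk_right _ _
  rw [branchChar, branchChar]
  split_ifs with hv
  · cases hb : P.bc v
    · linear_combination h1 - hY.dirichlet v hv hb ⟨s(u, v), h⟩ hmem
    · linear_combination h2 - hY.neumann v hv hb ⟨s(u, v), h⟩ hmem
  · have h3 := mul_prod_add_sum_eq_zero
      (D := fun x : {x // P.G.Adj v x ∧ x ≠ u} => P.branchChar .dirichlet v x.1 x.2.1 z)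
      (N := fun x : {x // P.G.Adj v x ∧ x ≠ u} => P.branchChar .neumann v x.1 x.2.1 z)
      (d := fun x => P.outDeriv Y v x.1) (p := P.valueAt Y ⟨s(u, v), h⟩ v)
      (fun x => by
        rw [outDeriv_of_adj Y x.2.1, ih x.1 x.2.1 x.2.2,
          hY.continuity v hv ⟨s(v, x.1), x.2.1⟩ ⟨s(u, v), h⟩ (Sym2.mem_mk_left _ _) hmem])
      (hY.add_sum_outDeriv h hv)
    have e : ∀ b : BC, ∑ x : {x // P.G.Adj v x ∧ x ≠ u}, P.branchChar .neumann v x.1 x.2.1 z *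
        (P.edgeCharAt z h b .dirichlet *
          ∏ y ∈ Finset.univ.erase x, P.branchChar .dirichlet v y.1 y.2.1 z) =
        P.edgeCharAt z h b .dirichlet * ∑ x : {x // P.G.Adj v x ∧ x ≠ u},
          P.branchChar .neumann v x.1 x.2.1 z *
          ∏ y ∈ Finset.univ.erase x, P.branchChar .dirichlet v y.1 y.2.1 z := by
      intro b
      rw [Finset.mul_sum]
      exact Finset.sum_congr rfl fun x _ => by ring
    rw [e, e]
    rw [h1, h2] at h3
    linear_combination -h3

/-- On a tree zero Cauchy data need not propagate: an eigenfunction may live on two branches beyond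
`v` and vanish at `v`. This requires two Dirichlet functions to vanish simultaneously, which forces
both characteristic functions of the branch to vanish; the hypothesis excludes it and is inherited
by the branches beyond. -/
theorem Solves.eq_zero_on_branch {z : ℂ} {Y : P.G.edgeSet → ℝ → ℂ × ℂ}
    (hY : P.Solves z Y) : ∀ u v (h : P.G.Adj u v),
    P.branchChar .dirichlet u v h z ≠ 0 ∨ P.branchChar .neumann u v h z ≠ 0 →
    P.valueAt Y ⟨s(u, v), h⟩ u = 0 → P.derivAt Y ⟨s(u, v), h⟩ u = 0 →
    ∀ e : P.G.edgeSet, (∃ y ∈ (e : Sym2 V), y ∈ P.side u v) →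
      ∀ x ∈ Icc 0 Real.pi, (Y e x).1 = 0 := by
  classical
  refine P.branch_induction fun u v h ih hne hval hder => ?_
  obtain ⟨hq, hq', hzero⟩ := eqOn_zero_of_valueAt_derivAt h (hY.equation ⟨s(u, v), h⟩) hval hder
  have hmem : v ∈ s(u, v) := Sym2.mem_mk_right _ _
  have hsuff : (∀ x (hx : P.G.Adj v x), x ≠ u → ∀ e : P.G.edgeSet,
      (∃ y ∈ (e : Sym2 V), y ∈ P.side v x) → ∀ t ∈ Icc 0 Real.pi, (Y e t).1 = 0) →
      ∀ e : P.G.edgeSet, (∃ y ∈ (e : Sym2 V), y ∈ P.side u v) →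
      ∀ x ∈ Icc 0 Real.pi, (Y e x).1 = 0 := by
    rintro hb ⟨e, he⟩ ⟨y, hye, hy⟩
    rcases (mem_side_iff h).1 hy with rfl | ⟨x, hx, hxu, hyx⟩
    · obtain ⟨x, rfl⟩ := hye
      by_cases hxu : x = u
      · subst hxu
        have e' : (⟨s(y, x), he⟩ : P.G.edgeSet) = ⟨s(x, y), h⟩ := Subtype.ext Sym2.eq_swap
        rw [e']
        exact hzero
      · exact hb x he hxu _ ⟨x, Sym2.mem_mk_right _ _, self_mem_side he⟩
    · exact hb x hx hxu _ ⟨y, hye, hyx⟩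
  refine hsuff ?_
  by_cases hv : P.IsBoundary v
  · intro x hx hxu
    exact ((isEmpty_of_isBoundary h hv).false ⟨x, hx, hxu⟩).elim
  have hcont : ∀ x (hx : P.G.Adj v x), P.valueAt Y ⟨s(v, x), hx⟩ v = 0 := fun x hx => by
    rw [hY.continuity v hv ⟨s(v, x), hx⟩ ⟨s(u, v), h⟩ (Sym2.mem_mk_left _ _) hmem, hq]
  have hrel : ∀ x : {x // P.G.Adj v x ∧ x ≠ u},
      P.branchChar .dirichlet v x.1 x.2.1 z * P.outDeriv Y v x.1 = 0 := fun x => by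
    rw [outDeriv_of_adj Y x.2.1, hY.branchChar_mul_derivAt, hcont, mul_zero]
  have hkir := hY.add_sum_outDeriv h hv
  rw [hq', zero_add] at hkir
  rw [branchChar, branchChar, if_neg hv, if_neg hv] at hne
  -- two vanishing factors at different branches would make both functions vanish
  have hvan : ∀ x : {x // P.G.Adj v x ∧ x ≠ u},
      P.branchChar .dirichlet v x.1 x.2.1 z = 0 →
      P.branchChar .neumann v x.1 x.2.1 z ≠ 0 ∧ ∀ y, y ≠ x →
        P.branchChar .dirichlet v y.1 y.2.1 z ≠ 0 := by
    intro x hx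
    have hprod : ∏ y : {x // P.G.Adj v x ∧ x ≠ u}, P.branchChar .dirichlet v y.1 y.2.1 z = 0 :=
      Finset.prod_eq_zero (Finset.mem_univ x) hx
    have hterm : ∀ y, y ≠ x → ∏ y' ∈ Finset.univ.erase y,
        P.branchChar .dirichlet v y'.1 y'.2.1 z = 0 := fun y hy =>
      Finset.prod_eq_zero (Finset.mem_erase.2 ⟨hy.symm, Finset.mem_univ x⟩) hx
    have hsum : ∀ b, ∑ y : {x // P.G.Adj v x ∧ x ≠ u}, P.branchChar .neumann v y.1 y.2.1 z *
        (P.edgeCharAt z h b .dirichlet *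
          ∏ y' ∈ Finset.univ.erase y, P.branchChar .dirichlet v y'.1 y'.2.1 z) =
        P.branchChar .neumann v x.1 x.2.1 z * (P.edgeCharAt z h b .dirichlet *
          ∏ y' ∈ Finset.univ.erase x, P.branchChar .dirichlet v y'.1 y'.2.1 z) := fun b => by
      refine Finset.sum_eq_single x (fun y _ hy => ?_) (fun hx => absurd (Finset.mem_univ x) hx)
      rw [hterm y hy, mul_zero, mul_zero]
    rw [hprod, hsum, hsum] at hne
    constructor
    · intro hN
      simp [hN] at hne
    · intro y hy hy0
      have : ∏ y' ∈ Finset.univ.erase x, P.branchChar .dirichlet v y'.1 y'.2.1 z = 0 :=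
        Finset.prod_eq_zero (Finset.mem_erase.2 ⟨hy, Finset.mem_univ y⟩) hy0
      simp [this] at hne
  -- If `D_x ≠ 0` the derivative vanishes by `hrel`. If `D_x = 0`, all other derivatives vanish, and
  -- Kirchhoff's condition removes the remaining one.
  have hd : ∀ x : {x // P.G.Adj v x ∧ x ≠ u}, P.outDeriv Y v x.1 = 0 := by
    intro x
    by_cases hx : P.branchChar .dirichlet v x.1 x.2.1 z = 0
    · rw [Finset.sum_eq_single x (fun y _ hy => ?_) (fun hx => absurd (Finset.mem_univ x) hx)]
        at hkir
      · exact hkir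
      · exact (mul_eq_zero.1 (hrel y)).resolve_left ((hvan x hx).2 y hy)
    · exact (mul_eq_zero.1 (hrel x)).resolve_left hx
  intro x hx hxu
  refine ih x hx hxu ?_ (hcont x hx) ?_
  · by_cases hx0 : P.branchChar .dirichlet v x hx z = 0
    · exact Or.inr (hvan ⟨x, hx, hxu⟩ hx0).1
    · exact Or.inl hx0
  · rw [← outDeriv_of_adj Y hx]
    exact hd ⟨x, hx, hxu⟩

theorem prod_ne_zero_of_charPi {H : P.G.Subgraph} {w : V} {z : ℂ} (h : P.charPi H w z ≠ 0)
    {v : V} (hv : H.Adj w v) : P.branchChar .dirichlet w v hv.adj_sub z ≠ 0 := by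
  classical
  intro h0
  exact h (Finset.prod_eq_zero (Finset.mem_univ ⟨v, hv⟩) h0)

open Classical in
theorem Solves.charK_mul {z : ℂ} {Y : P.G.edgeSet → ℝ → ℂ × ℂ} (hY : P.Solves z Y) {w : V}
    (H : P.G.Subgraph) {p : ℂ}
    (hp : ∀ v (hv : P.G.Adj w v), P.valueAt Y ⟨s(w, v), hv⟩ w = p) :
    P.charK H w z * p = P.charPi H w z * ∑ v : {v // H.Adj w v}, P.outDeriv Y w v.1 := by
  have := mul_prod_add_sum_eq_zero
    (D := fun v : {v // H.Adj w v} => P.branchChar .dirichlet w v.1 v.2.adj_sub z)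
    (N := fun v : {v // H.Adj w v} => P.branchChar .neumann w v.1 v.2.adj_sub z)
    (d := fun v => P.outDeriv Y w v.1) (p := p)
    (q := -∑ v : {v // H.Adj w v}, P.outDeriv Y w v.1)
    (fun v => by rw [outDeriv_of_adj Y v.2.adj_sub, hY.branchChar_mul_derivAt, hp])
    (by ring)
  unfold charK charPi
  linear_combination this

/-- With `p` the value of an eigenfunction at `w`, each part satisfies `Δ^K p = Δ^Π · (sum of its
derivatives at w)`. The two sums cancel by Kirchhoff's condition, and `p` can be divided out once it
is nonzero. -/
theorem IsDivision.charK_charPi_relation {K H : P.G.Subgraph} {w : V} (h : P.IsDivision K H w)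
    {z : ℂ} (hz : z ∈ P.spectrum) (hK : P.charPi K w z ≠ 0) (hH : P.charPi H w z ≠ 0) :
    P.charK K w z * P.charPi H w z + P.charPi K w z * P.charK H w z = 0 := by
  classical
  obtain ⟨Y, hY, e, x, hx, hne⟩ := hz
  obtain ⟨v₀, hv₀⟩ := h.exists_adj
  have hw := h.not_isBoundary
  set p := P.valueAt Y ⟨s(w, v₀), hv₀.adj_sub⟩ w with hpdef
  have hp : ∀ v (hv : P.G.Adj w v), P.valueAt Y ⟨s(w, v), hv⟩ w = p := fun v hv =>
    hY.continuity w hw _ _ (Sym2.mem_mk_left _ _) (Sym2.mem_mk_left _ _)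
  by_cases hp0 : p = 0
  -- If `p = 0`, nonvanishing of both `Δ^Π` makes all derivatives at `w` zero, and the eigenfunction
  -- would vanish on every branch.
  · exfalso
    refine hne ?_
    have hbr : ∀ v (hv : P.G.Adj w v), P.branchChar .dirichlet w v hv z ≠ 0 := fun v hv => by
      rcases h.adj_iff.1 hv with h1 | h1
      · exact prod_ne_zero_of_charPi hK h1
      · exact prod_ne_zero_of_charPi hH h1
    obtain ⟨y, hye, hyw⟩ : ∃ y ∈ (e : Sym2 V), y ≠ w := by
      obtain ⟨e, he⟩ := e
      induction e with
      | _ a b =>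
        have hab : P.G.Adj a b := he
        by_cases ha : a = w
        · exact ⟨b, Sym2.mem_mk_right _ _, fun hb => hab.ne (ha.trans hb.symm)⟩
        · exact ⟨a, Sym2.mem_mk_left _ _, ha⟩
    obtain ⟨v, hv, hyv⟩ := exists_mem_side hyw
    refine hY.eq_zero_on_branch w v hv (Or.inl (hbr v hv)) ((hp v hv).trans hp0) ?_ e
      ⟨y, hye, hyv⟩ x hx
    have := hY.branchChar_mul_derivAt w v hv
    rw [hp v hv, hp0, mul_zero] at this
    exact (mul_eq_zero.1 this).resolve_left (hbr v hv)
  · have h1 := hY.charK_mul K hp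
    have h2 := hY.charK_mul H hp
    have h3 : ∑ v : {v // K.Adj w v}, P.outDeriv Y w v.1 +
        ∑ v : {v // H.Adj w v}, P.outDeriv Y w v.1 = 0 := by
      rw [← hY.sum_outDeriv hw, ← Finset.sum_filter_of_ne (p := fun x => K.Adj w x ∨ H.Adj w x),
        Finset.filter_or, Finset.sum_union,
        Finset.sum_subtype (Finset.univ.filter fun x => K.Adj w x) (p := fun x => K.Adj w x)
          (by simp),
        Finset.sum_subtype (Finset.univ.filter fun x => H.Adj w x) (p := fun x => H.Adj w x)
          (by simp)]
      · refine Finset.disjoint_left.2 fun a ha hb => ?_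
        simp only [Finset.mem_filter, Finset.mem_univ, true_and] at ha hb
        exact h.not_adj ha hb
      · intro x _ hx
        by_contra hcon
        exact hx (dif_neg fun h' => hcon (h.adj_iff.1 h'))
    refine (mul_eq_zero.1 (?_ : p * _ = 0)).resolve_left hp0
    linear_combination P.charPi H w z * h1 + P.charPi K w z * h2 +
      P.charPi K w z * P.charPi H w z * h3

end Problem

end QTree
end

open MeasureTheory Set Filter Topology

noncomputable section

namespace QTree

/-! ### Entire functions -/

section Entire

variable {f g Q : ℂ → ℂ}

theorem frequently_ne_zero (hg : Differentiable ℂ g) {a : ℂ} (ha : g a ≠ 0) (z : ℂ) :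
    ∃ᶠ w in 𝓝[≠] z, g w ≠ 0 := by
  intro h
  have h1 := AnalyticOnNhd.eqOn_zero_of_preconnected_of_frequently_eq_zero (z₀ := z)
    (fun x _ => hg.analyticAt x) isPreconnected_univ (mem_univ z)
    (Eventually.frequently (h.mono fun w hw => not_not.1 hw))
  exact ha (h1 (mem_univ a))

theorem eq_of_mul_eventuallyEq (hg : Differentiable ℂ g) {a : ℂ} (ha : g a ≠ 0) {p q : ℂ → ℂ}
    {z : ℂ} (hp : ContinuousAt p z) (hq : ContinuousAt q z)
    (h : (fun w => g w * p w) =ᶠ[𝓝 z] fun w => g w * q w) : p z = q z := by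
  by_contra hne
  have h1 : ∀ᶠ w in 𝓝 z, p w ≠ q w :=
    (hp.sub hq).eventually_ne (sub_ne_zero.2 hne) |>.mono fun w hw => sub_ne_zero.1 hw
  obtain ⟨w, hw, h2, h3⟩ := ((frequently_ne_zero hg ha z).and_eventually
    ((h1.and h).filter_mono nhdsWithin_le_nhds)).exists
  exact h2 (mul_left_cancel₀ hw h3)

/-- An entire function that is locally divisible by an entire function is divisible by it. -/
theorem exists_entire_quotient (hg : Differentiable ℂ g) {a : ℂ} (ha : g a ≠ 0)
    (h : ∀ z, ∃ q : ℂ → ℂ, AnalyticAt ℂ q z ∧ f =ᶠ[𝓝 z] fun w => g w * q w) :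
    ∃ Q : ℂ → ℂ, Differentiable ℂ Q ∧ ∀ z, f z = g z * Q z := by
  choose q hq hfq using h
  refine ⟨fun z => q z z, fun z => ?_, fun z => (hfq z).self_of_nhds⟩
  -- The local quotients agree on overlaps because `g` does not vanish identically near any point.
  have h1 : (fun w => q w w) =ᶠ[𝓝 z] q z := by
    filter_upwards [(hfq z).eventually_nhds, (hq z).eventually_analyticAt] with w hw hw'
    exact eq_of_mul_eventuallyEq hg ha (hq w).continuousAt hw'.continuousAt
      ((hfq w).symm.trans hw)
  exact ((hq z).congr h1.symm).differentiableAt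

theorem finite_zeros (hg : Differentiable ℂ g) {a : ℂ} (ha : g a ≠ 0) (R : ℝ) :
    {z : ℂ | ‖z‖ < R ∧ g z = 0}.Finite := by
  by_contra hinf
  obtain ⟨z, -, hz⟩ := Set.Infinite.exists_accPt_of_subset_isCompact hinf
    (isCompact_closedBall (0 : ℂ) R) fun z hz => by simpa using hz.1.le
  have h1 := AnalyticOnNhd.eqOn_zero_of_preconnected_of_frequently_eq_zero (z₀ := z)
    (fun x _ => hg.analyticAt x) isPreconnected_univ (mem_univ z)
    ((accPt_iff_frequently_nhdsNE.1 hz).mono fun w hw => hw.2)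
  exact ha (h1 (mem_univ a))

/-! ### Bounds for quotients of entire functions -/

theorem norm_le_of_norm_le_sphere (hg : Differentiable ℂ g) {R M : ℝ}
    (h : ∀ z : ℂ, ‖z‖ = R → ‖g z‖ ≤ M) {z : ℂ} (hz : ‖z‖ ≤ R) : ‖g z‖ ≤ M := by
  rcases eq_or_lt_of_le hz with hz | hz
  · exact h z hz
  have hR : R ≠ 0 := ((norm_nonneg z).trans_lt hz).ne'
  refine Complex.norm_le_of_forall_mem_frontier_norm_le (U := Metric.ball 0 R)
    Metric.isBounded_ball hg.diffContOnCl (fun w hw => h w ?_) (subset_closure (by simpa using hz))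
  rw [frontier_ball _ hR] at hw
  simpa using hw

/-- Where `g` has no zeros, `g = g(0) e^h`. An upper bound for `|g|` bounds `Re h` above,
Borel–Carathéodory bounds `|h|` on the half disc, and this bounds `|g|` from below there. -/
theorem norm_quotient_le_of_ne_zero (hg : Differentiable ℂ g) (hQ : Differentiable ℂ Q) {R M : ℝ}
    (hR : 0 < R) (h0 : ∀ z, ‖z‖ < R → g z ≠ 0) (h1 : ∀ z, ‖z‖ = R → ‖g z‖ ≤ M)
    (h2 : ∀ z, ‖z‖ = R → ‖g z * Q z‖ ≤ M) {z : ℂ} (hz : ‖z‖ ≤ R / 2) :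
    ‖Q z‖ ≤ Real.exp 2 * (M / ‖g 0‖) ^ 3 := by
  have hg0 : 0 < ‖g 0‖ := norm_pos_iff.2 (h0 0 (by simpa using hR))
  have hM : ‖g 0‖ ≤ M := norm_le_of_norm_le_sphere hg h1 (by simpa using hR.le)
  have hM0 : 0 < M := hg0.trans_le hM
  have hzR : ‖z‖ < R := by linarith
  have hd : DifferentiableOn ℂ (fun w => deriv g w / g w) (Metric.ball 0 R) := by
    refine DifferentiableOn.div ?_ hg.differentiableOn fun w hw => h0 w (by simpa using hw)
    exact fun w _ => (hg.analyticAt w).deriv.differentiableAt.differentiableWithinAt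
  obtain ⟨h, hh0, hh⟩ := hd.isExactOn_ball.with_val_at 0 0
  have hconst : ∀ w ∈ Metric.ball (0 : ℂ) R, g w * Complex.exp (-h w) = g 0 := by
    have hder : ∀ w ∈ Metric.ball (0 : ℂ) R,
        HasDerivAt (fun w => g w * Complex.exp (-h w)) 0 w := by
      intro w hw
      have := (hg w).hasDerivAt.mul ((hh w hw).neg.cexp)
      refine this.congr_deriv ?_
      have e := mul_div_cancel₀ (deriv g w) (h0 w (by simpa using hw))
      linear_combination (-Complex.exp (-h w)) * e
    intro w hw
    have := (convex_ball (0 : ℂ) R).is_const_of_fderivWithin_eq_zero (𝕜 := ℂ)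
      (f := fun w => g w * Complex.exp (-h w))
      (fun x hx => (hder x hx).differentiableAt.differentiableWithinAt) (fun x hx => by
        rw [fderivWithin_of_isOpen Metric.isOpen_ball hx]
        ext
        simp [(hder x hx).hasFDerivAt.fderiv]) hw (Metric.mem_ball_self hR)
    rw [this, hh0]
    simp
  have hgexp : ∀ w ∈ Metric.ball (0 : ℂ) R, ‖g w‖ = ‖g 0‖ * Real.exp (h w).re := by
    intro w hw
    rw [← hconst w hw, norm_mul, Complex.norm_exp, mul_assoc, ← Real.exp_add]
    simp
  set L := Real.log (M / ‖g 0‖) with hL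
  have hMg : 0 < M / ‖g 0‖ := div_pos hM0 hg0
  have hL0 : 0 ≤ L := Real.log_nonneg ((one_le_div hg0).2 hM)
  -- The added `1` keeps the bound positive when `M = ‖g 0‖`; it produces the factor `e²`.
  have hre : MapsTo h (Metric.ball 0 R) {z | z.re ≤ L + 1} := by
    intro w hw
    have h3 : ‖g w‖ ≤ M := norm_le_of_norm_le_sphere hg h1 (by simpa using (Metric.mem_ball.1 hw).le)
    rw [hgexp w hw, ← le_div_iff₀' hg0, ← Real.le_log_iff_exp_le hMg] at h3
    change (h w).re ≤ L + 1
    linarith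
  have hdh : DifferentiableOn ℂ h (Metric.ball 0 R) := fun w hw =>
    (hh w hw).differentiableAt.differentiableWithinAt
  have hzb : z ∈ Metric.ball (0 : ℂ) R := by simpa using hzR
  have hbc := Complex.borelCaratheodory_zero (by linarith) hdh hre hR hzb hh0
  have hhz : ‖h z‖ ≤ 2 * (L + 1) := by
    refine hbc.trans ?_
    rw [div_le_iff₀ (by linarith)]
    refine mul_le_mul_of_nonneg_left (by linarith) (by linarith)
  have hgz : ‖g 0‖ * Real.exp (-(2 * (L + 1))) ≤ ‖g z‖ := by
    rw [hgexp z hzb]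
    gcongr
    have := Complex.abs_re_le_norm (h z)
    have := neg_abs_le (h z).re
    linarith
  have hgQ : ‖g z * Q z‖ ≤ M := norm_le_of_norm_le_sphere (hg.mul hQ) h2 hzR.le
  rw [norm_mul] at hgQ
  have h4 : ‖g 0‖ * Real.exp (-(2 * (L + 1))) * ‖Q z‖ ≤ M :=
    (mul_le_mul_of_nonneg_right hgz (norm_nonneg _)).trans hgQ
  have h5 : Real.exp (-(2 * (L + 1))) = (Real.exp 2)⁻¹ * ((M / ‖g 0‖) ^ 2)⁻¹ := by
    rw [← Real.exp_log hMg, ← hL, ← Real.exp_nat_mul, ← Real.exp_neg, ← Real.exp_neg,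
      ← Real.exp_add]
    congr 1
    push_cast
    ring
  have he := Real.exp_pos 2
  rw [h5] at h4
  calc ‖Q z‖ = (‖g 0‖ * ((Real.exp 2)⁻¹ * ((M / ‖g 0‖) ^ 2)⁻¹) * ‖Q z‖) *
        (Real.exp 2 * (M / ‖g 0‖) ^ 2 / ‖g 0‖) := by field_simp
    _ ≤ M * (Real.exp 2 * (M / ‖g 0‖) ^ 2 / ‖g 0‖) := by gcongr
    _ = _ := by field_simp

theorem norm_sq_sub_conj_mul {R : ℝ} {a z : ℂ} (hz : ‖z‖ = R) :
    ‖(R : ℂ) ^ 2 - starRingEnd ℂ a * z‖ = R * ‖z - a‖ := by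
  have h1 : (R : ℂ) ^ 2 = starRingEnd ℂ z * z := by
    rw [← Complex.normSq_eq_conj_mul_self, Complex.normSq_eq_norm_sq, hz]
    push_cast
    rfl
  rw [h1, ← sub_mul, norm_mul, hz, ← map_sub, Complex.norm_conj, mul_comm]

/-- Zeros are removed one at a time by reflection: `(z - a)^k` is replaced by `((R² - āz) / R)^k`,
which has the same modulus on `|z| = R` and no zeros inside. The bounds on the circle persist, and
the value at `0` can only grow in modulus. -/
theorem norm_quotient_le {R M : ℝ} (hR : 0 < R) (hM : 0 ≤ M) : ∀ (n : ℕ) {g Q : ℂ → ℂ},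
    Differentiable ℂ g → Differentiable ℂ Q → g 0 ≠ 0 →
    {z : ℂ | ‖z‖ < R ∧ g z = 0}.ncard = n →
    (∀ z, ‖z‖ = R → ‖g z‖ ≤ M) → (∀ z, ‖z‖ = R → ‖g z * Q z‖ ≤ M) →
    ∀ {z : ℂ}, ‖z‖ ≤ R / 2 → ‖Q z‖ ≤ Real.exp 2 * (M / ‖g 0‖) ^ 3 := by
  intro n
  induction n using Nat.strong_induction_on with
  | _ n ih =>
  intro g Q hg hQ hg0 hn h1 h2 z hz
  have hfin := finite_zeros hg hg0 R
  by_cases hz0 : ∀ z, ‖z‖ < R → g z ≠ 0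
  · exact norm_quotient_le_of_ne_zero hg hQ hR hz0 h1 h2 hz
  push Not at hz0
  obtain ⟨a, haR, hga⟩ := hz0
  have ha0 : a ≠ 0 := fun h => hg0 (h ▸ hga)
  have htop : analyticOrderAt g a ≠ ⊤ := by
    rw [ne_eq, analyticOrderAt_eq_top]
    intro h
    exact (frequently_ne_zero hg hg0 a) ((h.filter_mono nhdsWithin_le_nhds).mono
      fun w hw => not_not.2 hw)
  obtain ⟨q, hq, hqa, hgq⟩ := (hg.analyticAt a).analyticOrderAt_ne_top.1 htop
  set k := analyticOrderNatAt g a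
  obtain ⟨g₁, hg₁, hgg₁⟩ := exists_entire_quotient (f := g) (g := fun z => (z - a) ^ k)
    (by fun_prop) (a := a + 1) (by simp) fun w => by
      by_cases hw : w = a
      · subst hw
        exact ⟨q, hq, by simpa using hgq⟩
      · refine ⟨fun z => g z / (z - a) ^ k, (hg.analyticAt w).div (by fun_prop)
          (pow_ne_zero _ (sub_ne_zero.2 hw)), ?_⟩
        filter_upwards [isOpen_ne.mem_nhds hw] with z hz
        rw [mul_div_cancel₀ _ (pow_ne_zero _ (sub_ne_zero.2 hz))]
  have hg₁a : g₁ a ≠ 0 := by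
    have : g₁ a = q a := eq_of_mul_eventuallyEq (g := fun z => (z - a) ^ k) (by fun_prop)
      (a := a + 1) (by simp) hg₁.continuous.continuousAt hq.continuousAt (by
        filter_upwards [hgq] with w hw
        rw [← hgg₁, hw, smul_eq_mul])
    rwa [this]
  have hRC : (R : ℂ) ≠ 0 := by exact_mod_cast hR.ne'
  set B : ℂ → ℂ := fun z => ((R : ℂ) ^ 2 - starRingEnd ℂ a * z) / R with hB
  have hBd : Differentiable ℂ B := by fun_prop
  have hBn : ∀ z, ‖z‖ = R → ‖B z‖ = ‖z - a‖ := fun z hz => by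
    rw [hB, norm_div, norm_sq_sub_conj_mul hz, Complex.norm_real, Real.norm_of_nonneg hR.le,
      mul_div_cancel_left₀ _ hR.ne']
  have hB0 : ∀ z, ‖z‖ < R → B z ≠ 0 := fun z hz h => by
    rw [hB, div_eq_zero_iff, or_iff_left hRC, sub_eq_zero] at h
    have h3 := congrArg norm h
    rw [norm_pow, norm_mul, Complex.norm_conj, Complex.norm_real, Real.norm_of_nonneg hR.le] at h3
    nlinarith [norm_nonneg a, norm_nonneg z]
  have hnorm : ∀ z, ‖z‖ = R → ‖g₁ z * B z ^ k‖ = ‖g z‖ := fun z hz => by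
    rw [hgg₁ z, norm_mul, norm_mul, norm_pow, norm_pow, hBn z hz, mul_comm]
  have hB00 : B 0 = R := by
    simp only [hB, mul_zero, sub_zero]
    field_simp
  have hval : ‖g 0‖ ≤ ‖g₁ 0 * B 0 ^ k‖ := by
    rw [hgg₁ 0, norm_mul, norm_mul, norm_pow, norm_pow, hB00, zero_sub, norm_neg,
      Complex.norm_real, Real.norm_of_nonneg hR.le, mul_comm]
    gcongr
  have hg0' : 0 < ‖g 0‖ := norm_pos_iff.2 hg0
  have hsub : {z : ℂ | ‖z‖ < R ∧ g₁ z * B z ^ k = 0} ⊂ {z : ℂ | ‖z‖ < R ∧ g z = 0} := by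
    refine (ssubset_iff_of_subset ?_).2 ⟨a, ⟨haR, hga⟩, ?_⟩
    · rintro z ⟨hzR, hz⟩
      have h3 := (mul_eq_zero.1 hz).resolve_right (pow_ne_zero _ (hB0 z hzR))
      exact ⟨hzR, by rw [hgg₁ z, h3, mul_zero]⟩
    · rintro ⟨-, h3⟩
      exact (mul_eq_zero.1 h3).elim hg₁a (pow_ne_zero _ (hB0 a haR))
  have h3 := ih _ (hn ▸ Set.ncard_lt_ncard hsub hfin) (g := fun z => g₁ z * B z ^ k) (Q := Q)
    (hg₁.mul (hBd.pow k)) hQ (norm_pos_iff.1 (hg0'.trans_le hval)) rfl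
    (fun z hz => (hnorm z hz).trans_le (h1 z hz))
    (fun z hz => by
      rw [norm_mul, hnorm z hz, ← norm_mul]
      exact h2 z hz) hz
  refine h3.trans ?_
  gcongr

/-- If `g` and `g Q` are of exponential type and `g 0 ≠ 0`, then `Q` is of exponential type. -/
theorem exponentialType_of_mul (hg : Differentiable ℂ g) (hQ : Differentiable ℂ Q) (hg0 : g 0 ≠ 0)
    {C : ℝ} (h1 : ∀ z, 1 ≤ ‖z‖ → ‖g z‖ ≤ Real.exp (C * (1 + ‖z‖)))
    (h2 : ∀ z, 1 ≤ ‖z‖ → ‖g z * Q z‖ ≤ Real.exp (C * (1 + ‖z‖))) :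
    ∃ A, ∀ z, ‖Q z‖ ≤ A * Real.exp (6 * C * ‖z‖) := by
  refine ⟨Real.exp 2 * Real.exp (9 * C) / ‖g 0‖ ^ 3, fun z => ?_⟩
  -- This radius makes `z` lie in the half disc and the circle lie outside the unit disc.
  have hR : 0 < 2 * ‖z‖ + 2 := by positivity
  have h3 := norm_quotient_le hR (Real.exp_nonneg (C * (1 + (2 * ‖z‖ + 2)))) _ hg hQ hg0 rfl
    (fun w hw => hw ▸ h1 w (by rw [hw]; linarith [norm_nonneg z]))
    (fun w hw => hw ▸ h2 w (by rw [hw]; linarith [norm_nonneg z])) (z := z) (by linarith)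
  refine h3.trans_eq ?_
  rw [div_pow, ← Real.exp_nat_mul]
  have : ((3 : ℕ) : ℝ) * (C * (1 + (2 * ‖z‖ + 2))) = 9 * C + 6 * C * ‖z‖ := by
    push_cast
    ring
  rw [this, Real.exp_add]
  ring

/-- An entire function of exponential type that is bounded on the coordinate axes is constant. -/
theorem eq_of_bounded_on_axes (hf : Differentiable ℂ f) {A B C : ℝ}
    (hexp : ∀ z, ‖f z‖ ≤ A * Real.exp (B * ‖z‖)) (hre : ∀ x : ℝ, ‖f x‖ ≤ C)
    (him : ∀ x : ℝ, ‖f (x * Complex.I)‖ ≤ C) (z w : ℂ) : f z = f w := by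
  have hO : ∀ l : Filter ℂ, f =O[l] fun z => Real.exp (B * ‖z‖ ^ (1 : ℝ)) := fun l =>
    Asymptotics.IsBigO.of_bound A (Eventually.of_forall fun z => by
      rw [Real.rpow_one, Real.norm_of_nonneg (Real.exp_nonneg _)]
      exact hexp z)
  have hb : ∀ z, ‖f z‖ ≤ C := by
    intro z
    -- Exponential type means order `1`, below the critical order `2` of a quadrant.
    rcases le_total 0 z.re with h1 | h1 <;> rcases le_total 0 z.im with h2 | h2
    · exact PhragmenLindelof.quadrant_I hf.diffContOnCl ⟨1, by norm_num, B, hO _⟩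
        (fun x _ => hre x) (fun x _ => him x) h1 h2
    · exact PhragmenLindelof.quadrant_IV hf.diffContOnCl ⟨1, by norm_num, B, hO _⟩
        (fun x _ => hre x) (fun x _ => him x) h1 h2
    · exact PhragmenLindelof.quadrant_II hf.diffContOnCl ⟨1, by norm_num, B, hO _⟩
        (fun x _ => hre x) (fun x _ => him x) h1 h2
    · exact PhragmenLindelof.quadrant_III hf.diffContOnCl ⟨1, by norm_num, B, hO _⟩
        (fun x _ => hre x) (fun x _ => him x) h1 h2
  refine hf.apply_eq_apply_of_bounded ?_ z w
  exact isBounded_iff_forall_norm_le.2 ⟨C, by rintro _ ⟨z, rfl⟩; exact hb z⟩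

/-! ### Jensen's formula -/

theorem integral_abs_sin : ∫ x in (0 : ℝ)..2 * Real.pi, |Real.sin x| = 4 := by
  have h1 : ∀ a b, IntervalIntegrable (fun x => |Real.sin x|) volume a b := fun a b =>
    (Real.continuous_sin.abs).intervalIntegrable a b
  rw [← intervalIntegral.integral_add_adjacent_intervals (h1 0 Real.pi) (h1 _ _)]
  have h2 : ∫ x in (0 : ℝ)..Real.pi, |Real.sin x| = ∫ x in (0 : ℝ)..Real.pi, Real.sin x := by
    refine intervalIntegral.integral_congr fun x hx => ?_
    rw [uIcc_of_le Real.pi_pos.le] at hx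
    exact abs_of_nonneg (Real.sin_nonneg_of_mem_Icc hx)
  have h3 : ∫ x in Real.pi..2 * Real.pi, |Real.sin x| =
      ∫ x in Real.pi..2 * Real.pi, -Real.sin x := by
    refine intervalIntegral.integral_congr fun x hx => ?_
    rw [uIcc_of_le (by linarith [Real.pi_pos])] at hx
    refine abs_of_nonpos ?_
    have := Real.sin_nonneg_of_mem_Icc (x := x - Real.pi) ⟨by linarith [hx.1], by linarith [hx.2]⟩
    rw [Real.sin_sub_pi] at this
    linarith
  rw [h2, h3, intervalIntegral.integral_neg, integral_sin, integral_sin]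
  norm_num

theorem circleAverage_abs_im {R : ℝ} (hR : 0 ≤ R) :
    Real.circleAverage (fun z : ℂ => |z.im|) 0 R = 2 * R / Real.pi := by
  have h1 : ∀ θ : ℝ, |(circleMap 0 R θ).im| = R * |Real.sin θ| := fun θ => by
    rw [circleMap_zero, Complex.im_ofReal_mul, Complex.exp_ofReal_mul_I_im, abs_mul,
      abs_of_nonneg hR]
  simp only [Real.circleAverage, h1, intervalIntegral.integral_const_mul, integral_abs_sin]
  have := Real.pi_pos
  rw [smul_eq_mul]
  field_simp
  ring

/-- The mean of `|Im z|` over the circle is `2R / π`, which bounds the mean of `log ‖f‖`. In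
Jensen's formula all divisor terms are nonnegative, so those outside `Z` may be dropped; the
trailing coefficient at `0` goes into `c`. -/
theorem jensen_inequality (hf : Differentiable ℂ f) {a : ℂ} (ha : f a ≠ 0) {n : ℕ}
    (hn : (n : ℕ∞) ≤ analyticOrderAt f 0) {A C : ℝ} (hA : 0 ≤ A) (hC : 1 ≤ C)
    (hb : ∀ z, 1 ≤ ‖z‖ → ‖f z‖ ≤ C * Real.exp (A * |z.im|)) :
    ∃ c, ∀ R : ℝ, 1 ≤ R → ∀ Z : Finset ℂ, (∀ z ∈ Z, z ≠ 0 ∧ ‖z‖ ≤ R ∧ f z = 0) →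
      n * Real.log R + ∑ z ∈ Z, Real.log (R / ‖z‖) ≤ c + A * (2 * R / Real.pi) := by
  refine ⟨Real.log C - Real.log ‖meromorphicTrailingCoeffAt f 0‖, fun R hR Z hZ => ?_⟩
  have hR0 : 0 < R := by linarith
  have han : AnalyticOnNhd ℂ f (Metric.closedBall 0 |R|) := fun x _ => hf.analyticAt x
  have htop : ∀ z, analyticOrderAt f z ≠ ⊤ := fun z h => by
    rw [analyticOrderAt_eq_top] at h
    exact (frequently_ne_zero hf ha z) ((h.filter_mono nhdsWithin_le_nhds).mono
      fun w hw => not_not.2 hw)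
  have hJ := MeromorphicOn.circleAverage_log_norm hR0.ne' han.meromorphicOn
  have hdiv : ∀ z, ‖z‖ ≤ R →
      MeromorphicOn.divisor f (Metric.closedBall 0 |R|) z = analyticOrderNatAt f z := by
    intro z hz
    rw [MeromorphicOn.AnalyticOnNhd.divisor_apply han (by simpa [abs_of_pos hR0] using hz)]
    rw [← Nat.cast_analyticOrderNatAt (htop z)]
    rfl
  have hle : Real.circleAverage (fun z => Real.log ‖f z‖) 0 R ≤
      Real.log C + A * (2 * R / Real.pi) := by
    have h1 : Real.circleAverage (fun z => Real.log ‖f z‖) 0 R ≤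
        Real.circleAverage (fun z : ℂ => Real.log C + A * |z.im|) 0 R := by
      refine Real.circleAverage_mono ?_ ?_ ?_
      · exact (han.mono Metric.sphere_subset_closedBall).meromorphicOn.circleIntegrable_log_norm
      · refine Continuous.continuousOn (by fun_prop) |>.circleIntegrable hR0.le
      · intro z hz
        have hz : ‖z‖ = R := by simpa [abs_of_pos hR0] using hz
        -- At a zero `log 0 = 0` by convention, still below the bound as `C ≥ 1`.
        rcases eq_or_ne (f z) 0 with h | h
        · rw [h, norm_zero, Real.log_zero]
          have := Real.log_nonneg hC
          positivity
        · have := Real.log_le_log (norm_pos_iff.2 h) (hb z (by rw [hz]; exact hR))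
          rwa [Real.log_mul (by linarith) (Real.exp_pos _).ne', Real.log_exp] at this
    refine h1.trans_eq ?_
    have hi : ∀ c d : ℝ, CircleIntegrable (fun z : ℂ => c + d * |z.im|) 0 R := fun c d =>
      (Continuous.continuousOn (by fun_prop)).circleIntegrable hR0.le
    have h2 := Real.circleAverage_fun_add (hi (Real.log C) 0) (hi 0 A)
    simp only [zero_mul, add_zero, zero_add] at h2
    rw [h2, Real.circleAverage_const, ← circleAverage_abs_im hR0.le]
    congr 1
    exact Real.circleAverage_fun_smul (a := A) (f := fun z : ℂ => |z.im|)
  rw [hJ] at hle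
  rw [hdiv 0 (by simpa using hR0.le)] at hle
  have hn' : (n : ℝ) ≤ (analyticOrderNatAt f 0 : ℝ) := by
    rw [← Nat.cast_analyticOrderNatAt (htop 0)] at hn
    exact_mod_cast hn
  have hlogR := Real.log_nonneg hR
  have hsum : ∑ z ∈ Z, Real.log (R / ‖z‖) ≤ ∑ᶠ u, (MeromorphicOn.divisor f
      (Metric.closedBall 0 |R|) u : ℝ) * Real.log (R * ‖(0 : ℂ) - u‖⁻¹) := by
    classical
    have hfin := (MeromorphicOn.divisor f (Metric.closedBall 0 |R|)).finiteSupport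
      (isCompact_closedBall (0 : ℂ) |R|)
    rw [finsum_eq_sum_of_support_subset (s := hfin.toFinset ∪ Z)]
    · have hterm : ∀ u : ℂ, 0 ≤ (MeromorphicOn.divisor f (Metric.closedBall 0 |R|) u : ℝ) *
          Real.log (R * ‖(0 : ℂ) - u‖⁻¹) := by
        intro u
        by_cases hu : ‖u‖ ≤ R
        · rw [hdiv u hu, zero_sub, norm_neg]
          refine mul_nonneg (by positivity) ?_
          -- The origin contributes `log (R * 0⁻¹) = log 0 = 0`; its order is counted by the
          -- separate `log R` term.
          rcases eq_or_ne u 0 with rfl | hu0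
          · simp
          · refine Real.log_nonneg ?_
            rw [← div_eq_mul_inv, one_le_div (norm_pos_iff.2 hu0)]
            exact hu
        · rw [Function.locallyFinsuppWithin.apply_eq_zero_of_notMem]
          · simp
          · simpa [abs_of_pos hR0] using hu
      refine le_trans (Finset.sum_le_sum fun z hz => ?_)
        (Finset.sum_le_sum_of_subset_of_nonneg Finset.subset_union_right fun u _ _ => hterm u)
      obtain ⟨hz0, hzR, hfz⟩ := hZ z hz
      rw [hdiv z hzR, zero_sub, norm_neg, ← div_eq_mul_inv]
      have h1 : 1 ≤ analyticOrderNatAt f z := by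
        rw [Nat.one_le_iff_ne_zero]
        intro h
        have := Nat.cast_analyticOrderNatAt (htop z)
        rw [h, eq_comm, Nat.cast_zero, AnalyticAt.analyticOrderAt_eq_zero (hf.analyticAt z)] at this
        exact this hfz
      have h2 : 0 ≤ Real.log (R / ‖z‖) :=
        Real.log_nonneg ((one_le_div (norm_pos_iff.2 hz0)).2 hzR)
      have h3 : (1 : ℝ) ≤ ((analyticOrderNatAt f z : ℕ) : ℝ) := by exact_mod_cast h1
      rw [Int.cast_natCast]
      nlinarith
    · intro u hu
      simp only [Finset.coe_union, Finite.coe_toFinset]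
      refine Or.inl fun h => hu ?_
      simp [h]
  rw [Int.cast_natCast] at hle
  have := mul_le_mul_of_nonneg_right hn' hlogR
  linarith

end Entire

end QTree
end

open MeasureTheory Set Filter Topology

noncomputable section

namespace QTree

/-! ### Sums of logarithms -/

/-- The product of the half-integers `i + 1/2` is `(2N)! / (4^N N!)`. -/
theorem sum_log_add_half (N : ℕ) : ∑ i ∈ Finset.range N, Real.log (i + 1 / 2) =
    Real.log ((2 * N).factorial) - N * Real.log 4 - Real.log (N.factorial) := by
  induction N with
  | zero => simp
  | succ N ih =>
    have h1 : ((2 * (N + 1)).factorial : ℝ) = 4 * (N + 1 / 2) * (N + 1) * (2 * N).factorial := by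
      rw [show 2 * (N + 1) = 2 * N + 1 + 1 by ring, Nat.factorial_succ, Nat.factorial_succ]
      push_cast
      ring
    have h2 : ((2 * N).factorial : ℝ) ≠ 0 := by positivity
    have h3 : (N.factorial : ℝ) ≠ 0 := by positivity
    have h4 : (N : ℝ) + 1 ≠ 0 := by positivity
    have h5 : (N : ℝ) + 1 / 2 ≠ 0 := by positivity
    rw [Finset.sum_range_succ, ih, h1, Nat.factorial_succ, Real.log_mul (by positivity) h2,
      Real.log_mul (by positivity) h4, Real.log_mul (by norm_num) h5]
    push_cast
    rw [Real.log_mul h4 h3]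
    ring

/-- Stirling's formula for `(2N)!` and `N!`, in which the terms `(1/2) log N` cancel. An error
`O(1)` is essential: the final contradiction has a margin of one `log N`. -/
theorem sum_log_add_half_le : ∃ C, ∀ N : ℕ, 1 ≤ N →
    ∑ i ∈ Finset.range N, Real.log (i + 1 / 2) ≤ N * Real.log N - N + C := by
  refine ⟨Real.log (Stirling.stirlingSeq 1) + Real.log 2, fun N hN => ?_⟩
  have hN0 : (0 : ℝ) < N := by exact_mod_cast hN
  rw [sum_log_add_half]
  have h1 := Stirling.le_log_factorial_stirling (n := N) (by omega)
  have h2 : Real.log (Stirling.stirlingSeq (2 * N)) ≤ Real.log (Stirling.stirlingSeq 1) := by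
    have := Stirling.stirlingSeq'_antitone (Nat.zero_le (2 * N - 1))
    simp only [Function.comp_apply, Nat.succ_eq_add_one, zero_add] at this
    rw [Nat.sub_add_cancel (by omega)] at this
    refine Real.log_le_log ?_ this
    have := Stirling.stirlingSeq'_pos (2 * N - 1)
    rwa [Nat.sub_add_cancel (by omega)] at this
  rw [Stirling.log_stirlingSeq_formula, Real.log_div (by positivity) (Real.exp_pos _).ne',
    Real.log_exp] at h2
  have e1 : Real.log (2 * ((2 * N : ℕ) : ℝ)) = 2 * Real.log 2 + Real.log N := by
    push_cast
    rw [Real.log_mul (by norm_num) (by positivity), Real.log_mul (by norm_num) hN0.ne']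
    ring
  have e2 : Real.log ((2 * N : ℕ) : ℝ) = Real.log 2 + Real.log N := by
    push_cast
    rw [Real.log_mul (by norm_num) hN0.ne']
  have e3 : Real.log 4 = 2 * Real.log 2 := by
    rw [show (4 : ℝ) = 2 ^ 2 by norm_num, Real.log_pow]
    norm_num
  have e4 : 0 ≤ Real.log (2 * Real.pi) :=
    Real.log_nonneg (by linarith [Real.pi_gt_three])
  rw [e1, e2] at h2
  rw [e3]
  push_cast at h2
  nlinarith

theorem sum_Ico_neg {M : Type*} [AddCommMonoid M] (f : ℤ → M) (N : ℕ) :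
    ∑ n ∈ Finset.Ico (-(N : ℤ)) N, f n = ∑ i ∈ Finset.range N, (f i + f (-i - 1)) := by
  induction N with
  | zero => simp
  | succ N ih =>
    have : Finset.Ico (-((N + 1 : ℕ) : ℤ)) ((N + 1 : ℕ) : ℤ) =
        insert (N : ℤ) (insert (-(N : ℤ) - 1) (Finset.Ico (-(N : ℤ)) N)) := by
      ext x
      simp only [Finset.mem_Ico, Finset.mem_insert]
      omega
    rw [this, Finset.sum_insert, Finset.sum_insert, ih, Finset.sum_range_succ]
    · rw [← add_assoc, add_comm]
    · simp
    · simp only [Finset.mem_insert, Finset.mem_Ico, not_or]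
      omega

theorem int_add_ne_zero {α : ℝ} (hα : α ∈ Ioo (0 : ℝ) 1) (n : ℤ) : (n : ℝ) + α ≠ 0 := by
  intro h
  rcases le_or_gt 0 n with hn | hn
  · have : (0 : ℝ) ≤ n := by exact_mod_cast hn
    linarith [hα.1]
  · have : (n : ℝ) ≤ -1 := by exact_mod_cast (show n ≤ -1 by omega)
    linarith [hα.2]

/-- The indices `i` and `-i - 1` are paired, and `(i + α)(i + 1 - α) ≤ (i + 1/2)²`, so the shift `α`
only helps. -/
theorem sum_log_div_ge {α : ℝ} (hα : α ∈ Ioo (0 : ℝ) 1) : ∃ C, ∀ N : ℕ, 1 ≤ N →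
    2 * N - C ≤ ∑ n ∈ Finset.Ico (-(N : ℤ)) N, Real.log (N / |n + α|) := by
  obtain ⟨C, hC⟩ := sum_log_add_half_le
  refine ⟨2 * C, fun N hN => ?_⟩
  have hN0 : (0 : ℝ) < N := by exact_mod_cast hN
  rw [sum_Ico_neg]
  have h1 : ∀ i ∈ Finset.range N, 2 * Real.log N - 2 * Real.log (i + 1 / 2) ≤
      Real.log (N / |((i : ℤ) : ℝ) + α|) + Real.log (N / |((-i - 1 : ℤ) : ℝ) + α|) := by
    intro i _
    have hi : (0 : ℝ) ≤ i := by positivity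
    push_cast
    have ha : |(i : ℝ) + α| = i + α := abs_of_pos (by linarith [hα.1])
    have hb : |-(i : ℝ) - 1 + α| = i + 1 - α := by
      rw [abs_of_neg (by linarith [hα.2])]
      ring
    have hpa : 0 < i + α := by linarith [hα.1]
    have hpb : 0 < i + 1 - α := by linarith [hα.2]
    rw [ha, hb, Real.log_div hN0.ne' hpa.ne', Real.log_div hN0.ne' hpb.ne']
    have h2 : Real.log ((i + α) * (i + 1 - α)) ≤ Real.log ((i + 1 / 2) ^ 2) :=
      Real.log_le_log (mul_pos hpa hpb) (by nlinarith [sq_nonneg (α - 1 / 2)])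
    rw [Real.log_mul hpa.ne' hpb.ne', Real.log_pow] at h2
    push_cast at h2
    linarith
  refine le_trans ?_ (Finset.sum_le_sum h1)
  rw [Finset.sum_sub_distrib, ← Finset.mul_sum, ← Finset.mul_sum, Finset.sum_const,
    Finset.card_range, nsmul_eq_mul]
  have := hC N hN
  linarith

theorem summable_div_of_summable_sq {α : ℝ} {x : ℤ → ℝ} (h : Summable fun n => x n ^ 2) :
    Summable fun n : ℤ => |x n| / |n + α| := by
  have h1 : Summable fun n : ℤ => 1 / |(n : ℝ) + α| ^ (2 : ℝ) :=
    (Real.summable_one_div_int_add_rpow α 2).2 (by norm_num)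
  refine Summable.of_nonneg_of_le (fun n => by positivity) (fun n => ?_) (h.add h1)
  have h2 : 1 / |(n : ℝ) + α| ^ (2 : ℝ) = (1 / |(n : ℝ) + α|) ^ 2 := by
    rw [div_pow, one_pow, ← Real.rpow_natCast]
    norm_num
  rw [h2, div_eq_mul_one_div, ← sq_abs (x n)]
  nlinarith [sq_nonneg (|x n| - 1 / |(n : ℝ) + α|), sq_nonneg |x n|,
    sq_nonneg (1 / |(n : ℝ) + α|)]

theorem log_abs_le {x y : ℝ} (hx : x ≠ 0) (hy : y ≠ 0) :
    Real.log |x| ≤ Real.log |y| + |x - y| / |y| := by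
  have hy' := abs_pos.2 hy
  have hx' := abs_pos.2 hx
  have h1 := Real.log_le_sub_one_of_pos (div_pos hx' hy')
  rw [Real.log_div hx'.ne' hy'.ne'] at h1
  have h2 : |x| / |y| - 1 ≤ |x - y| / |y| := by
    rw [div_sub_one hy'.ne']
    exact div_le_div_of_nonneg_right (abs_sub_abs_le_abs_sub x y) hy'.le
  linarith

/-- Replacing `n + α` by `ρ n` costs at most `∑ |ρ n - (n + α)| / |n + α|`, finite because both
factors are square summable. Each excluded index costs at most `log N`, as `n + α ≥ 1` there. -/
theorem sum_log_div_abs_ge {α : ℝ} (hα : α ∈ Ioo (0 : ℝ) 1) {ρ : ℤ → ℝ}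
    (h : Summable fun n : ℤ => (ρ n - (n + α)) ^ 2) :
    ∃ C, ∀ N : ℕ, 1 ≤ N → ∀ E : Finset ℤ, (∀ n ∈ E, 1 ≤ n) → (∀ n ∉ E, ρ n ≠ 0) →
      2 * N - C - E.card * Real.log N ≤
        ∑ n ∈ Finset.Ico (-(N : ℤ)) N \ E, Real.log (N / |ρ n|) := by
  obtain ⟨C, hC⟩ := sum_log_div_ge hα
  have hs := summable_div_of_summable_sq (α := α) h
  refine ⟨C + ∑' n : ℤ, |ρ n - (n + α)| / |n + α|, fun N hN E hE hρ => ?_⟩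
  have hN0 : (0 : ℝ) < N := by exact_mod_cast hN
  have hlogN : 0 ≤ Real.log N := Real.log_nonneg (by exact_mod_cast hN)
  have h1 : ∑ n ∈ Finset.Ico (-(N : ℤ)) N \ E,
      (Real.log (N / |n + α|) - |ρ n - (n + α)| / |n + α|) ≤
        ∑ n ∈ Finset.Ico (-(N : ℤ)) N \ E, Real.log (N / |ρ n|) := by
    refine Finset.sum_le_sum fun n hn => ?_
    have hn := hρ n (Finset.mem_sdiff.1 hn).2
    have hα' := int_add_ne_zero hα n
    rw [Real.log_div hN0.ne' (abs_pos.2 hn).ne', Real.log_div hN0.ne' (abs_pos.2 hα').ne']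
    linarith [log_abs_le hn hα']
  refine le_trans ?_ h1
  have h2 : ∑ n ∈ Finset.Ico (-(N : ℤ)) N \ E, |ρ n - (n + α)| / |n + α| ≤
      ∑' n : ℤ, |ρ n - (n + α)| / |n + α| :=
    hs.sum_le_tsum _ fun n _ => by positivity
  have h3 : ∑ n ∈ Finset.Ico (-(N : ℤ)) N ∩ E, Real.log (N / |n + α|) ≤
      E.card * Real.log N := by
    calc ∑ n ∈ Finset.Ico (-(N : ℤ)) N ∩ E, Real.log (N / |n + α|)
        ≤ ∑ n ∈ Finset.Ico (-(N : ℤ)) N ∩ E, Real.log N := by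
          refine Finset.sum_le_sum fun n hn => ?_
          have hn : (1 : ℝ) ≤ n := by exact_mod_cast hE n (Finset.mem_inter.1 hn).2
          have h4 : (1 : ℝ) ≤ |n + α| := by
            rw [abs_of_pos (by linarith [hα.1])]
            linarith [hα.1]
          refine Real.log_le_log (by positivity) ?_
          rw [div_le_iff₀ (by linarith)]
          nlinarith
      _ ≤ _ := by
          rw [Finset.sum_const, nsmul_eq_mul]
          exact mul_le_mul_of_nonneg_right
            (by exact_mod_cast Finset.card_le_card Finset.inter_subset_right) hlogN
  have h5 := Finset.sum_inter_add_sum_sdiff (Finset.Ico (-(N : ℤ)) N) E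
    fun n => Real.log (N / |n + α|)
  rw [Finset.sum_sub_distrib]
  have := hC N hN
  linarith

end QTree
end

open MeasureTheory Set Filter Topology

noncomputable section

namespace QTree

/-! ### Exponential, sine and cosine transforms on an interval -/

/-- `∫₀ᵃ h(t) e^{μt} dt`. -/
def expTransform (a : ℝ) (h : ℝ → ℝ) (μ : ℂ) : ℂ :=
  ∫ t in (0 : ℝ)..a, (h t : ℂ) * Complex.exp (μ * t)

/-- `∫₀ᵃ h(t) sin(ρt) dt`. -/
def sinTransform (a : ℝ) (h : ℝ → ℝ) (ρ : ℂ) : ℂ :=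
  (expTransform a h (-ρ * Complex.I) - expTransform a h (ρ * Complex.I)) * Complex.I / 2

/-- `∫₀ᵃ h(t) cos(ρt) dt`. -/
def cosTransform (a : ℝ) (h : ℝ → ℝ) (ρ : ℂ) : ℂ :=
  (expTransform a h (ρ * Complex.I) + expTransform a h (-ρ * Complex.I)) / 2

section

variable {a : ℝ} {h : ℝ → ℝ}

theorem intervalIntegrable_mul_exp (hh : IntervalIntegrable h volume 0 a) (μ : ℂ) :
    IntervalIntegrable (fun t : ℝ => (h t : ℂ) * Complex.exp (μ * t)) volume 0 a :=
  (show IntervalIntegrable (fun t => (h t : ℂ)) volume 0 a from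
    ⟨hh.1.ofReal, hh.2.ofReal⟩).mul_continuousOn (by fun_prop)

theorem sinTransform_ofReal (hh : IntervalIntegrable h volume 0 a) (ρ : ℝ) :
    sinTransform a h ρ = ((∫ t in (0 : ℝ)..a, h t * Real.sin (ρ * t) : ℝ) : ℂ) := by
  unfold sinTransform expTransform
  rw [← intervalIntegral.integral_sub (intervalIntegrable_mul_exp hh _)
    (intervalIntegrable_mul_exp hh _), ← intervalIntegral.integral_ofReal, mul_div_assoc,
    ← intervalIntegral.integral_mul_const]
  refine intervalIntegral.integral_congr fun t _ => ?_
  simp only [Complex.ofReal_mul, Complex.ofReal_sin, Complex.sin]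
  ring_nf

theorem cosTransform_ofReal (hh : IntervalIntegrable h volume 0 a) (ρ : ℝ) :
    cosTransform a h ρ = ((∫ t in (0 : ℝ)..a, h t * Real.cos (ρ * t) : ℝ) : ℂ) := by
  unfold cosTransform expTransform
  rw [← intervalIntegral.integral_add (intervalIntegrable_mul_exp hh _)
    (intervalIntegrable_mul_exp hh _), ← intervalIntegral.integral_ofReal,
    ← intervalIntegral.integral_div]
  refine intervalIntegral.integral_congr fun t _ => ?_
  simp only [Complex.ofReal_mul, Complex.ofReal_cos, Complex.cos]
  ring_nf

theorem sinTransform_neg (ρ : ℂ) : sinTransform a h (-ρ) = -sinTransform a h ρ := by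
  simp only [sinTransform, neg_neg]
  ring

theorem cosTransform_neg (ρ : ℂ) : cosTransform a h (-ρ) = cosTransform a h ρ := by
  simp only [cosTransform, neg_neg]
  ring

theorem hasDerivAt_expTransform (ha : 0 ≤ a) (hh : IntervalIntegrable h volume 0 a) (μ : ℂ) :
    HasDerivAt (expTransform a h) (expTransform a (fun t => t * h t) μ) μ := by
  have hmeas : ∀ ν : ℂ, AEStronglyMeasurable (fun t : ℝ => (h t : ℂ) * Complex.exp (ν * t))
      (volume.restrict (uIoc 0 a)) := fun ν =>
    (intervalIntegrable_mul_exp hh ν).def'.aestronglyMeasurable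
  have hbound : IntervalIntegrable (fun t => |h t| * (a * Real.exp ((‖μ‖ + 1) * a))) volume 0 a :=
    hh.abs.mul_const _
  have hth : IntervalIntegrable (fun t => t * h t) volume 0 a :=
    hh.continuousOn_mul continuousOn_id
  have := (intervalIntegral.hasDerivAt_integral_of_dominated_loc_of_deriv_le
    (F := fun ν t => (h t : ℂ) * Complex.exp (ν * t))
    (F' := fun ν t => ((t * h t : ℝ) : ℂ) * Complex.exp (ν * t))
    (x₀ := μ) (Metric.ball_mem_nhds μ one_pos) (Eventually.of_forall hmeas)
    (intervalIntegrable_mul_exp hh μ) (intervalIntegrable_mul_exp hth μ).def'.aestronglyMeasurable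
    (bound := fun t => |h t| * (a * Real.exp ((‖μ‖ + 1) * a))) ?_ hbound ?_).2
  · exact this
  · refine Eventually.of_forall fun t ht ν hν => ?_
    rw [uIoc_of_le ha] at ht
    rw [norm_mul, Complex.norm_real, Real.norm_eq_abs, abs_mul, abs_of_pos ht.1, Complex.norm_exp,
      mul_comm t, mul_assoc]
    have hν' : ‖ν‖ ≤ ‖μ‖ + 1 := by
      have := norm_sub_norm_le ν μ
      have := mem_ball_iff_norm.1 hν
      linarith
    have hre : (ν * (t : ℂ)).re ≤ (‖μ‖ + 1) * a := by
      rw [Complex.re_mul_ofReal]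
      calc ν.re * t ≤ ‖ν‖ * t := by
            have := Complex.re_le_norm ν
            have := ht.1.le
            gcongr
        _ ≤ (‖μ‖ + 1) * a := by
            have := ht.2
            have := ht.1.le
            gcongr
    have := ht.2
    gcongr
  · refine Eventually.of_forall fun t _ ν _ => ?_
    have h1 : HasDerivAt (fun ν : ℂ => ν * (t : ℂ)) t ν := by
      simpa using (hasDerivAt_id ν).mul_const (t : ℂ)
    refine (h1.cexp.const_mul (h t : ℂ)).congr_deriv ?_
    push_cast
    ring

theorem hasDerivAt_sinTransform (ha : 0 ≤ a) (hh : IntervalIntegrable h volume 0 a) (ρ : ℂ) :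
    HasDerivAt (sinTransform a h) (cosTransform a (fun t => t * h t) ρ) ρ := by
  have h1 : HasDerivAt (fun ρ : ℂ => ρ * Complex.I) Complex.I ρ := by
    simpa using (hasDerivAt_id ρ).mul_const Complex.I
  have h2 : HasDerivAt (fun ρ : ℂ => -ρ * Complex.I) (-Complex.I) ρ := by
    simpa using (hasDerivAt_id ρ).neg.mul_const Complex.I
  have := ((((hasDerivAt_expTransform ha hh _).comp ρ h2).sub
    ((hasDerivAt_expTransform ha hh _).comp ρ h1)).mul_const Complex.I).div_const 2
  refine this.congr_deriv ?_
  unfold cosTransform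
  linear_combination (-(expTransform a (fun t => t * h t) (ρ * Complex.I) +
    expTransform a (fun t => t * h t) (-ρ * Complex.I)) / 2) * Complex.I_mul_I

theorem hasDerivAt_cosTransform (ha : 0 ≤ a) (hh : IntervalIntegrable h volume 0 a) (ρ : ℂ) :
    HasDerivAt (cosTransform a h) (-sinTransform a (fun t => t * h t) ρ) ρ := by
  have h1 : HasDerivAt (fun ρ : ℂ => ρ * Complex.I) Complex.I ρ := by
    simpa using (hasDerivAt_id ρ).mul_const Complex.I
  have h2 : HasDerivAt (fun ρ : ℂ => -ρ * Complex.I) (-Complex.I) ρ := by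
    simpa using (hasDerivAt_id ρ).neg.mul_const Complex.I
  have := (((hasDerivAt_expTransform ha hh _).comp ρ h1).add
    ((hasDerivAt_expTransform ha hh _).comp ρ h2)).div_const 2
  refine this.congr_deriv ?_
  unfold sinTransform
  ring

theorem differentiable_sinTransform (ha : 0 ≤ a) (hh : IntervalIntegrable h volume 0 a) :
    Differentiable ℂ (sinTransform a h) :=
  fun ρ => (hasDerivAt_sinTransform ha hh ρ).differentiableAt

theorem differentiable_cosTransform (ha : 0 ≤ a) (hh : IntervalIntegrable h volume 0 a) :
    Differentiable ℂ (cosTransform a h) :=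
  fun ρ => (hasDerivAt_cosTransform ha hh ρ).differentiableAt

theorem succ_le_analyticOrderAt {f : ℂ → ℂ} (hf : Differentiable ℂ f) {z : ℂ} (h0 : f z = 0)
    {n : ℕ} (hn : (n : ℕ∞) ≤ analyticOrderAt (deriv f) z) :
    ((n + 1 : ℕ) : ℕ∞) ≤ analyticOrderAt f z := by
  have h1 := (hf.analyticAt z).analyticOrderAt_deriv_add_one
  simp only [h0, sub_zero] at h1
  rw [← h1]
  push_cast
  gcongr

/-- Differentiation exchanges the two transforms, up to sign, and replaces `h` by `t h`, which
shifts the moments by one and flips their parity. The two statements are therefore proved together.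
-/
theorem le_analyticOrderAt_transform (ha : 0 ≤ a) (n : ℕ) :
    ∀ {h : ℝ → ℝ}, IntervalIntegrable h volume 0 a →
    ((∀ j < n, Odd j → ∫ t in (0 : ℝ)..a, h t * t ^ j = 0) →
      (n : ℕ∞) ≤ analyticOrderAt (sinTransform a h) 0) ∧
    ((∀ j < n, Even j → ∫ t in (0 : ℝ)..a, h t * t ^ j = 0) →
      (n : ℕ∞) ≤ analyticOrderAt (cosTransform a h) 0) := by
  induction n with
  | zero => simp
  | succ n ih =>
    intro h hh
    have hth : IntervalIntegrable (fun t => t * h t) volume 0 a :=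
      hh.continuousOn_mul continuousOn_id
    have hmom : ∀ j, ∫ t in (0 : ℝ)..a, t * h t * t ^ j = ∫ t in (0 : ℝ)..a, h t * t ^ (j + 1) :=
      fun j => intervalIntegral.integral_congr fun t _ => by ring
    obtain ⟨ih1, ih2⟩ := ih hth
    constructor
    · intro hm
      refine succ_le_analyticOrderAt (differentiable_sinTransform ha hh) ?_ ?_
      · have := sinTransform_ofReal hh 0
        simpa using this
      · rw [show deriv (sinTransform a h) = cosTransform a fun t => t * h t from
          funext fun ρ => (hasDerivAt_sinTransform ha hh ρ).deriv]
        refine ih2 fun j hj hj' => ?_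
        rw [hmom]
        exact hm _ (by omega) hj'.add_one
    · intro hm
      refine succ_le_analyticOrderAt (differentiable_cosTransform ha hh) ?_ ?_
      · have := cosTransform_ofReal hh 0
        have h0 := hm 0 (by omega) Even.zero
        simp only [pow_zero, mul_one] at h0
        simpa [h0] using this
      · rw [show deriv (cosTransform a h) = -sinTransform a fun t => t * h t from
          funext fun ρ => (hasDerivAt_cosTransform ha hh ρ).deriv, analyticOrderAt_neg]
        refine ih1 fun j hj hj' => ?_
        rw [hmom]
        exact hm _ (by omega) hj'.add_one

theorem norm_expTransform_le (ha : 0 ≤ a) (hh : IntervalIntegrable h volume 0 a) (μ : ℂ) :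
    ‖expTransform a h μ‖ ≤ Real.exp (a * |μ.re|) * ∫ t in (0 : ℝ)..a, |h t| := by
  rw [← intervalIntegral.integral_const_mul]
  refine intervalIntegral.norm_integral_le_of_norm_le ha
    (Eventually.of_forall fun t ht => ?_) (hh.abs.const_mul _)
  rw [norm_mul, Complex.norm_real, Complex.norm_exp, Complex.re_mul_ofReal, Real.norm_eq_abs,
    mul_comm]
  refine mul_le_mul_of_nonneg_right (Real.exp_le_exp.2 ?_) (abs_nonneg _)
  calc μ.re * t ≤ |μ.re| * a := mul_le_mul (le_abs_self _) ht.2 ht.1.le (abs_nonneg _)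
    _ = _ := mul_comm _ _

/-- The exponential concentrates at the right end for `Re μ > 0` and at the left end for `Re μ < 0`;
the gain of a square root over `norm_expTransform_le` comes from `h ∈ L₂`. -/
theorem norm_expTransform_le_div_sqrt (ha : 0 ≤ a) (hh : IntervalIntegrable h volume 0 a)
    (hh2 : IntervalIntegrable (fun t => h t ^ 2) volume 0 a) {μ : ℂ} (hμ : μ.re ≠ 0) :
    ‖expTransform a h μ‖ ≤
      Real.exp (a * |μ.re|) * ((1 + ∫ t in (0 : ℝ)..a, h t ^ 2) / √|μ.re|) := by
  have hτ : 0 < |μ.re| := abs_pos.2 hμ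
  have key : ∀ s : ℝ → ℝ, ((s = fun t => t) ∨ s = fun t => a - t) →
      (∀ t ∈ Ioc 0 a, μ.re * t ≤ a * |μ.re| + -(|μ.re| * s t)) →
      ‖expTransform a h μ‖ ≤
        Real.exp (a * |μ.re|) * ((1 + ∫ t in (0 : ℝ)..a, h t ^ 2) / √|μ.re|) := by
    intro s hs hle
    have hsc : Continuous s := by rcases hs with rfl | rfl <;> fun_prop
    have hint : IntervalIntegrable (fun t => Real.exp (-(|μ.re| * s t)) * |h t|) volume 0 a :=
      hh.abs.continuousOn_mul (by fun_prop)
    refine le_trans ?_ (mul_le_mul_of_nonneg_left (integral_exp_mul_abs_le hτ hh hh2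
      ⟨ha, le_rfl⟩ hs) (Real.exp_nonneg _))
    rw [← intervalIntegral.integral_const_mul]
    refine intervalIntegral.norm_integral_le_of_norm_le ha
      (Eventually.of_forall fun t ht => ?_) (hint.const_mul _)
    rw [norm_mul, Complex.norm_real, Complex.norm_exp, Complex.re_mul_ofReal, Real.norm_eq_abs,
      ← mul_assoc, ← Real.exp_add, mul_comm]
    gcongr
    exact hle t ht
  rcases lt_or_gt_of_ne hμ with hneg | hpos
  · refine key (fun t => t) (Or.inl rfl) fun t ht => ?_
    rw [abs_of_neg hneg]
    nlinarith [ht.1]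
  · refine key (fun t => a - t) (Or.inr rfl) fun t ht => ?_
    rw [abs_of_pos hpos]
    linarith

theorem norm_transform_le_of {B : ℝ} {ρ : ℂ} (h1 : ‖expTransform a h (ρ * Complex.I)‖ ≤ B)
    (h2 : ‖expTransform a h (-ρ * Complex.I)‖ ≤ B) :
    ‖sinTransform a h ρ‖ ≤ B ∧ ‖cosTransform a h ρ‖ ≤ B := by
  constructor
  · rw [sinTransform, norm_div, norm_mul, Complex.norm_I, mul_one, Complex.norm_ofNat,
      div_le_iff₀ two_pos]
    exact (norm_sub_le _ _).trans (by linarith)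
  · rw [cosTransform, norm_div, Complex.norm_ofNat, div_le_iff₀ two_pos]
    exact (norm_add_le _ _).trans (by linarith)

theorem norm_transform_le (ha : 0 ≤ a) (hh : IntervalIntegrable h volume 0 a) (ρ : ℂ) :
    ‖sinTransform a h ρ‖ ≤ Real.exp (a * |ρ.im|) * ∫ t in (0 : ℝ)..a, |h t| ∧
      ‖cosTransform a h ρ‖ ≤ Real.exp (a * |ρ.im|) * ∫ t in (0 : ℝ)..a, |h t| := by
  refine norm_transform_le_of ?_ ?_
  · simpa using norm_expTransform_le ha hh (ρ * Complex.I)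
  · simpa using norm_expTransform_le ha hh (-ρ * Complex.I)

theorem norm_sinTransform_le_div_sqrt (ha : 0 ≤ a) (hh : IntervalIntegrable h volume 0 a)
    (hh2 : IntervalIntegrable (fun t => h t ^ 2) volume 0 a) {ρ : ℂ} (hρ : ρ.im ≠ 0) :
    ‖sinTransform a h ρ‖ ≤
      Real.exp (a * |ρ.im|) * ((1 + ∫ t in (0 : ℝ)..a, h t ^ 2) / √|ρ.im|) := by
  refine (norm_transform_le_of ?_ ?_).1
  · simpa using norm_expTransform_le_div_sqrt ha hh hh2 (μ := ρ * Complex.I) (by simpa using hρ)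
  · simpa using norm_expTransform_le_div_sqrt ha hh hh2 (μ := -ρ * Complex.I) (by simpa using hρ)

end

/-! ### Bounds for functions with given asymptotics in the plane of `ρ = √λ` -/

theorem exists_sq_eq_neg_sq (ρ : ℂ) :
    ∃ μ : ℂ, μ.re = |ρ.im| ∧ ‖μ‖ = ‖ρ‖ ∧ ρ ^ 2 = -μ ^ 2 := by
  have hI : ∀ w : ℂ, (w * Complex.I) ^ 2 = -w ^ 2 := fun w => by
    rw [mul_pow, Complex.I_sq, mul_neg_one]
  rcases le_total 0 ρ.im with h | h
  · exact ⟨-ρ * Complex.I, by simp [abs_of_nonneg h], by simp, by rw [hI]; ring⟩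
  · exact ⟨ρ * Complex.I, by simp [abs_of_nonpos h], by simp, by rw [hI]; ring⟩

theorem HasAsymp.exists_norm_le {f : ℂ → ℂ} {k : ℤ} {n : ℕ} {c : ℝ} (hf : HasAsymp f k n c) :
    ∃ M, 0 ≤ M ∧ ∀ ρ : ℂ, 1 ≤ ‖ρ‖ →
      ‖f (ρ ^ 2)‖ ≤ M * (‖ρ‖ ^ k * Real.exp (n * Real.pi * |ρ.im|)) := by
  obtain ⟨ε, ⟨M, hM⟩, -, h⟩ := hf
  refine ⟨M, (norm_nonneg _).trans (hM 1 (by simp) (by simp)), fun ρ hρ => ?_⟩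
  obtain ⟨μ, h1, h2, h3⟩ := exists_sq_eq_neg_sq ρ
  have hre : 0 ≤ μ.re := h1 ▸ abs_nonneg _
  rw [h3, h μ hre (h2 ▸ hρ), norm_mul, norm_mul, norm_zpow, Complex.norm_exp, h2, mul_comm]
  have e : ((n : ℂ) * (Real.pi * μ)).re = n * Real.pi * |ρ.im| := by
    rw [← h1, ← Complex.ofReal_natCast, Complex.re_ofReal_mul, Complex.re_ofReal_mul, mul_assoc]
  rw [e]
  exact mul_le_mul_of_nonneg_right (hM μ hre (h2 ▸ hρ)) (by positivity)

/-- With `μ = ∓iρ` one has `Re μ = |Im ρ|`, so the bound from below holds far from the real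
`ρ`-axis, where `ε` is close to `c`; near that axis zeros may occur. -/
theorem HasAsymp.exists_le_norm {f : ℂ → ℂ} {k : ℤ} {n : ℕ} {c : ℝ} (hf : HasAsymp f k n c)
    (hc : 0 < c) : ∃ T, ∀ ρ : ℂ, 1 ≤ ‖ρ‖ → T ≤ |ρ.im| →
      c / 2 * (‖ρ‖ ^ k * Real.exp (n * Real.pi * |ρ.im|)) ≤ ‖f (ρ ^ 2)‖ := by
  obtain ⟨ε, -, hε, h⟩ := hf
  have h4 : ∀ᶠ μ in comap Complex.re atTop, c / 2 ≤ ‖ε μ‖ := by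
    refine (hε.norm.eventually_const_le ?_)
    rw [Complex.norm_real, Real.norm_of_nonneg hc.le]
    linarith
  rw [eventually_comap] at h4
  obtain ⟨T, hT⟩ := eventually_atTop.1 h4
  refine ⟨T, fun ρ hρ hρT => ?_⟩
  obtain ⟨μ, h1, h2, h3⟩ := exists_sq_eq_neg_sq ρ
  have hre : 0 ≤ μ.re := h1 ▸ abs_nonneg _
  rw [h3, h μ hre (h2 ▸ hρ), norm_mul, norm_mul, norm_zpow, Complex.norm_exp, h2, mul_comm]
  have e : ((n : ℂ) * (Real.pi * μ)).re = n * Real.pi * |ρ.im| := by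
    rw [← h1, ← Complex.ofReal_natCast, Complex.re_ofReal_mul, Complex.re_ofReal_mul, mul_assoc]
  rw [e]
  exact mul_le_mul_of_nonneg_left (hT _ hρT μ h1) (by positivity)

end QTree
end

open MeasureTheory Set Filter Topology

noncomputable section

namespace QTree

/-! ### Vanishing of the transforms -/

theorem le_analyticOrderAt_mul {f g : ℂ → ℂ} (hf : Differentiable ℂ f) (hg : Differentiable ℂ g)
    {z : ℂ} {m n : ℕ} (hm : (m : ℕ∞) ≤ analyticOrderAt f z) (hn : (n : ℕ∞) ≤ analyticOrderAt g z) :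
    ((m + n : ℕ) : ℕ∞) ≤ analyticOrderAt (fun w => f w * g w) z := by
  rw [show (fun w => f w * g w) = f * g from rfl,
    analyticOrderAt_mul (hf.analyticAt z) (hg.analyticAt z)]
  push_cast
  gcongr

theorem le_analyticOrderAt_pow (m : ℕ) :
    (m : ℕ∞) ≤ analyticOrderAt (fun w : ℂ => w ^ m) 0 := by
  rw [natCast_le_analyticOrderAt (by fun_prop)]
  exact ⟨fun _ => 1, by fun_prop, by simp⟩

theorem sum_card_excluded_le (l s : ℕ) :
    ∑ k : Fin l, ((if (k : ℕ) = 0 then Finset.Icc (1 : ℤ) s else ∅).card : ℝ) ≤ s := by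
  cases l with
  | zero => simp
  | succ l => simp [Fin.sum_univ_succ]

theorem sum_zeros_ge {l s : ℕ} {α : Fin l → ℝ} (hα : ∀ k, α k ∈ Ioo (0 : ℝ) 1)
    {ρ : ℤ → Fin l → ℝ} (hasymp : ∀ k, Summable fun n : ℤ => (ρ n k - (n + α k)) ^ 2)
    (hne : ∀ p ∈ indexSet l (s + 1), ρ p.1 p.2 ≠ 0) :
    ∃ C, ∀ N : ℕ, 1 ≤ N → ∃ S : Finset (ℤ × Fin l),
      (∀ p ∈ S, p ∈ indexSet l (s + 1) ∧ |ρ p.1 p.2| ≤ N) ∧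
      2 * l * N - C - s * Real.log N ≤ ∑ p ∈ S, Real.log (N / |ρ p.1 p.2|) := by
  classical
  choose C hC using fun k => sum_log_div_abs_ge (hα k) (hasymp k)
  refine ⟨∑ k, C k, fun N hN => ?_⟩
  have hN0 : (0 : ℝ) < N := by exact_mod_cast hN
  have hlogN : 0 ≤ Real.log N := Real.log_nonneg (by exact_mod_cast hN)
  set E : Fin l → Finset ℤ := fun k => if (k : ℕ) = 0 then Finset.Icc (1 : ℤ) s else ∅ with hE
  have hmem : ∀ p : ℤ × Fin l, p ∈ indexSet l (s + 1) ↔ p.1 ∉ E p.2 := by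
    intro p
    simp only [indexSet, mem_ofPred_eq, hE]
    split_ifs with h <;> simp [h]
  set T : Finset (ℤ × Fin l) := (Finset.Ico (-(N : ℤ)) N ×ˢ Finset.univ).filter
    (· ∈ indexSet l (s + 1)) with hT
  refine ⟨T.filter fun p => |ρ p.1 p.2| ≤ N, fun p hp => ?_, ?_⟩
  · rw [Finset.mem_filter, hT, Finset.mem_filter] at hp
    exact ⟨hp.1.2, hp.2⟩
  have h1 : ∑ p ∈ T, Real.log (N / |ρ p.1 p.2|) ≤
      ∑ p ∈ T.filter fun p => |ρ p.1 p.2| ≤ N, Real.log (N / |ρ p.1 p.2|) := by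
    -- Indices with `|ρ| > N` have nonpositive logarithms, so dropping them does not decrease the
    -- sum.
    rw [← Finset.sum_filter_add_sum_filter_not T fun p => |ρ p.1 p.2| ≤ N]
    refine add_le_of_nonpos_right (Finset.sum_nonpos fun p hp => ?_)
    have hp := not_le.1 (Finset.mem_filter.1 hp).2
    exact Real.log_nonpos (by positivity) ((div_le_one (hN0.trans hp)).2 hp.le)
  refine le_trans ?_ h1
  have h2 : ∑ p ∈ T, Real.log (N / |ρ p.1 p.2|) =
      ∑ k, ∑ n ∈ Finset.Ico (-(N : ℤ)) N \ E k, Real.log (N / |ρ n k|) := by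
    rw [hT, Finset.sum_filter, Finset.sum_product_right]
    refine Finset.sum_congr rfl fun k _ => ?_
    rw [Finset.sdiff_eq_filter, Finset.sum_filter]
    refine Finset.sum_congr rfl fun n _ => ?_
    simp only [hmem]
  rw [h2]
  have h3 : ∑ k, (2 * (N : ℝ) - C k - (E k).card * Real.log N) ≤
      ∑ k, ∑ n ∈ Finset.Ico (-(N : ℤ)) N \ E k, Real.log (N / |ρ n k|) := by
    refine Finset.sum_le_sum fun k _ => hC k N hN (E k) (fun n hn => ?_) fun n hn => ?_
    · simp only [hE] at hn
      split_ifs at hn with h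
      · exact (Finset.mem_Icc.1 hn).1
      · simp at hn
    · exact hne (n, k) ((hmem (n, k)).2 hn)
  refine le_trans ?_ h3
  rw [Finset.sum_sub_distrib, Finset.sum_sub_distrib, Finset.sum_const, Finset.card_univ,
    Fintype.card_fin, nsmul_eq_mul, ← Finset.sum_mul]
  have h4 := mul_le_mul_of_nonneg_right (sum_card_excluded_le l s) hlogN
  linarith

/-- In Jensen's inequality at radius `N` the zeros `±ρ` give `4lN - 2s log N - O(1)`, the origin
gives `(2s + 1) log N`, and the growth allows `4lN + O(1)`. So `log N` would be bounded. -/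
theorem eq_zero_of_zeros {l s : ℕ} {α : Fin l → ℝ} (hα : ∀ k, α k ∈ Ioo (0 : ℝ) 1)
    {ρ : ℤ → Fin l → ℝ} (hasymp : ∀ k, Summable fun n : ℤ => (ρ n k - (n + α k)) ^ 2)
    (hinj : InjOn (fun p : ℤ × Fin l => ρ p.1 p.2 ^ 2) (indexSet l (s + 1)))
    (hne : ∀ p ∈ indexSet l (s + 1), ρ p.1 p.2 ≠ 0) {f : ℂ → ℂ} (hf : Differentiable ℂ f) {C : ℝ}
    (hC : 1 ≤ C) (hb : ∀ z, 1 ≤ ‖z‖ → ‖f z‖ ≤ C * Real.exp (2 * l * Real.pi * |z.im|))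
    (hord : ((2 * s + 1 : ℕ) : ℕ∞) ≤ analyticOrderAt f 0)
    (hzero : ∀ p ∈ indexSet l (s + 1), f (ρ p.1 p.2) = 0 ∧ f (-ρ p.1 p.2) = 0) (z : ℂ) :
    f z = 0 := by
  classical
  by_contra hz
  obtain ⟨c, hc⟩ := jensen_inequality hf hz hord (by positivity) hC hb
  obtain ⟨D, hD⟩ := sum_zeros_ge hα hasymp hne
  have key : ∀ N : ℕ, 1 ≤ N → Real.log N ≤ c + 2 * D := by
    intro N hN
    obtain ⟨S, hS, hsum⟩ := hD N hN
    have hreal : ∀ p ∈ S, ∀ q ∈ S, (ρ p.1 p.2) ^ 2 = (ρ q.1 q.2) ^ 2 → p = q :=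
      fun p hp q hq h => hinj (hS p hp).1 (hS q hq).1 h
    have h1 := hc N (by exact_mod_cast hN) (S.image (fun p => ((ρ p.1 p.2 : ℝ) : ℂ)) ∪
      S.image (fun p => ((-ρ p.1 p.2 : ℝ) : ℂ))) (fun w hw => by
        rcases Finset.mem_union.1 hw with hw | hw
        · obtain ⟨p, hp, rfl⟩ := Finset.mem_image.1 hw
          refine ⟨?_, ?_, (hzero p (hS p hp).1).1⟩
          · exact_mod_cast hne p (hS p hp).1
          · rw [Complex.norm_real]
            exact (hS p hp).2
        · obtain ⟨p, hp, rfl⟩ := Finset.mem_image.1 hw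
          refine ⟨?_, ?_, ?_⟩
          · exact_mod_cast neg_ne_zero.2 (hne p (hS p hp).1)
          · rw [Complex.norm_real, norm_neg]
            exact (hS p hp).2
          · rw [Complex.ofReal_neg]
            exact (hzero p (hS p hp).1).2)
    rw [Finset.sum_union, Finset.sum_image, Finset.sum_image] at h1
    · simp only [Complex.norm_real, Real.norm_eq_abs, abs_neg] at h1
      have hpi := Real.pi_ne_zero
      have e : 2 * (l : ℝ) * Real.pi * (2 * N / Real.pi) = 4 * l * N := by
        field_simp
        ring
      rw [e] at h1
      push_cast at h1
      linarith
    · intro p hp q hq h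
      have h : -ρ p.1 p.2 = -ρ q.1 q.2 := Complex.ofReal_injective h
      exact hreal p hp q hq (by rw [neg_injective h])
    · intro p hp q hq h
      have h : ρ p.1 p.2 = ρ q.1 q.2 := Complex.ofReal_injective h
      exact hreal p hp q hq (by rw [h])
    · refine Finset.disjoint_left.2 fun w hw hw' => ?_
      obtain ⟨p, hp, rfl⟩ := Finset.mem_image.1 hw
      obtain ⟨q, hq, h⟩ := Finset.mem_image.1 hw'
      have h : -ρ q.1 q.2 = ρ p.1 p.2 := by exact_mod_cast h
      have hpq : q = p := hreal q hq p hp (by rw [← h, neg_sq])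
      subst hpq
      exact hne q (hS q hq).1 (by linarith)
  have hlim : Tendsto (fun N : ℕ => Real.log N) atTop atTop :=
    Real.tendsto_log_atTop.comp tendsto_natCast_atTop_atTop
  obtain ⟨N, hN1, hN2⟩ := ((hlim.eventually_gt_atTop (c + 2 * D)).and
    (eventually_ge_atTop 1)).exists
  exact absurd (key N hN2) (not_le.2 hN1)

/-! ### The entire functions attached to an orthogonal vector -/

section

variable {l s : ℕ} {DP DK : ℂ → ℂ} {cP cK : ℝ} {h₁ h₂ : ℝ → ℝ}

theorem transform_identity {α : Fin l → ℝ} (hα : ∀ k, α k ∈ Ioo (0 : ℝ) 1)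
    {ρ : ℤ → Fin l → ℝ} (hasymp : ∀ k, Summable fun n : ℤ => (ρ n k - (n + α k)) ^ 2)
    (hinj : InjOn (fun p : ℤ × Fin l => ρ p.1 p.2 ^ 2) (indexSet l (s + 1)))
    (hne : ∀ p ∈ indexSet l (s + 1), ρ p.1 p.2 ≠ 0)
    (hDP : Differentiable ℂ DP) (hDK : Differentiable ℂ DK)
    (hP : HasAsymp DP (-((s + 1 : ℕ) : ℤ)) l cP) (hK : HasAsymp DK (1 - ((s + 1 : ℕ) : ℤ)) l cK)
    (hh₁ : IntervalIntegrable h₁ volume 0 (l * Real.pi))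
    (hh₂ : IntervalIntegrable h₂ volume 0 (l * Real.pi))
    (hs₁ : ((s + 1 : ℕ) : ℕ∞) ≤ analyticOrderAt (sinTransform (l * Real.pi) h₁) 0)
    (hs₂ : (s : ℕ∞) ≤ analyticOrderAt (cosTransform (l * Real.pi) h₂) 0)
    (hzero : ∀ p ∈ indexSet l (s + 1),
      (ρ p.1 p.2 : ℂ) * DP (ρ p.1 p.2 ^ 2) * cosTransform (l * Real.pi) h₂ (ρ p.1 p.2) =
        DK (ρ p.1 p.2 ^ 2) * sinTransform (l * Real.pi) h₁ (ρ p.1 p.2)) {z : ℂ} (hz : z ≠ 0) :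
    z * DP (z ^ 2) * cosTransform (l * Real.pi) h₂ z =
      DK (z ^ 2) * sinTransform (l * Real.pi) h₁ z := by
  have ha : 0 ≤ l * Real.pi := by positivity
  set F₁ := sinTransform (l * Real.pi) h₁ with hF₁
  set F₂ := cosTransform (l * Real.pi) h₂ with hF₂
  have hd₁ : Differentiable ℂ F₁ := differentiable_sinTransform ha hh₁
  have hd₂ : Differentiable ℂ F₂ := differentiable_cosTransform ha hh₂
  have hDP2 : Differentiable ℂ fun z => DP (z ^ 2) := hDP.comp (by fun_prop)
  have hDK2 : Differentiable ℂ fun z => DK (z ^ 2) := hDK.comp (by fun_prop)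
  set G : ℂ → ℂ := fun z => z * DP (z ^ 2) * F₂ z - DK (z ^ 2) * F₁ z with hG
  have hGd : Differentiable ℂ G :=
    ((differentiable_id.mul hDP2).mul hd₂).sub (hDK2.mul hd₁)
  have hGneg : ∀ z, G (-z) = -G z := fun z => by
    simp only [hG, hF₁, hF₂, sinTransform_neg, cosTransform_neg, neg_sq]
    ring
  have hGord : ((s + 1 : ℕ) : ℕ∞) ≤ analyticOrderAt G 0 := by
    have h1 : ((s + 1 : ℕ) : ℕ∞) ≤ analyticOrderAt (fun z => z * DP (z ^ 2) * F₂ z) 0 := by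
      have h2 := le_analyticOrderAt_mul (m := 1) (n := 0) (z := 0) differentiable_id hDP2
        (by simp) (by simp)
      have h3 := le_analyticOrderAt_mul (differentiable_id.mul hDP2) hd₂ h2 hs₂
      rwa [add_zero, add_comm] at h3
    have h2 : ((s + 1 : ℕ) : ℕ∞) ≤ analyticOrderAt (fun z => DK (z ^ 2) * F₁ z) 0 := by
      have := le_analyticOrderAt_mul (m := 0) (z := 0) hDK2 hd₁ (by simp) hs₁
      rwa [zero_add] at this
    refine le_trans (le_min h1 h2) ?_
    exact le_analyticOrderAt_sub
  obtain ⟨MP, hMP0, hMP⟩ := hP.exists_norm_le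
  obtain ⟨MK, hMK0, hMK⟩ := hK.exists_norm_le
  set I₁ := ∫ t in (0 : ℝ)..l * Real.pi, |h₁ t|
  set I₂ := ∫ t in (0 : ℝ)..l * Real.pi, |h₂ t|
  have hI₁ : 0 ≤ I₁ := intervalIntegral.integral_nonneg ha fun t _ => abs_nonneg _
  have hI₂ : 0 ≤ I₂ := intervalIntegral.integral_nonneg ha fun t _ => abs_nonneg _
  -- The powers of `z` in the asymptotics make `G` of size `|z|^{-s} e^{2lπ|Im z|}`. The factor
  -- `z^s` uses up this decay and raises the order at `0` from `s + 1` to `2s + 1`.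
  have hvan := eq_zero_of_zeros hα hasymp hinj hne (f := fun z => z ^ s * G z)
    ((differentiable_id.pow s).mul hGd) (C := MP * I₂ + MK * I₁ + 1)
    (by nlinarith [mul_nonneg hMP0 hI₂, mul_nonneg hMK0 hI₁])
    (fun z hz => by
      have hz0 : 0 < ‖z‖ := by linarith
      set e := Real.exp (l * Real.pi * |z.im|) with he
      have hee : Real.exp (2 * l * Real.pi * |z.im|) = e * e := by
        rw [he, ← Real.exp_add]
        ring_nf
      have h1 : ‖F₁ z‖ ≤ e * I₁ := (norm_transform_le ha hh₁ z).1
      have h2 : ‖F₂ z‖ ≤ e * I₂ := (norm_transform_le ha hh₂ z).2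
      have h3 := hMP z hz
      have h4 := hMK z hz
      have e1 : ‖z‖ ^ s * (‖z‖ * (MP * (‖z‖ ^ (-((s + 1 : ℕ) : ℤ)) * e))) = MP * e := by
        rw [zpow_neg, zpow_natCast, pow_succ]
        field_simp
      have e2 : ‖z‖ ^ s * (MK * (‖z‖ ^ (1 - ((s + 1 : ℕ) : ℤ)) * e)) = MK * e := by
        rw [show (1 : ℤ) - ((s + 1 : ℕ) : ℤ) = -((s : ℕ) : ℤ) by push_cast; ring, zpow_neg,
          zpow_natCast]
        field_simp
      calc ‖z ^ s * G z‖ ≤ ‖z‖ ^ s * (‖z‖ * ‖DP (z ^ 2)‖ * ‖F₂ z‖ + ‖DK (z ^ 2)‖ * ‖F₁ z‖) := by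
            rw [norm_mul, norm_pow]
            gcongr
            exact (norm_sub_le _ _).trans_eq (by rw [norm_mul, norm_mul, norm_mul])
        _ ≤ ‖z‖ ^ s * (‖z‖ * (MP * (‖z‖ ^ (-((s + 1 : ℕ) : ℤ)) * e)) * (e * I₂) +
              (MK * (‖z‖ ^ (1 - ((s + 1 : ℕ) : ℤ)) * e)) * (e * I₁)) := by gcongr
        _ = MP * e * (e * I₂) + MK * e * (e * I₁) := by rw [← e1, ← e2]; ring
        _ ≤ _ := by
            rw [hee]
            have : 0 ≤ e * e := mul_self_nonneg e
            nlinarith)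
    (by
      have := le_analyticOrderAt_mul (differentiable_id.pow s) hGd (le_analyticOrderAt_pow s) hGord
      rwa [show s + (s + 1) = 2 * s + 1 by ring] at this)
    (fun p hp => by
      have h1 : G (ρ p.1 p.2) = 0 := sub_eq_zero.2 (hzero p hp)
      simp [hGneg, h1]) z
  exact sub_eq_zero.1 ((mul_eq_zero.1 hvan).resolve_left (pow_ne_zero _ hz))

/-- Divisibility is checked locally. At `0` it follows from the order of `F₁` and `DP 0 ≠ 0`. Where
`DP (z ^ 2) = 0`, the function `DK (z ^ 2)` is nonzero, and the identity rewrites the quotient as `z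
F₂ / (z^{s+1} DK(z²))`. Elsewhere it is trivial. -/
theorem exists_transform_quotient (hDP : Differentiable ℂ DP) (hDK : Differentiable ℂ DK)
    (hP0 : DP 0 ≠ 0) (hPK : ∀ z, ¬ (DK z = 0 ∧ DP z = 0)) {F₁ F₂ : ℂ → ℂ}
    (hd₁ : Differentiable ℂ F₁) (hd₂ : Differentiable ℂ F₂)
    (hs₁ : ((s + 1 : ℕ) : ℕ∞) ≤ analyticOrderAt F₁ 0)
    (hid : ∀ z : ℂ, z ≠ 0 → z * DP (z ^ 2) * F₂ z = DK (z ^ 2) * F₁ z) :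
    ∃ Q : ℂ → ℂ, Differentiable ℂ Q ∧ ∀ z, F₁ z = z ^ (s + 1) * DP (z ^ 2) * Q z := by
  have hDP2 : Differentiable ℂ fun z => DP (z ^ 2) := hDP.comp (by fun_prop)
  have hDK2 : Differentiable ℂ fun z => DK (z ^ 2) := hDK.comp (by fun_prop)
  have hg : Differentiable ℂ fun z : ℂ => z ^ (s + 1) * DP (z ^ 2) :=
    (differentiable_id.pow _).mul hDP2
  obtain ⟨a, ha⟩ : ∃ a : ℂ, a ^ (s + 1) * DP (a ^ 2) ≠ 0 := by
    obtain ⟨a, ha, ha'⟩ := ((frequently_ne_zero hDP2 (a := 0) (by simpa using hP0) 0).and_eventually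
      (eventually_mem_nhdsWithin)).exists
    exact ⟨a, mul_ne_zero (pow_ne_zero _ ha') ha⟩
  refine exists_entire_quotient hg ha fun z => ?_
  by_cases hz : z = 0
  · subst hz
    obtain ⟨k, hk, hFk⟩ := (natCast_le_analyticOrderAt (hd₁.analyticAt 0)).1 hs₁
    have hP0' : DP ((0 : ℂ) ^ 2) ≠ 0 := by simpa using hP0
    refine ⟨fun w => k w / DP (w ^ 2), hk.div (hDP2.analyticAt 0) hP0', ?_⟩
    filter_upwards [hFk, hDP2.continuous.continuousAt.eventually_ne hP0'] with w hw hw'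
    rw [hw, sub_zero, smul_eq_mul]
    field_simp
  by_cases hP : DP (z ^ 2) = 0
  · have hK : DK (z ^ 2) ≠ 0 := fun h => hPK _ ⟨h, hP⟩
    refine ⟨fun w => w * F₂ w / (w ^ (s + 1) * DK (w ^ 2)),
      (analyticAt_id.mul (hd₂.analyticAt z)).div ((analyticAt_id.pow _).mul (hDK2.analyticAt z))
        (mul_ne_zero (pow_ne_zero _ hz) hK), ?_⟩
    filter_upwards [hDK2.continuous.continuousAt.eventually_ne hK, isOpen_ne.mem_nhds hz]
      with w hw hw'
    have h1 := hid w hw'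
    have h2 : w ≠ 0 := hw'
    field_simp
    linear_combination -h1
  · refine ⟨fun w => F₁ w / (w ^ (s + 1) * DP (w ^ 2)), (hd₁.analyticAt z).div (hg.analyticAt z)
      (mul_ne_zero (pow_ne_zero _ hz) hP), ?_⟩
    filter_upwards [hDP2.continuous.continuousAt.eventually_ne hP, isOpen_ne.mem_nhds hz]
      with w hw hw'
    have h2 : w ≠ 0 := hw'
    field_simp

/-- The denominator `z^{s+1} DP(z²)` is bounded below by a multiple of `e^{lπ|Im z|}` far from the
real axis, and the numerator is smaller than this by `|Im z|^{-1/2}`. So `Q` tends to `0` along the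
diagonals, while its exponential type makes it constant. -/
theorem sinTransform_eq_zero_of_quotient (hDP : Differentiable ℂ DP) (hP0 : DP 0 ≠ 0)
    (hP : HasAsymp DP (-((s + 1 : ℕ) : ℤ)) l cP) (hcP : 0 < cP)
    (hh₁ : IntervalIntegrable h₁ volume 0 (l * Real.pi))
    (hh₁' : IntervalIntegrable (fun t => h₁ t ^ 2) volume 0 (l * Real.pi)) {Q : ℂ → ℂ}
    (hQ : Differentiable ℂ Q)
    (hFQ : ∀ z, sinTransform (l * Real.pi) h₁ z = z ^ (s + 1) * DP (z ^ 2) * Q z) (z : ℂ) :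
    sinTransform (l * Real.pi) h₁ z = 0 := by
  have ha : 0 ≤ l * Real.pi := by positivity
  set F₁ := sinTransform (l * Real.pi) h₁ with hF₁
  have hDP2 : Differentiable ℂ fun z => DP (z ^ 2) := hDP.comp (by fun_prop)
  obtain ⟨MP, hMP0, hMP⟩ := hP.exists_norm_le
  set I₁ := ∫ t in (0 : ℝ)..l * Real.pi, |h₁ t|
  have hI₁ : 0 ≤ I₁ := intervalIntegral.integral_nonneg ha fun t _ => abs_nonneg _
  set C := MP + I₁ + l * Real.pi with hC
  have hexp : ∀ (M : ℝ) (z : ℂ), 0 ≤ M → M ≤ MP + I₁ →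
      M * Real.exp (l * Real.pi * |z.im|) ≤ Real.exp (C * (1 + ‖z‖)) := by
    intro M z hM0 hM
    have h1 : M ≤ Real.exp M := by linarith [Real.add_one_le_exp M]
    calc M * Real.exp (l * Real.pi * |z.im|) ≤ Real.exp M * Real.exp (l * Real.pi * |z.im|) := by
          gcongr
      _ = Real.exp (M + l * Real.pi * |z.im|) := (Real.exp_add _ _).symm
      _ ≤ _ := by
          rw [Real.exp_le_exp, hC]
          have h2 := mul_le_mul_of_nonneg_left (Complex.abs_im_le_norm z) ha
          nlinarith [norm_nonneg z, mul_nonneg (hM0.trans hM) (norm_nonneg z)]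
  obtain ⟨A, hA⟩ := exponentialType_of_mul (g := fun z => DP (z ^ 2)) hDP2 hQ
    (by simpa using hP0) (C := C)
    (fun z hz => by
      refine le_trans ?_ (hexp MP z hMP0 (by linarith))
      refine (hMP z hz).trans (mul_le_mul_of_nonneg_left ?_ hMP0)
      refine mul_le_of_le_one_left (Real.exp_nonneg _) ?_
      rw [zpow_neg, zpow_natCast]
      exact inv_le_one_of_one_le₀ (one_le_pow₀ hz))
    (fun z hz => by
      refine le_trans ?_ (hexp I₁ z hI₁ (by linarith))
      have h1 : ‖F₁ z‖ = ‖z‖ ^ (s + 1) * ‖DP (z ^ 2) * Q z‖ := by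
        rw [hFQ z, mul_assoc, norm_mul, norm_pow]
      have h2 : 1 * ‖DP (z ^ 2) * Q z‖ ≤ ‖F₁ z‖ := by
        rw [h1]
        exact mul_le_mul_of_nonneg_right (one_le_pow₀ hz) (norm_nonneg _)
      rw [one_mul] at h2
      rw [mul_comm I₁]
      exact h2.trans (norm_transform_le ha hh₁ z).1)
  obtain ⟨T, hT⟩ := hP.exists_le_norm hcP
  set K := (1 + ∫ t in (0 : ℝ)..l * Real.pi, h₁ t ^ 2) * (2 / cP) with hK
  have hI₂ : 0 ≤ ∫ t in (0 : ℝ)..l * Real.pi, h₁ t ^ 2 :=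
    intervalIntegral.integral_nonneg ha fun t _ => sq_nonneg _
  have hK0 : 0 ≤ K := by positivity
  -- decay away from the real axis
  have hdecay : ∀ z : ℂ, 1 ≤ |z.im| → T ≤ |z.im| → ‖Q z‖ ≤ K / √|z.im| := by
    intro z hz1 hzT
    have hz : 1 ≤ ‖z‖ := hz1.trans (Complex.abs_im_le_norm z)
    have hz0 : 0 < ‖z‖ := by linarith
    have h1 := norm_sinTransform_le_div_sqrt ha hh₁ hh₁' (ρ := z)
      (abs_pos.1 (by linarith))
    have h2 := hT z hz hzT
    rw [← hF₁, hFQ z, norm_mul, norm_mul, norm_pow] at h1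
    set e := Real.exp (l * Real.pi * |z.im|) with he
    have he0 : 0 < e := Real.exp_pos _
    have h3 : cP / 2 * e ≤ ‖z‖ ^ (s + 1) * ‖DP (z ^ 2)‖ := by
      calc cP / 2 * e = ‖z‖ ^ (s + 1) * (cP / 2 * (‖z‖ ^ (-((s + 1 : ℕ) : ℤ)) * e)) := by
            rw [zpow_neg, zpow_natCast]
            field_simp
        _ ≤ _ := by gcongr
    have h4 : cP / 2 * e * ‖Q z‖ ≤
        e * ((1 + ∫ t in (0 : ℝ)..l * Real.pi, h₁ t ^ 2) / √|z.im|) :=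
      (mul_le_mul_of_nonneg_right h3 (norm_nonneg _)).trans h1
    have h5 : cP / 2 * ‖Q z‖ ≤ (1 + ∫ t in (0 : ℝ)..l * Real.pi, h₁ t ^ 2) / √|z.im| := by
      refine le_of_mul_le_mul_left ?_ he0
      linarith
    calc ‖Q z‖ = cP / 2 * ‖Q z‖ * (2 / cP) := by field_simp
      _ ≤ (1 + ∫ t in (0 : ℝ)..l * Real.pi, h₁ t ^ 2) / √|z.im| * (2 / cP) := by gcongr
      _ = _ := by rw [hK]; ring
  -- The real axis carries no lower bound for `DP`. Multiplication by `1 + i` takes the axes to the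
  -- diagonals, where `|Im (ω x)| = |x|` and the decay estimate applies.
  set ω : ℂ := 1 + Complex.I with hω
  have hω0 : ‖ω‖ ≤ 2 := (norm_add_le _ _).trans (by simp; norm_num)
  set T' := max T 1 with hT'
  obtain ⟨B, hB⟩ := (isCompact_closedBall (0 : ℂ) (2 * T')).exists_bound_of_continuousOn
    hQ.continuous.continuousOn
  have hbound : ∀ (x : ℝ) (w : ℂ), |w.im| = |x| → ‖w‖ ≤ 2 * |x| → ‖Q w‖ ≤ max B K := by
    intro x w hw hw'
    rcases le_total |x| T' with h | h
    · exact (hB w (by simpa using hw'.trans (by linarith))).trans (le_max_left _ _)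
    · have h1 : 1 ≤ |w.im| := hw ▸ (le_max_right _ _).trans h
      refine (hdecay w h1 (hw ▸ (le_max_left _ _).trans h)).trans
        ((div_le_self hK0 ?_).trans (le_max_right _ _))
      exact Real.one_le_sqrt.2 h1
  have hnω : ∀ (x : ℝ) (w : ℂ), ‖w‖ ≤ |x| → ‖ω * w‖ ≤ 2 * |x| := fun x w hw => by
    rw [norm_mul]
    gcongr
  have hconst := eq_of_bounded_on_axes (f := fun z => Q (ω * z)) (A := A) (B := 6 * C * 2)
    (C := max B K) (hQ.comp (by fun_prop))
    (fun z => by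
      refine (hA _).trans ?_
      have hA0 : 0 ≤ A := by
        have := (norm_nonneg _).trans (hA 0)
        exact nonneg_of_mul_nonneg_left this (Real.exp_pos _)
      have hC0 : 0 ≤ C := by positivity
      refine mul_le_mul_of_nonneg_left (Real.exp_le_exp.2 ?_) hA0
      rw [norm_mul, mul_assoc (6 * C) 2]
      gcongr)
    (fun x => hbound x _ (by simp [hω]) (hnω x _ (by simp)))
    (fun x => hbound x _ (by simp [hω]) (hnω x _ (by simp)))
  have hQ0 : Q 0 = 0 := by
    have hlim : Tendsto (fun x : ℝ => K / √x) atTop (𝓝 0) :=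
      tendsto_const_nhds.div_atTop Real.tendsto_sqrt_atTop
    have hle : ∀ᶠ x : ℝ in atTop, ‖Q 0‖ ≤ K / √x := by
      filter_upwards [eventually_ge_atTop T'] with x hx
      have hx1 : 1 ≤ x := (le_max_right _ _).trans hx
      have h1 : |(ω * (x : ℂ)).im| = x := by
        simp [hω, abs_of_nonneg (zero_le_one.trans hx1)]
      have h2 := hdecay (ω * x) (by rw [h1]; exact hx1) (by rw [h1]; exact (le_max_left _ _).trans hx)
      rw [h1] at h2
      have h3 : Q (ω * 0) = Q (ω * x) := hconst 0 x
      rw [mul_zero] at h3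
      rwa [h3]
    exact norm_le_zero_iff.1 (ge_of_tendsto hlim hle)
  have hω1 : ω ≠ 0 := fun h => by simpa [hω] using congrArg Complex.im h
  have h1 : Q (ω * 0) = Q (ω * (z / ω)) := hconst 0 (z / ω)
  rw [mul_zero, mul_div_cancel₀ _ hω1, hQ0] at h1
  rw [hFQ, ← h1, mul_zero]

theorem cosTransform_eq_zero (hDP : Differentiable ℂ DP) (hP0 : DP 0 ≠ 0) {F₁ F₂ : ℂ → ℂ}
    (hd₂ : Differentiable ℂ F₂) (hF₁ : ∀ z, F₁ z = 0)
    (hid : ∀ z : ℂ, z ≠ 0 → z * DP (z ^ 2) * F₂ z = DK (z ^ 2) * F₁ z) (z : ℂ) : F₂ z = 0 := by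
  have hDP2 : Differentiable ℂ fun z => DP (z ^ 2) := hDP.comp (by fun_prop)
  obtain ⟨a, ha, ha'⟩ := ((frequently_ne_zero hDP2 (a := 0) (by simpa using hP0) 0).and_eventually
    (eventually_mem_nhdsWithin)).exists
  refine eq_of_mul_eventuallyEq (g := fun z => z * DP (z ^ 2)) (differentiable_id.mul hDP2)
    (mul_ne_zero ha' ha) (p := F₂) (q := fun _ => 0) hd₂.continuous.continuousAt
    continuousAt_const (Eventually.of_forall fun w => ?_)
  change w * DP (w ^ 2) * F₂ w = w * DP (w ^ 2) * 0
  rcases eq_or_ne w 0 with rfl | hw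
  · simp
  · rw [hid w hw, hF₁, mul_zero, mul_zero]

end

end QTree
end

open MeasureTheory Set Filter Topology

noncomputable section

namespace QTree

/-! ### Uniqueness for the moment problem and the transforms -/

section

variable {a : ℝ} {h : ℝ → ℝ}

/-- Even polynomials suffice on `[0, a]`: Weierstrass' theorem is applied to `φ ∘ √` in the variable
`t²`. -/
theorem integral_mul_eq_zero_of_moments (ha : 0 ≤ a) (hh : IntervalIntegrable h volume 0 a)
    (hm : ∀ j : ℕ, ∫ t in (0 : ℝ)..a, h t * t ^ (2 * j) = 0) {φ : ℝ → ℝ} (hφ : Continuous φ) :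
    ∫ t in (0 : ℝ)..a, h t * φ t = 0 := by
  have hpoly : ∀ p : Polynomial ℝ, ∫ t in (0 : ℝ)..a, h t * p.eval (t ^ 2) = 0 := by
    intro p
    simp only [Polynomial.eval_eq_sum_range, Finset.mul_sum]
    rw [intervalIntegral.integral_finsetSum]
    · refine Finset.sum_eq_zero fun i _ => ?_
      have e : ∀ t : ℝ, h t * (p.coeff i * (t ^ 2) ^ i) = p.coeff i * (h t * t ^ (2 * i)) :=
        fun t => by rw [pow_mul]; ring
      simp only [e, intervalIntegral.integral_const_mul, hm, mul_zero]
    · exact fun i _ => hh.mul_continuousOn (by fun_prop)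
  set I := ∫ t in (0 : ℝ)..a, |h t| with hI
  have hI0 : 0 ≤ I := intervalIntegral.integral_nonneg ha fun t _ => abs_nonneg _
  have key : ∀ ε > 0, |∫ t in (0 : ℝ)..a, h t * φ t| ≤ ε * I := by
    intro ε hε
    obtain ⟨p, hp⟩ := exists_polynomial_near_of_continuousOn 0 (a ^ 2) (fun s => φ (√s))
      (hφ.comp Real.continuous_sqrt).continuousOn ε hε
    have h1 : ∫ t in (0 : ℝ)..a, h t * φ t =
        ∫ t in (0 : ℝ)..a, (h t * φ t - h t * p.eval (t ^ 2)) := by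
      rw [intervalIntegral.integral_sub (hh.mul_continuousOn hφ.continuousOn)
        (hh.mul_continuousOn (by fun_prop)), hpoly, sub_zero]
    rw [h1, hI, ← intervalIntegral.integral_const_mul, ← Real.norm_eq_abs]
    refine intervalIntegral.norm_integral_le_of_norm_le ha
      (Eventually.of_forall fun t ht => ?_) (hh.abs.const_mul _)
    have h2 := (hp (t ^ 2) ⟨by positivity, pow_le_pow_left₀ ht.1.le ht.2 2⟩).le
    rw [Real.sqrt_sq ht.1.le] at h2
    rw [← mul_sub, norm_mul, Real.norm_eq_abs, Real.norm_eq_abs, mul_comm, abs_sub_comm]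
    gcongr
  have hlim : Tendsto (fun ε : ℝ => ε * I) (𝓝[>] 0) (𝓝 0) := by
    have : Tendsto (fun ε : ℝ => ε * I) (𝓝 0) (𝓝 (0 * I)) := tendsto_id.mul_const I
    rw [zero_mul] at this
    exact this.mono_left nhdsWithin_le_nhds
  exact abs_nonpos_iff.1 (ge_of_tendsto hlim (eventually_mem_nhdsWithin.mono fun ε hε => key ε hε))

theorem ae_eq_zero_of_moments (ha : 0 ≤ a) (hh : IntervalIntegrable h volume 0 a)
    (hm : ∀ j : ℕ, ∫ t in (0 : ℝ)..a, h t * t ^ (2 * j) = 0) :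
    ∀ᵐ t, t ∈ Ioo 0 a → h t = 0 := by
  have hint : IntegrableOn h (Ioo 0 a) :=
    (intervalIntegrable_iff_integrableOn_Ioo_of_le ha).1 hh
  refine isOpen_Ioo.ae_eq_zero_of_integral_contDiff_smul_eq_zero hint.locallyIntegrableOn
    fun g hg _ hsupp => ?_
  have h1 := integral_mul_eq_zero_of_moments ha hh hm hg.continuous
  rw [intervalIntegral.integral_of_le ha, integral_Ioc_eq_integral_Ioo] at h1
  rw [← h1, ← setIntegral_eq_integral_of_forall_compl_eq_zero (s := Ioo 0 a)]
  · exact integral_congr_ae (Eventually.of_forall fun t => mul_comm _ _)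
  · intro t ht
    rw [image_eq_zero_of_notMem_tsupport fun h' => ht (hsupp h'), zero_smul]

/-- Two derivatives of the cosine transform give, up to sign, the transform of `t² h`; the value at
`0` is the zeroth moment. -/
theorem cosTransform_mul_sq_eq_zero (ha : 0 ≤ a) (j : ℕ) :
    ∀ {h : ℝ → ℝ}, IntervalIntegrable h volume 0 a → (∀ z, cosTransform a h z = 0) →
      ∫ t in (0 : ℝ)..a, h t * t ^ (2 * j) = 0 := by
  induction j with
  | zero =>
    intro h hh h0
    have := cosTransform_ofReal hh 0
    rw [h0] at this
    simpa using this.symm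
  | succ j ih =>
    intro h hh h0
    have hth : IntervalIntegrable (fun t => t * h t) volume 0 a :=
      hh.continuousOn_mul continuousOn_id
    have htth : IntervalIntegrable (fun t => t * (t * h t)) volume 0 a :=
      hth.continuousOn_mul continuousOn_id
    have h1 : ∀ z, sinTransform a (fun t => t * h t) z = 0 := fun z => by
      have h2 := hasDerivAt_cosTransform ha hh z
      rw [show cosTransform a h = fun _ => 0 from funext h0] at h2
      exact neg_eq_zero.1 (h2.unique (hasDerivAt_const z (0 : ℂ)))
    have h2 : ∀ z, cosTransform a (fun t => t * (t * h t)) z = 0 := fun z => by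
      have h2 := hasDerivAt_sinTransform ha hth z
      rw [show sinTransform a (fun t => t * h t) = fun _ => 0 from funext h1] at h2
      exact h2.unique (hasDerivAt_const z (0 : ℂ))
    refine Eq.trans ?_ (ih htth h2)
    refine intervalIntegral.integral_congr fun t _ => ?_
    ring

theorem ae_eq_zero_of_cosTransform (ha : 0 ≤ a) (hh : IntervalIntegrable h volume 0 a)
    (h0 : ∀ z, cosTransform a h z = 0) : ∀ᵐ t, t ∈ Ioo 0 a → h t = 0 :=
  ae_eq_zero_of_moments ha hh fun j => cosTransform_mul_sq_eq_zero ha j hh h0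

theorem ae_eq_zero_of_sinTransform (ha : 0 ≤ a) (hh : IntervalIntegrable h volume 0 a)
    (h0 : ∀ z, sinTransform a h z = 0) : ∀ᵐ t, t ∈ Ioo 0 a → h t = 0 := by
  have hth : IntervalIntegrable (fun t => t * h t) volume 0 a :=
    hh.continuousOn_mul continuousOn_id
  have h1 : ∀ z, cosTransform a (fun t => t * h t) z = 0 := fun z => by
    have h2 := hasDerivAt_sinTransform ha hh z
    rw [show sinTransform a h = fun _ => 0 from funext h0] at h2
    exact h2.unique (hasDerivAt_const z (0 : ℂ))
  filter_upwards [ae_eq_zero_of_cosTransform ha hth h1] with t ht hta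
  exact (mul_eq_zero.1 (ht hta)).resolve_left hta.1.ne'

end

/-! ### Orthogonality in the Hilbert space -/

theorem inner_vec (a : ℝ) (f g : C(ℝ, ℝ)) (x : HSpace a) (ha : 0 ≤ a) :
    inner ℝ (vec a f g) x = (∫ t in (0 : ℝ)..a, x.fst t * f t) +
      ∫ t in (0 : ℝ)..a, x.snd t * g t := by
  have key : ∀ (f : C(ℝ, ℝ)) (y : Lp ℝ 2 (volume.restrict (Ioo 0 a))),
      inner ℝ ((memLp_of_continuous a f.continuous).toLp f) y =
        ∫ t in (0 : ℝ)..a, y t * f t := by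
    intro f y
    rw [L2.inner_def, intervalIntegral.integral_of_le ha, integral_Ioc_eq_integral_Ioo]
    refine integral_congr_ae ?_
    filter_upwards [(memLp_of_continuous a f.continuous).coeFn_toLp] with t ht
    rw [ht]
    rfl
  rw [WithLp.prod_inner_apply]
  exact congrArg₂ (· + ·) (key f _) (key g _)

theorem isCompleteSystem_iff {a : ℝ} {S : Set (HSpace a)} :
    IsCompleteSystem S ↔ ∀ x : HSpace a, (∀ v ∈ S, inner ℝ v x = 0) → x = 0 := by
  rw [IsCompleteSystem, Submodule.topologicalClosure_eq_top_iff, Submodule.eq_bot_iff]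
  refine forall_congr' fun x => imp_congr_left ?_
  rw [Submodule.mem_orthogonal]
  refine ⟨fun h v hv => h v (Submodule.subset_span hv), fun h v hv => ?_⟩
  induction hv using Submodule.span_induction with
  | mem v hv => exact h v hv
  | zero => exact inner_zero_left x
  | add u v _ _ hu hv => rw [inner_add_left, hu, hv, add_zero]
  | smul c v _ hv => rw [real_inner_smul_left, hv, mul_zero]

theorem inner_sVec {a : ℝ} (ha : 0 ≤ a) (ΔK ΔPi : ℂ → ℂ) (lam : ℝ) (x : HSpace a) :
    inner ℝ (sVec a ΔK ΔPi lam) x =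
      (ΔK lam).re * ((√lam)⁻¹ * ∫ t in (0 : ℝ)..a, x.fst t * Real.sin (√lam * t)) +
        (ΔPi lam).re * ∫ t in (0 : ℝ)..a, x.snd t * Real.cos (√lam * t) := by
  rw [sVec, inner_vec _ _ _ _ ha, ← intervalIntegral.integral_const_mul,
    ← intervalIntegral.integral_const_mul, ← intervalIntegral.integral_const_mul]
  congr 1 <;> refine intervalIntegral.integral_congr fun t _ => ?_
  · change x.fst t * ((ΔK lam).re * ((√lam)⁻¹ * Real.sin (√lam * t))) = _
    ring
  · change x.snd t * ((ΔPi lam).re * Real.cos (√lam * t)) = _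
    ring

theorem inner_sMono {a : ℝ} (ha : 0 ≤ a) (j : ℕ) (x : HSpace a) :
    inner ℝ (sMono a j) x = if Even j then ∫ t in (0 : ℝ)..a, x.snd t * t ^ j
      else ∫ t in (0 : ℝ)..a, x.fst t * t ^ j := by
  rw [sMono]
  split_ifs
  · rw [inner_vec _ _ _ _ ha]
    simp
  · rw [inner_vec _ _ _ _ ha]
    simp

theorem intervalIntegrable_of_Lp {a : ℝ} (ha : 0 ≤ a)
    (y : Lp ℝ 2 (volume.restrict (Ioo 0 a))) :
    IntervalIntegrable y volume 0 a ∧ IntervalIntegrable (fun t => y t ^ 2) volume 0 a := by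
  rw [intervalIntegrable_iff_integrableOn_Ioo_of_le ha,
    intervalIntegrable_iff_integrableOn_Ioo_of_le ha]
  exact ⟨(Lp.memLp y).integrable one_le_two, (Lp.memLp y).integrable_sq⟩

theorem Lp_eq_zero {a : ℝ} {y : Lp ℝ 2 (volume.restrict (Ioo 0 a))}
    (h : ∀ᵐ t, t ∈ Ioo 0 a → y t = 0) : y = 0 := by
  rw [Lp.eq_zero_iff_ae_eq_zero]
  exact (ae_restrict_iff' measurableSet_Ioo).2 h

/-- The orthogonality relation at an eigenvalue, as a relation between the transforms. -/
theorem transform_relation {DKk DPk DKu DPu : ℂ → ℂ} {a ρ : ℝ} {h₁ h₂ : ℝ → ℝ}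
    (hh₁ : IntervalIntegrable h₁ volume 0 a) (hh₂ : IntervalIntegrable h₂ volume 0 a)
    (hρ : ρ ≠ 0) (hKim : (DKk (ρ ^ 2 : ℝ)).im = 0) (hPim : (DPk (ρ ^ 2 : ℝ)).im = 0)
    (hrel : DKk (ρ ^ 2 : ℝ) * DPu (ρ ^ 2 : ℝ) + DPk (ρ ^ 2 : ℝ) * DKu (ρ ^ 2 : ℝ) = 0)
    (hP0 : DPk (ρ ^ 2 : ℝ) ≠ 0)
    (horth : (DKk (ρ ^ 2 : ℝ)).re *
        ((√(ρ ^ 2))⁻¹ * ∫ t in (0 : ℝ)..a, h₁ t * Real.sin (√(ρ ^ 2) * t)) +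
      (DPk (ρ ^ 2 : ℝ)).re * ∫ t in (0 : ℝ)..a, h₂ t * Real.cos (√(ρ ^ 2) * t) = 0) :
    (ρ : ℂ) * DPu (ρ ^ 2) * cosTransform a h₂ ρ = DKu (ρ ^ 2) * sinTransform a h₁ ρ := by
  rw [Real.sqrt_sq_eq_abs] at horth
  have h1 : (DKk (ρ ^ 2 : ℝ)) * (((|ρ| : ℝ) : ℂ)⁻¹ * sinTransform a h₁ (|ρ| : ℝ)) +
      DPk (ρ ^ 2 : ℝ) * cosTransform a h₂ (|ρ| : ℝ) = 0 := by
    have hre : ∀ c : ℂ, c.im = 0 → c = ((c.re : ℝ) : ℂ) := fun c hc =>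
      Complex.ext rfl (by simpa using hc)
    rw [sinTransform_ofReal hh₁, cosTransform_ofReal hh₂, hre _ hKim, hre _ hPim]
    exact_mod_cast horth
  have habs : ((|ρ| : ℝ) : ℂ) ≠ 0 := by exact_mod_cast abs_ne_zero.2 hρ
  have h2 : ((|ρ| : ℝ) : ℂ) * DPu (ρ ^ 2 : ℝ) * cosTransform a h₂ (|ρ| : ℝ) =
      DKu (ρ ^ 2 : ℝ) * sinTransform a h₁ (|ρ| : ℝ) := by
    refine mul_left_cancel₀ hP0 ?_
    have h3 : DKk (ρ ^ 2 : ℝ) * sinTransform a h₁ (|ρ| : ℝ) +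
        ((|ρ| : ℝ) : ℂ) * (DPk (ρ ^ 2 : ℝ) * cosTransform a h₂ (|ρ| : ℝ)) = 0 := by
      field_simp at h1
      linear_combination h1
    linear_combination DPu (ρ ^ 2 : ℝ) * h3 - sinTransform a h₁ (|ρ| : ℝ) * hrel
  rw [Complex.ofReal_pow] at h2
  -- The relation is known at `|ρ| = √(ρ²)`. Both of its sides are odd in `ρ`, so it holds at `ρ`.
  rcases abs_choice ρ with h | h
  · rwa [h] at h2
  · rw [h, Complex.ofReal_neg, sinTransform_neg, cosTransform_neg] at h2
    linear_combination -h2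

end QTree

end

/-! ### Completeness of the system -/

theorem theorem3 {V : Type*} [Fintype V] (P : QTree.Problem V)
    (Gknown Gunknown : P.G.Subgraph) (w : V) (hdiv : P.IsDivision Gknown Gunknown w)
    (l r : ℕ) (hl : Gunknown.edgeSet.ncard = l)
    (hr : P.numDirichlet Gunknown = r) (hodd : Odd r)
    (α : Fin l → ℝ) (hα : ∀ k, α k ∈ Set.Ioo (0 : ℝ) (1 / 2))
    (ρ lam : ℤ → Fin l → ℝ)
    (hlam : ∀ n k, lam n k = ρ n k ^ 2)
    (hspec : ∀ n k, (lam n k : ℂ) ∈ P.spectrum)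
    (hasymp : ∀ k, Summable fun n : ℤ => (ρ n k - (n + α k)) ^ 2)
    -- the eigenvalues chosen are distinct and positive
    (A1 : Set.InjOn (fun p : ℤ × Fin l => lam p.1 p.2) (QTree.indexSet l r) ∧
      ∀ p ∈ QTree.indexSet l r, 0 < lam p.1 p.2)
    (A2 : ∀ p ∈ QTree.indexSet l r,
      P.charPi Gknown w (lam p.1 p.2) ≠ 0 ∧ P.charPi Gunknown w (lam p.1 p.2) ≠ 0)
    (A3 : P.charK Gunknown w 0 ≠ 0 ∧ P.charPi Gunknown w 0 ≠ 0)
    (A4 : ∀ z : ℂ, ¬ (P.charK Gunknown w z = 0 ∧ P.charPi Gunknown w z = 0)) :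
    QTree.IsCompleteSystem
      ((fun p : ℤ × Fin l => QTree.sVec (l * Real.pi) (P.charK Gknown w) (P.charPi Gknown w)
          (lam p.1 p.2)) '' QTree.indexSet l r ∪
        QTree.sMono (l * Real.pi) '' {j : ℕ | j + 1 < r}) := by
  classical
  obtain ⟨s, rfl⟩ : ∃ s, r = s + 1 := ⟨r - 1, (Nat.sub_add_cancel hodd.pos).symm⟩
  have hseven : Even s := by
    rw [Nat.odd_add_one] at hodd
    exact Nat.not_odd_iff_even.1 hodd
  have ha : 0 ≤ l * Real.pi := by positivity
  obtain ⟨cP, hcP, hP⟩ := QTree.Problem.hasAsymp_charPi Gunknown w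
  obtain ⟨cK, -, hK⟩ := QTree.Problem.hasAsymp_charK Gunknown w hdiv.exists_adj
  rw [← hdiv.numDirichlet_eq, ← hdiv.ncard_edgeSet_eq, hl, hr] at hP hK
  have hDP := QTree.Problem.differentiable_charPi Gunknown w
  have hDK := QTree.Problem.differentiable_charK Gunknown w
  rw [QTree.isCompleteSystem_iff]
  intro x hx
  obtain ⟨hh₁, hh₁'⟩ := QTree.intervalIntegrable_of_Lp ha x.fst
  obtain ⟨hh₂, -⟩ := QTree.intervalIntegrable_of_Lp ha x.snd
  have hne : ∀ p ∈ QTree.indexSet l (s + 1), ρ p.1 p.2 ≠ 0 := fun p hp h0 => by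
    have := A1.2 p hp
    rw [hlam, h0] at this
    norm_num at this
  have hmono : ∀ j < s, inner ℝ (QTree.sMono (l * Real.pi) j) x = 0 := fun j hj =>
    hx _ (Or.inr ⟨j, by simpa using hj, rfl⟩)
  have hs₁ : ((s + 1 : ℕ) : ℕ∞) ≤
      analyticOrderAt (QTree.sinTransform (l * Real.pi) x.fst) 0 := by
    refine (QTree.le_analyticOrderAt_transform ha (s + 1) hh₁).1 fun j hj hjodd => ?_
    -- The oddness of `r` enters here: `s = r - 1` is even, so the odd moment conditions below `s +
    -- 1` involve only `j < s`, and `F₁` vanishes to one order more than there are monomials.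
    have hjs : j ≠ s := fun h => (Nat.not_even_iff_odd.2 hjodd) (h ▸ hseven)
    have := hmono j (by omega)
    rwa [QTree.inner_sMono ha, if_neg (Nat.not_even_iff_odd.2 hjodd)] at this
  have hs₂ : (s : ℕ∞) ≤ analyticOrderAt (QTree.cosTransform (l * Real.pi) x.snd) 0 := by
    refine (QTree.le_analyticOrderAt_transform ha s hh₂).2 fun j hj hjeven => ?_
    have := hmono j hj
    rwa [QTree.inner_sMono ha, if_pos hjeven] at this
  have hzero : ∀ p ∈ QTree.indexSet l (s + 1),
      (ρ p.1 p.2 : ℂ) * P.charPi Gunknown w (ρ p.1 p.2 ^ 2) *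
          QTree.cosTransform (l * Real.pi) x.snd (ρ p.1 p.2) =
        P.charK Gunknown w (ρ p.1 p.2 ^ 2) *
          QTree.sinTransform (l * Real.pi) x.fst (ρ p.1 p.2) := by
    intro p hp
    obtain ⟨h1, h2⟩ := A2 p hp
    have h3 := hdiv.charK_charPi_relation (hspec p.1 p.2) h1 h2
    have h4 := hx _ (Or.inl ⟨p, hp, rfl⟩)
    rw [QTree.inner_sVec ha] at h4
    rw [hlam] at h1 h3 h4
    exact QTree.transform_relation hh₁ hh₂ (hne p hp)
      (QTree.Problem.charK_im Gknown w (Complex.ofReal_im _))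
      (QTree.Problem.charPi_im Gknown w (Complex.ofReal_im _)) h3 h1 h4
  have hinj : Set.InjOn (fun p : ℤ × Fin l => ρ p.1 p.2 ^ 2) (QTree.indexSet l (s + 1)) := by
    simpa only [hlam] using A1.1
  have hid := fun z (hz : z ≠ 0) => QTree.transform_identity
    (fun k => ⟨(hα k).1, by linarith [(hα k).2]⟩) hasymp hinj hne hDP hDK hP hK hh₁ hh₂ hs₁ hs₂
    hzero (z := z) hz
  obtain ⟨Q, hQ, hFQ⟩ := QTree.exists_transform_quotient hDP hDK A3.2 A4
    (QTree.differentiable_sinTransform ha hh₁) (QTree.differentiable_cosTransform ha hh₂) hs₁ hid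
  have hF₁ := QTree.sinTransform_eq_zero_of_quotient hDP A3.2 hP hcP hh₁ hh₁' hQ hFQ
  have hF₂ := QTree.cosTransform_eq_zero hDP A3.2 (QTree.differentiable_cosTransform ha hh₂)
    hF₁ hid
  have hx₁ := QTree.Lp_eq_zero (QTree.ae_eq_zero_of_sinTransform ha hh₁ hF₁)
  have hx₂ := QTree.Lp_eq_zero (QTree.ae_eq_zero_of_cosTransform ha hh₂ hF₂)
  exact (WithLp.ofLp_injective 2) (Prod.ext hx₁ hx₂)
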